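/- An instance of Diverse Knapsack consists of a set $P$ of $m$ items, a set $V$ of $n$ voters, costs $c : P \to \mathbb{N}$, utility functions $\mathrm{util}_v : P \to \mathbb{N}$ for $v \in V$, and a budget $b \in \mathbb{N}$, where $\mathbb{N}$ includes $0$ and all numbers are encoded in binary. A bundle $Z \subseteq P$ is feasible if $\sum_{p \in Z} c(p) \le b$, and the task is to find a feasible bundle that maximizes $\mathrm{util}(Z) = \sum_{v \in V} \max_{p \in Z} \mathrm{util}_v(p)$ (the maximum over the empty bundle being $0$). The utility profile is single-peaked if there is a linear order $\triangleleft$ on $P$ such that every voter $v$ has a most preferred item $\mathrm{top}_v$ (one maximizing $\mathrm{util}_v$) with $\mathrm{util}_v(p') \ge \mathrm{util}_v(p)$ whenever $p \triangleleft p' \triangleleft \mathrm{top}_v$ or $\mathrm{top}_v \triangleleft p' \triangleleft p$. It is single-crossing if there is a linear order on $V$ such that for all items $p, p'$ the set $\{v \in V : \mathrm{util}_v(p) \ge \mathrm{util}_v(p')\}$ is a (possibly empty) consecutive block of that order. Theorem. Diverse Knapsack admits a fully polynomial-time approximation scheme (FPTAS) on the instances whose utility profile is single-peaked or single-crossing.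 That is, there is one algorithm which, given a rational $\varepsilon > 0$ and an instance whose profile is single-peaked or single-crossing (the order is not part of the input), returns a feasible bundle $Z$ such that every feasible bundle $S$ satisfies $\mathrm{util}(S) \le (1+\varepsilon)\,\mathrm{util}(Z)$, and hence $\mathrm{util}(Z) \ge (1-\varepsilon)\,\mathrm{util}(S)$; its running time, counted in steps of a random access machine whose unit-cost arithmetic operations are addition and truncated subtraction, is at most a polynomial in the bit size of the instance and $1/\varepsilon$. -/

import Mathlib

/-! ### Diverse Knapsack -/

/-- An instance of Diverse Knapsack (optimization version): `n` voters, `m` items, a cost for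
every item, a utility of every voter for every item, and a budget. -/
structure DiverseKnapsack where
  n : ℕ
  m : ℕ
  cost : Fin m → ℕ
  util : Fin n → Fin m → ℕ
  budget : ℕ

namespace DiverseKnapsack

/-- A bundle is feasible if its total cost is within the budget. -/
def Feasible (I : DiverseKnapsack) (Z : Finset (Fin I.m)) : Prop :=
  ∑ p ∈ Z, I.cost p ≤ I.budget

/-- Total satisfaction: each voter contributes the largest utility it has for an item of the
bundle (`0` for the empty bundle). -/
def satisfaction (I : DiverseKnapsack) (Z : Finset (Fin I.m)) : ℕ :=
  ∑ v : Fin I.n, Z.sup (I.util v)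

/-- `σ` gives the position of every item in the ordering; `top` is a most preferred item of the
voter `v`. -/
def SinglePeaked (I : DiverseKnapsack) : Prop :=
  ∃ σ : Equiv.Perm (Fin I.m), ∀ v : Fin I.n, ∃ top : Fin I.m,
    (∀ p, I.util v p ≤ I.util v top) ∧
    ∀ p p', (σ p < σ p' ∧ σ p' < σ top ∨ σ top < σ p' ∧ σ p' < σ p) →
      I.util v p ≤ I.util v p'

/-- `σ` gives the position of every voter in the ordering; for any two items, the voters who
weakly prefer the first to the second occupy a (possibly empty) block of consecutive positions. -/
def SingleCrossing (I : DiverseKnapsack) : Prop :=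
  ∃ σ : Equiv.Perm (Fin I.n), ∀ p p' : Fin I.m,
    (σ '' {v | I.util v p' ≤ I.util v p}).OrdConnected

/-- The instance as a list of numbers: `n`, `m`, the budget, the costs, and the utilities voter
by voter. -/
def encode (I : DiverseKnapsack) : List ℕ :=
  [I.n, I.m, I.budget] ++ List.ofFn I.cost ++
    (List.ofFn fun v => List.ofFn (I.util v)).flatten

/-- The size of an instance: the number of bits of its encoding, all numbers written in binary,
with one further bit per number as a separator. -/
def size (I : DiverseKnapsack) : ℕ :=
  (I.encode.map fun x => Nat.size x + 1).sum

/-- A bundle as its characteristic `0`-`1` vector. -/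
def encodeBundle (I : DiverseKnapsack) (Z : Finset (Fin I.m)) : List ℕ :=
  List.ofFn fun p => if p ∈ Z then 1 else 0

end DiverseKnapsack

/-! ### Random access machine programs

Programs of a random access machine, in structured form, working on natural-number registers and
on arrays (memory with indirect addressing). The only arithmetic operations are addition and
truncated subtraction, and every operation takes one step; since one step makes the numbers in
memory longer by at most one bit, polynomially many steps in this model are the same as polynomial
time on Turing machines. -/

namespace RAM

/-- Contents of the registers and of the arrays. -/
@[ext]
structure Store where
  reg : ℕ → ℕ
  arr : ℕ → ℕ → ℕ

/-- Expressions: constants, registers, array cells, sums, and truncated differences. -/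
inductive Expr where
  | lit (k : ℕ)
  | reg (x : ℕ)
  | cell (a : ℕ) (i : Expr)
  | add (e f : Expr)
  | sub (e f : Expr)

/-- The value of an expression. -/
def Expr.eval (s : Store) : Expr → ℕ
  | .lit k => k
  | .reg x => s.reg x
  | .cell a i => s.arr a (i.eval s)
  | .add e f => e.eval s + f.eval s
  | .sub e f => e.eval s - f.eval s

/-- The number of steps that the evaluation of an expression takes: one for every node. -/
def Expr.steps : Expr → ℕ
  | .lit _ => 1
  | .reg _ => 1
  | .cell _ i => i.steps + 1
  | .add e f => e.steps + f.steps + 1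
  | .sub e f => e.steps + f.steps + 1

/-- Programs. A test succeeds if the value of its expression is not zero. -/
inductive Prog where
  | skip
  | assign (x : ℕ) (e : Expr)
  | store (a : ℕ) (i e : Expr)
  | seq (c d : Prog)
  | ite (e : Expr) (c d : Prog)
  | while (e : Expr) (c : Prog)

/-- Assignment to a register. -/
def Store.setReg (s : Store) (x k : ℕ) : Store :=
  { s with reg := Function.update s.reg x k }

/-- Assignment to an array cell. -/
def Store.setCell (s : Store) (a i k : ℕ) : Store :=
  { s with arr := Function.update s.arr a (Function.update (s.arr a) i k) }

/-- `Exec c s s' t`: started in `s`, the program `c` halts in `s'` after exactly `t` steps. -/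
inductive Exec : Prog → Store → Store → ℕ → Prop where
  | skip (s : Store) : Exec .skip s s 1
  | assign (s : Store) (x : ℕ) (e : Expr) :
      Exec (.assign x e) s (s.setReg x (e.eval s)) (e.steps + 1)
  | store (s : Store) (a : ℕ) (i e : Expr) :
      Exec (.store a i e) s (s.setCell a (i.eval s) (e.eval s)) (i.steps + e.steps + 1)
  | seq {c d : Prog} {s s' s'' : Store} {t t' : ℕ} :
      Exec c s s' t → Exec d s' s'' t' → Exec (.seq c d) s s'' (t + t')
  | ite_true {e : Expr} {c d : Prog} {s s' : Store} {t : ℕ} :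
      e.eval s ≠ 0 → Exec c s s' t → Exec (.ite e c d) s s' (e.steps + 1 + t)
  | ite_false {e : Expr} {c d : Prog} {s s' : Store} {t : ℕ} :
      e.eval s = 0 → Exec d s s' t → Exec (.ite e c d) s s' (e.steps + 1 + t)
  | while_true {e : Expr} {c : Prog} {s s' s'' : Store} {t t' : ℕ} :
      e.eval s ≠ 0 → Exec c s s' t → Exec (.while e c) s' s'' t' →
      Exec (.while e c) s s'' (e.steps + 1 + t + t')
  | while_false {e : Expr} {c : Prog} {s : Store} :
      e.eval s = 0 → Exec (.while e c) s s (e.steps + 1)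

/-- Execution is deterministic, in its result and in its number of steps. -/
theorem Exec.deterministic {c : Prog} {s s₁ s₂ : Store} {t₁ t₂ : ℕ}
    (h₁ : Exec c s s₁ t₁) (h₂ : Exec c s s₂ t₂) : s₁ = s₂ ∧ t₁ = t₂ := by
  induction h₁ generalizing s₂ t₂ with
  | skip | assign | store => cases h₂; exact ⟨rfl, rfl⟩
  | seq _ _ ih ih' =>
    cases h₂ with
    | seq h h' =>
      obtain ⟨rfl, rfl⟩ := ih h
      obtain ⟨rfl, rfl⟩ := ih' h'
      exact ⟨rfl, rfl⟩
  | ite_true he _ ih =>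
    cases h₂ with
    | ite_true _ h => obtain ⟨rfl, rfl⟩ := ih h; exact ⟨rfl, rfl⟩
    | ite_false he' _ => exact absurd he' he
  | ite_false he _ ih =>
    cases h₂ with
    | ite_true he' _ => exact absurd he he'
    | ite_false _ h => obtain ⟨rfl, rfl⟩ := ih h; exact ⟨rfl, rfl⟩
  | while_true he _ _ ih ih' =>
    cases h₂ with
    | while_true _ h h' =>
      obtain ⟨rfl, rfl⟩ := ih h
      obtain ⟨rfl, rfl⟩ := ih' h'
      exact ⟨rfl, rfl⟩
    | while_false he' => exact absurd he' he
  | while_false he =>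
    cases h₂ with
    | while_true he' _ _ => exact absurd he he'
    | while_false _ => exact ⟨rfl, rfl⟩

/-- The initial store: the input in array `0`, its length in register `0`, zero elsewhere. -/
def Store.ofInput (l : List ℕ) : Store where
  reg x := if x = 0 then l.length else 0
  arr a i := if a = 0 then l.getD i 0 else 0

/-- The output of a final store, by the same convention. -/
def Store.output (s : Store) : List ℕ :=
  (List.range (s.reg 0)).map (s.arr 0)

/-- On the given input, `c` halts after exactly `t` steps with the given output. -/
def Computes (c : Prog) (input output : List ℕ) (t : ℕ) : Prop :=
  ∃ s : Store, Exec c (Store.ofInput input) s t ∧ s.output = output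

end RAM

/-- The program `c` is a fully polynomial-time approximation scheme for Diverse Knapsack on the
instances that satisfy `D`: given a rational `ε > 0` (numerator and denominator) and an instance,
it returns a feasible bundle whose satisfaction is at least `1 - ε` times, and even at least
`1 / (1 + ε)` times, that of every feasible bundle, and the number of its steps is at most a fixed
polynomial in the size of the instance and `1 / ε`. -/
def RAM.Prog.IsFPTASOn (c : RAM.Prog) (D : DiverseKnapsack → Prop) : Prop :=
  ∃ q : Polynomial ℕ, ∀ I : DiverseKnapsack, D I → ∀ ε : ℚ, 0 < ε →
    ∃ (Z : Finset (Fin I.m)) (t : ℕ),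
      RAM.Computes c ([ε.num.toNat, ε.den] ++ I.encode) (I.encodeBundle Z) t ∧
      t ≤ q.eval (I.size + ⌈1 / ε⌉₊) ∧
      I.Feasible Z ∧
      ∀ S : Finset (Fin I.m), I.Feasible S →
        (1 - ε) * (I.satisfaction S : ℚ) ≤ (I.satisfaction Z : ℚ) ∧
        (I.satisfaction S : ℚ) ≤ (1 + ε) * (I.satisfaction Z : ℚ)

/-! The problem becomes a search for good walks in a graph with polynomially many nodes. Every step
of a walk pays for one item and gains some utility. The items collected by a walk have total
satisfaction at least the utility gained and total cost at most the cost paid (`Reach.le_sat`,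
`Reach.basic`). Conversely, on the allowed profiles every nonempty bundle is matched by a walk that
gains its satisfaction, costs no more and has at most as many steps as the bundle has items
(`hasWalks`).

Single-peaked profiles: a walk visits items along the axis, and a voter gains the truncated
difference between the new item and the previous one. To find an axis, note that a voter who ranks
`b` strictly below `a` and `a'` keeps `b` from standing between them, so the order of `(a, b)`
forces that of `(a', b)`. Forcing divides the ordered pairs into classes. From each class and its
reversal, the one that contains the lexicographically smaller pair is chosen. If some axis exists,
no pair forces its reversal (`not_forces_swap`), and a triangle lemma as for transitive orientations
(`triangle`, `Before.trans`) shows that the choice is a linear order and an axis (`hasAxis`).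

Single-crossing profiles: the first voter `g` is guessed. The number of weak comparisons shared with
`g` never grows along the order of the voters, so sorting by it gives a usable order
(`CrossesFrom.of_ahead`). With a suitable tie-breaking the best items of a bundle are monotone along
this order (`CrossesFrom.exists_assignment`). The voters thus split into consecutive blocks, each
served by one item, and a node records the guess, the last voter of the block and the item.

Approximation: let `K = ⌈1 / ε⌉` and let `peak` be the largest total utility of an affordable item.
Gains are rounded down to multiples of `peak / ((K + 1) * m)`, and dynamic programming finds the
least cost for every number of steps, last node and rounded utility. At most `m` roundings lose at
most `peak / (K + 1)` in all. Since a single item already attains `peak`, this gives the ratio `(K +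
1) / K ≤ 1 + ε` (`chosen_approx`).

The machine program is assembled from closure properties: functions built from bounded sums have
programs that are polynomial in a few parameter registers (`Definable`), and a table is filled by
recursion on the index (`exec_tabulate`). -/

namespace RAM

/-! ### Definable functions and decidable predicates on the machine -/

theorem exec_while {e : Expr} {c : Prog} {n T : ℕ} (I : ℕ → Store → Prop)
    (guard : ∀ j s, I j s → (e.eval s ≠ 0 ↔ j < n))
    (body : ∀ j s, j < n → I j s → ∃ s' t, Exec c s s' t ∧ t ≤ T ∧ I (j + 1) s')
    {s : Store} (h₀ : I 0 s) :
    ∃ s' t, Exec (.while e c) s s' t ∧ t ≤ n * (e.steps + 1 + T) + (e.steps + 1) ∧ I n s' := by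
  suffices H : ∀ r j s, j + r = n → I j s →
      ∃ s' t, Exec (.while e c) s s' t ∧ t ≤ r * (e.steps + 1 + T) + (e.steps + 1) ∧ I n s' from
    H n 0 s (by simp) h₀
  intro r
  induction r with
  | zero =>
    intro j s hj hI
    obtain rfl : j = n := by simpa using hj
    refine ⟨s, _, .while_false ?_, by simp, hI⟩
    by_contra h
    exact lt_irrefl _ ((guard _ _ hI).1 h)
  | succ r ih =>
    intro j s hj hI
    have hjn : j < n := by omega
    obtain ⟨s', t, h, ht, hI'⟩ := body j s hjn hI
    obtain ⟨s'', t', h', ht', hI''⟩ := ih (j + 1) s' (by omega) hI'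
    refine ⟨s'', _, .while_true ((guard _ _ hI).2 hjn) h h', ?_, hI''⟩
    rw [Nat.succ_mul]
    omega

/-- The registers below this number are reserved for parameters, which bound all loops. -/
def numParams : ℕ := 16

/-- Types of contexts of a computation: a store together with finitely many local variables, which
are kept in registers at given locations. -/
class Ctx (Γ : Type) where
  Loc : Type
  Bdd : Loc → ℕ → Prop
  Rep : Loc → Γ → Store → Prop
  store : Γ → Store
  bdd_mono : ∀ {ℓ d d'}, Bdd ℓ d → d ≤ d' → Bdd ℓ d'
  le_of_bdd : ∀ {ℓ d}, Bdd ℓ d → numParams ≤ d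
  rep_congr : ∀ {ℓ d γ s s'}, Bdd ℓ d → Rep ℓ γ s → s'.arr = s.arr →
    (∀ x < d, s'.reg x = s.reg x) → Rep ℓ γ s'
  rep_arr : ∀ {ℓ γ s}, Rep ℓ γ s → s.arr = (store γ).arr
  rep_reg : ∀ {ℓ γ s}, Rep ℓ γ s → ∀ x < numParams, s.reg x = (store γ).reg x

/-- A bare store has no local variables. Registers from `numParams` on are scratch space, so only
the arrays and the parameters have to agree. -/
instance : Ctx Store where
  Loc := Unit
  Bdd _ d := numParams ≤ d
  Rep _ s₀ s := s.arr = s₀.arr ∧ ∀ x < numParams, s.reg x = s₀.reg x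
  store s := s
  bdd_mono h h' := h.trans h'
  le_of_bdd h := h
  rep_congr h hr ha hx := ⟨ha.trans hr.1, fun x hlt => (hx x (hlt.trans_le h)).trans (hr.2 x hlt)⟩
  rep_arr h := h.1
  rep_reg h := h.2

instance {Γ : Type} [Ctx Γ] : Ctx (Γ × ℕ) where
  Loc := Ctx.Loc Γ × ℕ
  Bdd ℓ d := Ctx.Bdd ℓ.1 d ∧ ℓ.2 < d
  Rep ℓ γ s := Ctx.Rep ℓ.1 γ.1 s ∧ s.reg ℓ.2 = γ.2
  store γ := Ctx.store γ.1
  bdd_mono h h' := ⟨Ctx.bdd_mono h.1 h', h.2.trans_le h'⟩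
  le_of_bdd h := Ctx.le_of_bdd h.1
  rep_congr h hr ha hx := ⟨Ctx.rep_congr h.1 hr.1 ha hx, (hx _ h.2).trans hr.2⟩
  rep_arr h := Ctx.rep_arr h.1
  rep_reg h := Ctx.rep_reg h.1

/-- Started in `s`, the program `c` leaves the arrays and the registers below `d` unchanged and
writes `v` into register `d`, in at most `T` steps. -/
def Yields (c : Prog) (d : ℕ) (s : Store) (v T : ℕ) : Prop :=
  ∃ s' t, Exec c s s' t ∧ t ≤ T ∧ s'.arr = s.arr ∧ (∀ x < d, s'.reg x = s.reg x) ∧ s'.reg d = v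

/-- The function `f` is computed by a program in time polynomial in the parameters. -/
def Definable {Γ : Type} [Ctx Γ] (f : Γ → ℕ) : Prop :=
  ∀ (ℓ : Ctx.Loc Γ) (d : ℕ), Ctx.Bdd ℓ d → ∃ (c : Prog) (q : Polynomial ℕ), ∀ γ s B,
    Ctx.Rep ℓ γ s → (∀ x < numParams, s.reg x ≤ B) → Yields c d s (f γ) (q.eval B)

/-- The predicate `P` is decided by a program in time polynomial in the parameters. -/
def Decides {Γ : Type} [Ctx Γ] (P : Γ → Prop) : Prop :=
  ∃ f : Γ → ℕ, Definable f ∧ ∀ γ, f γ ≠ 0 ↔ P γ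

@[simp] theorem Store.setReg_arr (s : Store) (x k : ℕ) : (s.setReg x k).arr = s.arr := rfl

@[simp] theorem Store.setReg_reg_self (s : Store) (x k : ℕ) : (s.setReg x k).reg x = k := by
  simp [Store.setReg]

theorem Store.setReg_reg_of_ne (s : Store) {x y : ℕ} (k : ℕ) (h : y ≠ x) :
    (s.setReg x k).reg y = s.reg y := by
  simp [Store.setReg, h]

theorem yields_assign {e : Expr} {d : ℕ} {s : Store} {v : ℕ} (h : e.eval s = v) :
    Yields (.assign d e) d s v (e.steps + 1) :=
  ⟨_, _, .assign s d e, le_rfl, rfl, fun x hx => s.setReg_reg_of_ne _ hx.ne,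
    by rw [Store.setReg_reg_self, h]⟩

namespace Definable

variable {Γ : Type} [Ctx Γ] {f g : Γ → ℕ}

theorem congr (h : Definable f) (e : ∀ γ, g γ = f γ) : Definable g := by
  rwa [show g = f from funext e]

theorem of_expr (e : (ℓ : Ctx.Loc Γ) → Expr)
    (h : ∀ ℓ γ s, Ctx.Rep ℓ γ s → (e ℓ).eval s = f γ) : Definable f := fun ℓ d _ =>
  ⟨.assign d (e ℓ), Polynomial.C ((e ℓ).steps + 1), fun γ s B hr _ => by
    simpa using yields_assign (d := d) (h ℓ γ s hr)⟩

theorem const (k : ℕ) : Definable (fun _ : Γ => k) :=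
  of_expr (fun _ => .lit k) fun _ _ _ _ => rfl

theorem param (x : ℕ) (hx : x < numParams := by decide) :
    Definable (fun γ : Γ => (Ctx.store γ).reg x) :=
  of_expr (fun _ => .reg x) fun _ _ _ h => Ctx.rep_reg h x hx

theorem var : Definable (fun γ : Γ × ℕ => γ.2) :=
  of_expr (fun ℓ => .reg ℓ.2) fun _ _ _ h => h.2

theorem weaken (h : Definable f) : Definable (fun γ : Γ × ℕ => f γ.1) := fun ℓ d hd => by
  obtain ⟨c, q, hc⟩ := h ℓ.1 d hd.1
  exact ⟨c, q, fun γ s B hr hB => hc γ.1 s B hr.1 hB⟩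

/-- A variable is only a register number, so the program for `f` is taken at the locations that skip
the middle variable. This is why `Definable` quantifies over all locations. -/
theorem swap_weaken {f : Γ × ℕ → ℕ} (h : Definable f) :
    Definable (fun γ : (Γ × ℕ) × ℕ => f (γ.1.1, γ.2)) := fun ℓ d hd => by
  obtain ⟨c, q, hc⟩ := h (ℓ.1.1, ℓ.2) d ⟨hd.1.1, hd.2⟩
  exact ⟨c, q, fun γ s B hr hB => hc _ s B ⟨hr.1.1, hr.2⟩ hB⟩

/-- Local binding: compute `g`, then use its value as a variable. -/
theorem bind {F : Γ × ℕ → ℕ} (hF : Definable F) (hg : Definable g) :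
    Definable (fun γ => F (γ, g γ)) := fun ℓ d hd => by
  obtain ⟨c, q, hc⟩ := hg ℓ d hd
  -- The value of `g` stays in register `d` and becomes the new variable. The result of `F` arrives
  -- in `d + 1` and is finally moved down to `d`.
  obtain ⟨c', q', hc'⟩ := hF (ℓ, d) (d + 1) ⟨Ctx.bdd_mono hd (by omega), by simp⟩
  refine ⟨.seq (.seq c c') (.assign d (.reg (d + 1))), q + q' + Polynomial.C 2,
    fun γ s B hr hB => ?_⟩
  obtain ⟨s₁, t₁, e₁, ht₁, ha₁, hx₁, hv₁⟩ := hc γ s B hr hB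
  have hp := Ctx.le_of_bdd hd
  obtain ⟨s₂, t₂, e₂, ht₂, ha₂, hx₂, hv₂⟩ := hc' (γ, g γ) s₁ B
    ⟨Ctx.rep_congr hd hr ha₁ hx₁, hv₁⟩ (fun x hx => (hx₁ x (by omega)).trans_le (hB x hx))
  refine ⟨_, _, .seq (.seq e₁ e₂) (.assign _ _ _), ?_, ?_, ?_, ?_⟩
  · simp [Expr.steps]; omega
  · simp [ha₁, ha₂]
  · intro x hx
    rw [Store.setReg_reg_of_ne _ _ hx.ne, hx₂ x (by omega), hx₁ x hx]
  · simp [Expr.eval, hv₂]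

theorem comp₂ (op : Expr → Expr → Expr) (o : ℕ → ℕ → ℕ)
    (hop : ∀ e e' s, (op e e').eval s = o (e.eval s) (e'.eval s))
    (hf : Definable f) (hg : Definable g) : Definable (fun γ => o (f γ) (g γ)) := by
  have h : Definable (fun γ : (Γ × ℕ) × ℕ => o γ.1.2 γ.2) :=
    of_expr (fun ℓ => op (.reg ℓ.1.2) (.reg ℓ.2)) fun ℓ γ s hr => by
      rw [hop]; simp [Expr.eval, hr.1.2, hr.2]
  exact (h.bind hg.weaken).bind hf

theorem add (hf : Definable f) (hg : Definable g) : Definable (fun γ => f γ + g γ) :=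
  comp₂ .add _ (fun _ _ _ => rfl) hf hg

theorem sub (hf : Definable f) (hg : Definable g) : Definable (fun γ => f γ - g γ) :=
  comp₂ .sub _ (fun _ _ _ => rfl) hf hg

theorem cell (a : ℕ) (hf : Definable f) : Definable (fun γ => (Ctx.store γ).arr a (f γ)) := by
  have h : Definable (fun γ : Γ × ℕ => (Ctx.store γ).arr a γ.2) :=
    of_expr (fun ℓ => .cell a (.reg ℓ.2)) fun ℓ γ s hr => by
      simp only [Expr.eval]
      rw [hr.2, Ctx.rep_arr (Γ := Γ × ℕ) hr]
  exact h.bind hf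

theorem cond (hf : Definable f) {g₁ g₂ : Γ → ℕ} (h₁ : Definable g₁) (h₂ : Definable g₂) :
    Definable (fun γ => if f γ = 0 then g₂ γ else g₁ γ) := fun ℓ d hd => by
  obtain ⟨c, q, hc⟩ := hf ℓ d hd
  obtain ⟨c₁, q₁, hc₁⟩ := h₁ ℓ d hd
  obtain ⟨c₂, q₂, hc₂⟩ := h₂ ℓ d hd
  refine ⟨.seq c (.ite (.reg d) c₁ c₂), q + (q₁ + q₂) + Polynomial.C 2, fun γ s B hr hB => ?_⟩
  obtain ⟨s₁, t₁, e₁, ht₁, ha₁, hx₁, hv₁⟩ := hc γ s B hr hB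
  have hp := Ctx.le_of_bdd hd
  have hr' := Ctx.rep_congr hd hr ha₁ hx₁
  have hB' : ∀ x < numParams, s₁.reg x ≤ B := fun x hx =>
    (hx₁ x (by omega)).trans_le (hB x hx)
  by_cases h0 : f γ = 0
  · obtain ⟨s₂, t₂, e₂, ht₂, ha₂, hx₂, hv₂⟩ := hc₂ γ s₁ B hr' hB'
    refine ⟨s₂, _, .seq e₁ (.ite_false (by simp [Expr.eval, hv₁, h0]) e₂), ?_, ha₂.trans ha₁,
      fun x hx => (hx₂ x hx).trans (hx₁ x hx), by simp [h0, hv₂]⟩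
    simp [Expr.steps]; omega
  · obtain ⟨s₂, t₂, e₂, ht₂, ha₂, hx₂, hv₂⟩ := hc₁ γ s₁ B hr' hB'
    refine ⟨s₂, _, .seq e₁ (.ite_true (by simp [Expr.eval, hv₁, h0]) e₂), ?_, ha₂.trans ha₁,
      fun x hx => (hx₂ x hx).trans (hx₁ x hx), by simp [h0, hv₂]⟩
    simp [Expr.steps]; omega

theorem ite {P : Γ → Prop} [DecidablePred P] (hP : Decides P) (hf : Definable f)
    (hg : Definable g) : Definable (fun γ => if P γ then f γ else g γ) := by
  obtain ⟨p, hp, hpP⟩ := hP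
  refine (hp.cond hf hg).congr fun γ => ?_
  by_cases h : P γ
  · simp [h, (hpP γ).2 h]
  · simp [h, not_not.1 (mt (hpP γ).1 h)]

/-- The only source of iteration: products, quotients, bounded quantifiers and searches are all
written as such sums. The number of rounds is a parameter, so the time does not depend on the size
of the summands. -/
theorem sum (N : ℕ) {F : Γ → ℕ → ℕ} (hF : Definable (fun γ : Γ × ℕ => F γ.1 γ.2))
    (hN : N < numParams := by decide) :
    Definable (fun γ => ∑ i ∈ Finset.range ((Ctx.store γ).reg N), F γ i) := fun ℓ d hd => by
  -- Register `d` holds the partial sum, `d + 1` the index, and `d + 2` receives the current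
  -- summand.
  obtain ⟨c, q, hc⟩ := hF (ℓ, d + 1) (d + 2) ⟨Ctx.bdd_mono hd (by omega), by simp⟩
  refine ⟨.seq (.seq (.assign d (.lit 0)) (.assign (d + 1) (.lit 0)))
    (.while (.sub (.reg N) (.reg (d + 1))) (.seq (.seq c
      (.assign d (.add (.reg d) (.reg (d + 2)))))
      (.assign (d + 1) (.add (.reg (d + 1)) (.lit 1))))),
    Polynomial.X * (Polynomial.C 12 + q) + Polynomial.C 8, fun γ s B hr hB => ?_⟩
  have hp := Ctx.le_of_bdd hd
  set n := (Ctx.store γ).reg N with hn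
  have hsN : s.reg N = n := Ctx.rep_reg hr N hN
  have hnB : n ≤ B := hsN ▸ hB N hN
  obtain ⟨s', t, e, ht, hI⟩ := exec_while (n := n) (T := q.eval B + 8)
    (e := .sub (.reg N) (.reg (d + 1)))
    (c := .seq (.seq c (.assign d (.add (.reg d) (.reg (d + 2)))))
      (.assign (d + 1) (.add (.reg (d + 1)) (.lit 1))))
    (fun j s' => s'.arr = s.arr ∧ (∀ x < d, s'.reg x = s.reg x) ∧ s'.reg (d + 1) = j ∧
      s'.reg d = ∑ i ∈ Finset.range j, F γ i)
    (fun j s' ⟨_, hx, hj, _⟩ => by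
      simp only [Expr.eval, hj, hx N (by omega), hsN]; omega)
    (fun j s' hjn ⟨ha, hx, hj, hs⟩ => by
      obtain ⟨s₁, t₁, e₁, ht₁, ha₁, hx₁, hv₁⟩ := hc (γ, j) s' B
        ⟨Ctx.rep_congr hd hr ha hx, hj⟩
        (fun x hxl => (hx x (by omega)).trans_le (hB x hxl))
      refine ⟨_, _, .seq (.seq e₁ (.assign _ _ _)) (.assign _ _ _), ?_, ?_, ?_, ?_, ?_⟩
      · simp [Expr.steps]; omega
      · simp [ha₁, ha]
      · intro x hxd
        rw [Store.setReg_reg_of_ne _ _ (by omega), Store.setReg_reg_of_ne _ _ (by omega),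
          hx₁ x (by omega), hx x hxd]
      · simp [Expr.eval, Store.setReg_reg_of_ne, hx₁ (d + 1) (by omega), hj]
      · rw [Store.setReg_reg_of_ne _ _ (by omega)]
        simp [Expr.eval, hx₁ d (by omega), hs, hv₁, Finset.sum_range_succ])
    (s := (s.setReg d 0).setReg (d + 1) 0)
    ⟨rfl, fun x hx => by
      rw [Store.setReg_reg_of_ne _ _ (by omega), Store.setReg_reg_of_ne _ _ (by omega)],
      by simp, by rw [Store.setReg_reg_of_ne _ _ (by omega)]; simp⟩
  refine ⟨s', _, .seq (.seq (.assign _ _ _) (.assign _ _ _)) e, ?_, hI.1, hI.2.1, hI.2.2.2⟩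
  simp only [Expr.steps, Polynomial.eval_add, Polynomial.eval_mul, Polynomial.eval_X,
    Polynomial.eval_C] at ht ⊢
  have := Nat.mul_le_mul_right (1 + 1 + 1 + 1 + (q.eval B + 8)) hnB
  have h12 : B * (1 + 1 + 1 + 1 + (q.eval B + 8)) = B * (12 + q.eval B) := by ring
  omega

theorem mul_param (N : ℕ) (hf : Definable f) (hN : N < numParams := by decide) :
    Definable (fun γ => f γ * (Ctx.store γ).reg N) :=
  (sum N (F := fun γ _ => f γ) hf.weaken hN).congr fun γ => by simp [mul_comm]

end Definable

namespace Decides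

variable {Γ : Type} [Ctx Γ] {f g : Γ → ℕ} {P Q : Γ → Prop}

theorem congr (h : Decides P) (e : ∀ γ, Q γ ↔ P γ) : Decides Q := by
  rwa [show Q = P from funext fun γ => propext (e γ)]

theorem weaken (h : Decides P) : Decides (fun γ : Γ × ℕ => P γ.1) := by
  obtain ⟨p, hp, h⟩ := h
  exact ⟨_, hp.weaken, fun γ => h γ.1⟩

theorem swap_weaken {P : Γ × ℕ → Prop} (h : Decides P) :
    Decides (fun γ : (Γ × ℕ) × ℕ => P (γ.1.1, γ.2)) := by
  obtain ⟨p, hp, h⟩ := h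
  exact ⟨_, hp.swap_weaken, fun γ => h _⟩

theorem lt (hf : Definable f) (hg : Definable g) : Decides (fun γ => f γ < g γ) :=
  ⟨_, hg.sub hf, fun γ => by omega⟩

theorem not (hP : Decides P) : Decides (fun γ => ¬ P γ) := by
  obtain ⟨p, hp, h⟩ := hP
  exact ⟨_, (Definable.const 1).sub hp, fun γ => by
    show _ ↔ ¬ P γ
    rw [← h γ]; omega⟩

theorem le (hf : Definable f) (hg : Definable g) : Decides (fun γ => f γ ≤ g γ) :=
  (lt hg hf).not.congr fun γ => by simp

theorem and (hP : Decides P) (hQ : Decides Q) : Decides (fun γ => P γ ∧ Q γ) := by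
  obtain ⟨p, hp, h⟩ := hP
  obtain ⟨q, hq, h'⟩ := hQ
  refine ⟨_, hp.cond hq (.const 0), fun γ => ?_⟩
  show _ ↔ P γ ∧ Q γ
  rw [← h, ← h']
  by_cases hp : p γ = 0 <;> simp [hp]

theorem or (hP : Decides P) (hQ : Decides Q) : Decides (fun γ => P γ ∨ Q γ) :=
  (hP.not.and hQ.not).not.congr fun γ => by tauto

theorem imp (hP : Decides P) (hQ : Decides Q) : Decides (fun γ => P γ → Q γ) :=
  (hP.and hQ.not).not.congr fun γ => by tauto

theorem eq (hf : Definable f) (hg : Definable g) : Decides (fun γ => f γ = g γ) :=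
  ((le hf hg).and (le hg hf)).congr fun γ => by omega

theorem exists_lt (N : ℕ) {P : Γ → ℕ → Prop} (hP : Decides (fun γ : Γ × ℕ => P γ.1 γ.2))
    (hN : N < numParams := by decide) :
    Decides (fun γ => ∃ i < (Ctx.store γ).reg N, P γ i) := by
  obtain ⟨p, hp, h⟩ := hP
  exact ⟨_, Definable.sum N (F := fun γ i => p (γ, i)) hp hN, fun γ => by
    simp [Finset.sum_eq_zero_iff, ← h (γ, _)]⟩

theorem forall_lt (N : ℕ) {P : Γ → ℕ → Prop} (hP : Decides (fun γ : Γ × ℕ => P γ.1 γ.2))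
    (hN : N < numParams := by decide) :
    Decides (fun γ => ∀ i < (Ctx.store γ).reg N, P γ i) :=
  (exists_lt N (P := fun γ i => ¬ P γ i) hP.not hN).not.congr fun γ => by push Not; rfl

end Decides

end RAM

/-! ### Bounded arithmetic and bounded search -/

/-- Division with a bound on the quotient. -/
def boundedDiv (N M i : ℕ) : ℕ :=
  ∑ t ∈ Finset.range N, if (t + 1) * M ≤ i then 1 else 0

theorem boundedDiv_eq {N M i : ℕ} (hM : 0 < M) (h : i / M ≤ N) : boundedDiv N M i = i / M := by
  unfold boundedDiv
  rw [← Finset.card_filter]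
  have : (Finset.range N).filter (fun t => (t + 1) * M ≤ i) = Finset.range (i / M) := by
    ext t
    simp only [Finset.mem_filter, Finset.mem_range, ← Nat.le_div_iff_mul_le hM]
    omega
  rw [this, Finset.card_range]

/-- Remainder with a bound on the quotient. -/
def boundedMod (N M i : ℕ) : ℕ := i - boundedDiv N M i * M

theorem boundedMod_eq {N M i : ℕ} (hM : 0 < M) (h : i / M ≤ N) : boundedMod N M i = i % M := by
  rw [boundedMod, boundedDiv_eq hM h]
  have := Nat.div_add_mod' i M
  omega

/-- Multiplication with a bound on the first factor. -/
def boundedMul (N a b : ℕ) : ℕ := ∑ j ∈ Finset.range N, if j < a then b else 0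

theorem boundedMul_eq {N a b : ℕ} (h : a ≤ N) : boundedMul N a b = a * b := by
  unfold boundedMul
  rw [← Finset.sum_filter, Finset.sum_const, smul_eq_mul]
  congr
  have : (Finset.range N).filter (fun j => j < a) = Finset.range a := by
    ext j; simp; omega
  rw [this, Finset.card_range]

open Classical in
/-- The least number below `N` that satisfies `P` (and `0` if there is none). -/
noncomputable def pick (N : ℕ) (P : ℕ → Prop) : ℕ :=
  ∑ i ∈ Finset.range N, if P i ∧ ∀ j < N, j < i → ¬ P j then i else 0

theorem pick_spec {N : ℕ} {P : ℕ → Prop} (h : ∃ i < N, P i) : pick N P < N ∧ P (pick N P) := by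
  classical
  have h' : ∃ i, i < N ∧ P i := h
  have hs := Nat.find_spec h'
  suffices H : pick N P = Nat.find h' by rw [H]; exact hs
  unfold pick
  rw [Finset.sum_eq_single (Nat.find h')]
  · rw [if_pos ⟨hs.2, fun j hj hlt hp => Nat.find_min h' hlt ⟨hj, hp⟩⟩]
  · intro b hb hne
    rw [if_neg]
    rintro ⟨hb', hmin⟩
    rcases lt_or_gt_of_ne hne with hlt | hlt
    · exact Nat.find_min h' hlt ⟨Finset.mem_range.1 hb, hb'⟩
    · exact hmin _ hs.1 hlt hs.2
  · intro hn
    exact absurd (Finset.mem_range.2 hs.1) hn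

theorem pick_congr {N : ℕ} {P Q : ℕ → Prop} (h : ∀ i < N, P i ↔ Q i) : pick N P = pick N Q := by
  classical
  unfold pick
  refine Finset.sum_congr rfl fun i hi => ?_
  rw [Finset.mem_range] at hi
  congr 1
  refine propext (and_congr (h i hi) (forall_congr' fun j => forall_congr' fun hj => ?_))
  rw [h j hj]

/-! ### Programs for bounded arithmetic and for filling tables -/

namespace RAM

namespace Definable

variable {Γ : Type} [Ctx Γ] {f g : Γ → ℕ}

theorem boundedDiv (N M : ℕ) (hf : Definable f) (hN : N < numParams := by decide)
    (hM : M < numParams := by decide) :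
    Definable (fun γ => boundedDiv ((Ctx.store γ).reg N) ((Ctx.store γ).reg M) (f γ)) :=
  sum N (F := fun γ t => if (t + 1) * (Ctx.store γ).reg M ≤ f γ then 1 else 0)
    (ite (.le ((var.add (.const 1)).mul_param M hM) hf.weaken) (.const 1) (.const 0)) hN

theorem boundedMod (N M : ℕ) (hf : Definable f) (hN : N < numParams := by decide)
    (hM : M < numParams := by decide) :
    Definable (fun γ => boundedMod ((Ctx.store γ).reg N) ((Ctx.store γ).reg M) (f γ)) :=
  hf.sub ((hf.boundedDiv N M hN hM).mul_param M hM)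

theorem boundedMul (N : ℕ) (hf : Definable f) (hg : Definable g)
    (hN : N < numParams := by decide) :
    Definable (fun γ => boundedMul ((Ctx.store γ).reg N) (f γ) (g γ)) :=
  sum N (F := fun γ j => if j < f γ then g γ else 0)
    (ite (.lt var hf.weaken) hg.weaken (.const 0)) hN

theorem pick (N : ℕ) {P : Γ → ℕ → Prop} (hP : Decides (fun γ : Γ × ℕ => P γ.1 γ.2))
    (hN : N < numParams := by decide) :
    Definable (fun γ => pick ((Ctx.store γ).reg N) (P γ)) := by
  classical
  refine sum N (F := fun γ i =>
    if P γ i ∧ ∀ j < (Ctx.store γ).reg N, j < i → ¬ P γ j then i else 0) (ite ?_ var (.const 0)) hN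
  exact hP.and (Decides.forall_lt N (.imp (.lt var var.weaken) hP.swap_weaken.not) hN)

end Definable

/-- The stores agree on the parameters and on all arrays but `a`. -/
def AgreeOff (a : ℕ) (s s' : Store) : Prop :=
  (∀ x < numParams, s'.reg x = s.reg x) ∧ ∀ b ≠ a, s'.arr b = s.arr b

/-- In stores that agree with `s` off `a`, the value `F · i` depends on the array `a` only through
its entries below `k`. -/
def LocalAt (a : ℕ) (s : Store) (F : Store → ℕ) (k : ℕ) : Prop :=
  ∀ s₁ s₂, AgreeOff a s s₁ → AgreeOff a s s₂ → (∀ j < k, s₁.arr a j = s₂.arr a j) → F s₁ = F s₂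

/-- The cells are filled in increasing order, so a recurrence that reads the array itself meets only
finished cells. Locality makes the value written for `i` agree with `F s' i` in the final store. -/
theorem exec_tabulate (a N : ℕ) {F : Store → ℕ → ℕ}
    (hF : Definable (fun γ : Store × ℕ => F γ.1 γ.2)) (hN : N < numParams) :
    ∃ (c : Prog) (q : Polynomial ℕ), ∀ s B, (∀ x < numParams, s.reg x ≤ B) →
      (∀ i < s.reg N, LocalAt a s (F · i) i) →
      ∃ s' t, Exec c s s' t ∧ t ≤ q.eval B ∧ AgreeOff a s s' ∧
        ∀ i < s.reg N, s'.arr a i = F s' i := by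
  -- The first scratch register holds the index, the next one the value to be stored.
  obtain ⟨c, q, hc⟩ := hF ((), numParams) (numParams + 1)
    ⟨show numParams ≤ numParams + 1 by omega, Nat.lt_succ_self _⟩
  set d := numParams with hd
  let body : Prog := .seq (.seq c (.store a (.reg d) (.reg (d + 1))))
    (.assign d (.add (.reg d) (.lit 1)))
  refine ⟨.seq (.assign d (.lit 0)) (.while (.sub (.reg N) (.reg d)) body),
    Polynomial.X * (Polynomial.C 11 + q) + Polynomial.C 6, fun s B hB hloc => ?_⟩
  obtain ⟨s', t, e, ht, hI⟩ := exec_while (n := s.reg N) (T := q.eval B + 7)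
    (e := .sub (.reg N) (.reg d)) (c := body)
    (fun j s' => AgreeOff a s s' ∧ s'.reg d = j ∧ ∀ i < j, i < s.reg N → s'.arr a i = F s' i)
    (fun j s' ⟨hA, hj, _⟩ => by
      simp only [Expr.eval, hj, hA.1 N hN]; omega)
    (fun j s' hjn ⟨hA, hj, hs⟩ => by
      obtain ⟨s₁, t₁, e₁, ht₁, ha₁, hx₁, hv₁⟩ := hc (s', j) s' B
        ⟨⟨rfl, fun _ _ => rfl⟩, hj⟩ (fun x hx => (hA.1 x hx).trans_le (hB x hx))
      have e₂ := Exec.store s₁ a (.reg d) (.reg (d + 1))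
      have e₃ := Exec.assign (s₁.setCell a ((Expr.reg d).eval s₁) ((Expr.reg (d + 1)).eval s₁)) d
        (.add (.reg d) (.lit 1))
      have hd₁ : s₁.reg d = j := (hx₁ d (by omega)).trans hj
      have heq : (Expr.reg d).eval s₁ = j := hd₁
      have heq' : (Expr.reg (d + 1)).eval s₁ = F s' j := hv₁
      rw [heq, heq'] at e₂ e₃
      set s₃ := ((s₁.setCell a j (F s' j)).setReg d
        ((Expr.add (.reg d) (.lit 1)).eval (s₁.setCell a j (F s' j)))) with hs₃
      have hne : ∀ a' ≠ a, s₃.arr a' = s'.arr a' := fun a' ha' => by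
        simp [hs₃, Store.setCell, ha', ha₁]
      have hcell : ∀ i, s₃.arr a i = if i = j then F s' j else s'.arr a i := fun i => by
        simp [hs₃, Store.setCell, ha₁, Function.update_apply]
      have hA₃ : AgreeOff a s s₃ := ⟨fun x hx => by
        rw [hs₃, Store.setReg_reg_of_ne _ _ (by omega)]
        exact (hx₁ x (by omega)).trans (hA.1 x hx), fun a' ha' => (hne a' ha').trans (hA.2 a' ha')⟩
      -- Writing cell `j` disturbs no value `F · i` with `i ≤ j`, as that value depends only on
      -- cells below `i`.
      have hF₃ : ∀ i ≤ j, i < s.reg N → F s₃ i = F s' i := fun i hi hiN =>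
        hloc i hiN s₃ s' hA₃ hA fun k hk => by rw [hcell, if_neg (by omega)]
      refine ⟨s₃, _, .seq (.seq e₁ e₂) e₃, ?_, hA₃, ?_, ?_⟩
      · simp [Expr.steps]; omega
      · simp [hs₃, Expr.eval, Store.setCell, hd₁]
      · intro i hi hiN
        rw [hcell, hF₃ i (by omega) hiN]
        split_ifs with h
        · rw [h]
        · exact hs i (by omega) hiN)
    (s := s.setReg d 0)
    ⟨⟨fun x hx => s.setReg_reg_of_ne _ (by omega), fun _ _ => rfl⟩, by simp, by simp⟩
  refine ⟨s', _, .seq (.assign _ _ _) e, ?_, hI.1, fun i hi => hI.2.2 i hi hi⟩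
  have hnB := hB N hN
  simp only [Expr.steps, Polynomial.eval_add, Polynomial.eval_mul, Polynomial.eval_X,
    Polynomial.eval_C] at ht ⊢
  have := Nat.mul_le_mul_right (1 + 1 + 1 + 1 + (q.eval B + 7)) hnB
  have h11 : B * (1 + 1 + 1 + 1 + (q.eval B + 7)) = B * (11 + q.eval B) := by ring
  omega

/-- One program takes all stores that satisfy `P x` to stores that satisfy `Q x`, in time
polynomial in the size of `x`. -/
def Achieves {ι : Type} (size : ι → ℕ) (P Q : ι → Store → Prop) : Prop :=
  ∃ (c : Prog) (q : Polynomial ℕ), ∀ x s, P x s →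
    ∃ s' t, Exec c s s' t ∧ t ≤ q.eval (size x) ∧ Q x s'

namespace Achieves

variable {ι : Type} {size : ι → ℕ} {P Q R : ι → Store → Prop}

theorem trans (h : Achieves size P Q) (h' : Achieves size Q R) : Achieves size P R := by
  obtain ⟨c, q, h⟩ := h
  obtain ⟨c', q', h'⟩ := h'
  refine ⟨.seq c c', q + q', fun x s hs => ?_⟩
  obtain ⟨s₁, t₁, e₁, ht₁, h₁⟩ := h x s hs
  obtain ⟨s₂, t₂, e₂, ht₂, h₂⟩ := h' x s₁ h₁
  exact ⟨s₂, _, .seq e₁ e₂, by simp; omega, h₂⟩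

theorem mono {P' Q' : ι → Store → Prop} (h : Achieves size P Q) (hP : ∀ x s, P' x s → P x s)
    (hQ : ∀ x s, Q x s → Q' x s) : Achieves size P' Q' := by
  obtain ⟨c, q, h⟩ := h
  refine ⟨c, q, fun x s hs => ?_⟩
  obtain ⟨s₁, t₁, e₁, ht₁, h₁⟩ := h x s (hP x s hs)
  exact ⟨s₁, t₁, e₁, ht₁, hQ x s₁ h₁⟩

theorem assign (y : ℕ) (e : Expr)
    (h : ∀ x s, P x s → Q x (s.setReg y (e.eval s))) : Achieves size P Q :=
  ⟨.assign y e, Polynomial.C (e.steps + 1), fun x s hs =>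
    ⟨_, _, .assign s y e, by simp, h x s hs⟩⟩

theorem ite (e : Expr) (h : Achieves size (fun x s => P x s ∧ e.eval s ≠ 0) Q)
    (h' : Achieves size (fun x s => P x s ∧ e.eval s = 0) Q) : Achieves size P Q := by
  obtain ⟨c, q, h⟩ := h
  obtain ⟨c', q', h'⟩ := h'
  refine ⟨.ite e c c', q + q' + Polynomial.C (e.steps + 1), fun x s hs => ?_⟩
  by_cases he : e.eval s = 0
  · obtain ⟨s₁, t₁, e₁, ht₁, h₁⟩ := h' x s ⟨hs, he⟩
    exact ⟨s₁, _, .ite_false he e₁, by simp; omega, h₁⟩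
  · obtain ⟨s₁, t₁, e₁, ht₁, h₁⟩ := h x s ⟨hs, he⟩
    exact ⟨s₁, _, .ite_true he e₁, by simp; omega, h₁⟩

/-- The parameters are polynomially bounded. -/
def ParamsBounded (size : ι → ℕ) (P : ι → Store → Prop) : Prop :=
  ∃ r : Polynomial ℕ, ∀ x s, P x s → ∀ y < numParams, s.reg y ≤ r.eval (size x)

theorem setParam (y : ℕ) {F : Store → ℕ} (hF : Definable F) (hb : ParamsBounded size P)
    (h : ∀ x s s', P x s → s'.arr = s.arr →
      (∀ z < numParams, s'.reg z = if z = y then F s else s.reg z) → Q x s') :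
    Achieves size P Q := by
  obtain ⟨c, q, hc⟩ := hF () numParams (show numParams ≤ numParams from le_rfl)
  obtain ⟨r, hr⟩ := hb
  refine ⟨.seq c (.assign y (.reg numParams)), q.comp r + Polynomial.C 2, fun x s hs => ?_⟩
  obtain ⟨s₁, t₁, e₁, ht₁, ha₁, hx₁, hv₁⟩ := hc s s (r.eval (size x)) ⟨rfl, fun _ _ => rfl⟩
    (fun z hz => hr x s hs z hz)
  refine ⟨_, _, .seq e₁ (.assign _ _ _), ?_, h x s _ hs ?_ ?_⟩
  · simp [Expr.steps, Polynomial.eval_comp]; omega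
  · simp [ha₁]
  · intro z hz
    split_ifs with hzy
    · rw [hzy]; simp [Expr.eval, hv₁]
    · rw [Store.setReg_reg_of_ne _ _ hzy, hx₁ z hz]

theorem tabulate (a N : ℕ) {F : Store → ℕ → ℕ}
    (hF : Definable (fun γ : Store × ℕ => F γ.1 γ.2)) (hb : ParamsBounded size P)
    (hloc : ∀ x s, P x s → ∀ i < s.reg N, LocalAt a s (F · i) i)
    (h : ∀ x s s', P x s → AgreeOff a s s' → (∀ i < s.reg N, s'.arr a i = F s' i) → Q x s')
    (hN : N < numParams := by decide) :
    Achieves size P Q := by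
  obtain ⟨c, q, hc⟩ := exec_tabulate a N hF hN
  obtain ⟨r, hr⟩ := hb
  refine ⟨c, q.comp r, fun x s hs => ?_⟩
  obtain ⟨s', t, e, ht, hA, hval⟩ := hc s (r.eval (size x)) (fun z hz => hr x s hs z hz)
    (hloc x s hs)
  exact ⟨s', t, e, by rwa [Polynomial.eval_comp], h x s s' hs hA hval⟩

/-- Tabulation of a function of two arguments, the second of which is below the parameter `M`. -/
theorem tabulate₂ (a N M : ℕ) {F : Store → ℕ → ℕ → ℕ}
    (hF : Definable (fun γ : (((Store × ℕ) × ℕ) × ℕ) => F γ.1.1.1 γ.1.2 γ.2))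
    (hb : ParamsBounded size P)
    (hloc : ∀ x s, P x s → ∀ e f, f < s.reg M → e * s.reg M + f < s.reg N →
      LocalAt a s (F · e f) (e * s.reg M + f))
    (h : ∀ x s s', P x s → AgreeOff a s s' →
      (∀ e f, f < s.reg M → e * s.reg M + f < s.reg N →
        s'.arr a (e * s.reg M + f) = F s' e f) → Q x s')
    (hM0 : ∀ x s, P x s → 0 < s.reg M)
    (hN : N < numParams := by decide) (hM : M < numParams := by decide) :
    Achieves size P Q := by
  have hdec : ∀ {x s s'}, P x s → AgreeOff a s s' → ∀ i < s.reg N,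
      boundedDiv (s'.reg N) (s'.reg M) i = i / s.reg M ∧
      boundedMod (s'.reg N) (s'.reg M) i = i % s.reg M := fun {x s s'} hs hA i hi => by
    have hle : i / s.reg M ≤ s.reg N := (Nat.div_le_self _ _).trans hi.le
    rw [hA.1 N hN, hA.1 M hM]
    exact ⟨boundedDiv_eq (hM0 x s hs) hle, boundedMod_eq (hM0 x s hs) hle⟩
  refine tabulate (P := P) (Q := Q) a N (F := fun s i => F s (boundedDiv (s.reg N) (s.reg M) i)
    (boundedMod (s.reg N) (s.reg M) i)) ?_ hb ?_ ?_ hN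
  · exact (hF.bind (Definable.boundedMod N M Definable.var.weaken hN hM)).bind
      (Definable.boundedDiv N M Definable.var hN hM)
  · intro x s hs i hi s₁ s₂ h₁ h₂ hj
    obtain ⟨d₁, m₁⟩ := hdec hs h₁ i hi
    obtain ⟨d₂, m₂⟩ := hdec hs h₂ i hi
    simp only [d₁, m₁, d₂, m₂]
    refine hloc x s hs (i / s.reg M) (i % s.reg M) (Nat.mod_lt _ (hM0 x s hs)) ?_ s₁ s₂ h₁ h₂ ?_
    · rwa [Nat.div_add_mod']
    · rwa [Nat.div_add_mod']
  · intro x s s' hs hA hs'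
    refine h x s s' hs hA fun e f hf hlt => ?_
    have := hs' _ hlt
    obtain ⟨d₁, m₁⟩ := hdec hs hA _ hlt
    rw [d₁, m₁] at this
    rwa [Nat.mul_add_mod_self_right, Nat.mod_eq_of_lt hf, add_comm (e * s.reg M),
      Nat.add_mul_div_right _ _ (hM0 x s hs), Nat.div_eq_of_lt hf, zero_add, add_comm f] at this

/-- Tabulation of a function of three arguments. -/
theorem tabulate₃ (a N E M : ℕ) {F : Store → ℕ → ℕ → ℕ → ℕ}
    (hF : Definable (fun γ : (((((Store × ℕ) × ℕ) × ℕ) × ℕ) × ℕ) =>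
      F γ.1.1.1.1.1 γ.1.2 γ.2 γ.1.1.2))
    (hb : ParamsBounded size P)
    (hloc : ∀ x s, P x s → ∀ k e f, e < s.reg E → f < s.reg M →
      (k * s.reg E + e) * s.reg M + f < s.reg N →
      LocalAt a s (F · k e f) ((k * s.reg E + e) * s.reg M + f))
    (h : ∀ x s s', P x s → AgreeOff a s s' →
      (∀ k e f, e < s.reg E → f < s.reg M → (k * s.reg E + e) * s.reg M + f < s.reg N →
        s'.arr a ((k * s.reg E + e) * s.reg M + f) = F s' k e f) → Q x s')
    (hM0 : ∀ x s, P x s → 0 < s.reg M) (hE0 : ∀ x s, P x s → 0 < s.reg E)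
    (hN : N < numParams := by decide) (hM : M < numParams := by decide)
    (hE : E < numParams := by decide) :
    Achieves size P Q := by
  have hdec : ∀ {x s s'}, P x s → AgreeOff a s s' → ∀ i f, i * s.reg M + f < s.reg N →
      boundedDiv (s'.reg N) (s'.reg E) i = i / s.reg E ∧
      boundedMod (s'.reg N) (s'.reg E) i = i % s.reg E := fun {x s s'} hs hA i f hi => by
    have hi' : i ≤ i * s.reg M := Nat.le_mul_of_pos_right _ (hM0 x s hs)
    have hle : i / s.reg E ≤ s.reg N := (Nat.div_le_self _ _).trans (by omega)
    rw [hA.1 N hN, hA.1 E hE]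
    exact ⟨boundedDiv_eq (hE0 x s hs) hle, boundedMod_eq (hE0 x s hs) hle⟩
  refine tabulate₂ (P := P) (Q := Q) a N M (F := fun s i f =>
    F s (boundedDiv (s.reg N) (s.reg E) i) (boundedMod (s.reg N) (s.reg E) i) f) ?_ hb ?_ ?_ hM0
    hN hM
  -- After the store, the context lists the raw index, its quotient by `M`, then `f`, `k` and `e`,
  -- in the order in which the decoding binds them.
  · have hF' : Definable (fun γ : (((((Store × ℕ) × ℕ) × ℕ) × ℕ) × ℕ) =>
      F γ.1.1.1.1.1 γ.1.2 γ.2 γ.1.1.2) := hF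
    exact (hF'.bind (Definable.boundedMod N E Definable.var.weaken.weaken hN hE)).bind
      (Definable.boundedDiv N E Definable.var.weaken hN hE)
  · intro x s hs i f hf hi s₁ s₂ h₁ h₂ hj
    obtain ⟨d₁, m₁⟩ := hdec hs h₁ i f hi
    obtain ⟨d₂, m₂⟩ := hdec hs h₂ i f hi
    simp only [d₁, m₁, d₂, m₂]
    refine hloc x s hs (i / s.reg E) (i % s.reg E) f (Nat.mod_lt _ (hE0 x s hs)) hf ?_
      s₁ s₂ h₁ h₂ ?_
    · rwa [Nat.div_add_mod']
    · rwa [Nat.div_add_mod']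
  · intro x s s' hs hA hs'
    refine h x s s' hs hA fun k e f he hf hlt => ?_
    have := hs' _ f hf hlt
    obtain ⟨d₁, m₁⟩ := hdec hs hA _ f hlt
    rw [d₁, m₁] at this
    rwa [Nat.mul_add_mod_self_right, Nat.mod_eq_of_lt he, add_comm (k * s.reg E),
      Nat.add_mul_div_right _ _ (hE0 x s hs), Nat.div_eq_of_lt he, zero_add, add_comm e] at this

end Achieves

end RAM

/-! ### Consecutive orderings

`N a a' b` says that some set of the family contains `a` and `a'` but not `b`, so that `b` must
not be placed between `a` and `a'`. -/

namespace ConsecutiveOrder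

variable {α : Type*} {N : α → α → α → Prop}

/-- Pairs whose relative orders force each other directly. -/
def Step (N : α → α → α → Prop) (x y : α × α) : Prop :=
  (x.2 = y.2 ∧ N x.1 y.1 x.2) ∨ (x.1 = y.1 ∧ N x.2 y.2 x.1)

/-- Pairs whose relative orders force each other. -/
def Forces (N : α → α → α → Prop) : α × α → α × α → Prop := Relation.ReflTransGen (Step N)

/-- The properties of `N` that come from its set representation. -/
structure IsSeparation (N : α → α → α → Prop) : Prop where
  symm : ∀ {a a' b}, N a a' b → N a' a b
  ne : ∀ {a a' b}, N a a' b → a ≠ b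
  split : ∀ {a a' b} z, N a a' b → (N a z b ∧ N a' z b) ∨ N a a' z

theorem Step.symm (h : IsSeparation N) {x y : α × α} (hs : Step N x y) : Step N y x := by
  rcases hs with ⟨h₁, h₂⟩ | ⟨h₁, h₂⟩
  · exact .inl ⟨h₁.symm, h₁ ▸ h.symm h₂⟩
  · exact .inr ⟨h₁.symm, h₁ ▸ h.symm h₂⟩

theorem Forces.symm (h : IsSeparation N) {x y : α × α} (hs : Forces N x y) : Forces N y x :=
  (@Relation.ReflTransGen.stdSymm _ (Step N) ⟨fun _ _ => Step.symm h⟩).symm _ _ hs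

theorem Forces.trans {x y z : α × α} (h : Forces N x y) (h' : Forces N y z) : Forces N x z :=
  Relation.ReflTransGen.trans h h'

theorem Forces.swap {x y : α × α} (hs : Forces N x y) : Forces N x.swap y.swap := by
  induction hs with
  | refl => exact .refl
  | tail _ hxy ih => exact .tail ih (Or.symm hxy)

theorem Forces.left {a a' b : α} (h : N a a' b) : Forces N (a, b) (a', b) :=
  .single (.inl ⟨rfl, h⟩)

theorem Forces.right {a b b' : α} (h : N b b' a) : Forces N (a, b) (a, b') :=
  .single (.inr ⟨rfl, h⟩)

/-- The analogue of the triangle lemma for implication classes of transitive orientations. Each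
separation met on the forcing path from `(a, b)` to `x` is split at `c`: either the current pair
forces one that contains `c`, against `h₁` or `h₂`, or the same move is possible with `c` as the
fixed component. -/
theorem triangle (h : IsSeparation N) {a b c : α} (h₁ : ¬ Forces N (a, b) (c, b))
    (h₂ : ¬ Forces N (a, b) (a, c)) {x : α × α} (hx : Forces N (a, b) x) :
    Forces N (b, c) (x.2, c) ∧ Forces N (c, a) (c, x.1) := by
  induction hx with
  | refl => exact ⟨.refl, .refl⟩
  | @tail x y hx hxy ih =>
    obtain ⟨x₁, x₂⟩ := x
    obtain ⟨y₁, y₂⟩ := y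
    obtain ⟨i₁, i₂⟩ := ih
    rcases hxy with ⟨he, hN⟩ | ⟨he, hN⟩
    · obtain rfl : x₂ = y₂ := he
      refine ⟨i₁, ?_⟩
      rcases h.split c hN with hz | hz
      · exact absurd ((Forces.trans hx (.left hz.1)).trans (i₁.swap.symm h)) h₁
      · exact i₂.trans (.right hz)
    · obtain rfl : x₁ = y₁ := he
      refine ⟨?_, i₂⟩
      rcases h.split c hN with hz | hz
      · exact absurd ((Forces.trans hx (.right hz.1)).trans (i₂.swap.symm h)) h₂
      · exact i₁.trans (.left hz)

/-- The canonical orientation: of the class of a pair and the class of the reversed pair, the one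
that holds the pair with the smaller key is chosen. -/
def Before (N : α → α → α → Prop) (key : α × α → ℕ) (a b : α) : Prop :=
  ∃ f, Forces N (a, b) f ∧ ∀ f', Forces N (b, a) f' → key f < key f'

variable {key : α × α → ℕ}

theorem Before.asymm {a b : α} (h₁ : Before N key a b) : ¬ Before N key b a := by
  rintro ⟨g, hg, hg'⟩
  obtain ⟨f, hf, hf'⟩ := h₁
  exact lt_asymm (hf' g hg) (hg' f hf)

theorem Before.of_forces (h : IsSeparation N) {a b c d : α} (h₁ : Before N key a b)
    (h₂ : Forces N (a, b) (c, d)) : Before N key c d := by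
  obtain ⟨f, hf, hf'⟩ := h₁
  exact ⟨f, (h₂.symm h).trans hf, fun f' hf₂ => hf' f' (h₂.swap.trans hf₂)⟩

/-- Both classes have a pair of least key. Keys being injective, equal minima would put `(a, b)` and
`(b, a)` into one class. -/
theorem before_total (hinj : Function.Injective key) (h : IsSeparation N) {a b : α}
    (hab : ¬ Forces N (a, b) (b, a)) : Before N key a b ∨ Before N key b a := by
  classical
  have hmin : ∀ x : α × α, ∃ f, Forces N x f ∧ ∀ f', Forces N x f' → key f ≤ key f' := fun x => by
    have hne : ∃ k, ∃ f, Forces N x f ∧ key f = k := ⟨_, x, .refl, rfl⟩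
    obtain ⟨f, hf, hk⟩ := Nat.find_spec hne
    exact ⟨f, hf, fun f' hf' => hk ▸ Nat.find_min' hne ⟨f', hf', rfl⟩⟩
  obtain ⟨f, hf, hf'⟩ := hmin (a, b)
  obtain ⟨g, hg, hg'⟩ := hmin (b, a)
  rcases lt_trichotomy (key f) (key g) with hlt | heq | hlt
  · exact .inl ⟨f, hf, fun f' h' => hlt.trans_le (hg' f' h')⟩
  · have := hinj heq
    subst this
    exact absurd (hf.trans (hg.symm h)) hab
  · exact .inr ⟨g, hg, fun k hk => hlt.trans_le (hf' k hk)⟩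

/-- In an order that keeps all sets consecutive, no pair forces the reversed pair. -/
theorem not_forces_swap (h : IsSeparation N) (pos : α → ℕ) (hpos : Function.Injective pos)
    (hN : ∀ a a' b, N a a' b → (pos a < pos b ↔ pos a' < pos b)) {a b : α} (hab : a ≠ b) :
    ¬ Forces N (a, b) (b, a) := by
  have key : ∀ y : α × α, Forces N (a, b) y →
      y.1 ≠ y.2 ∧ (pos a < pos b ↔ pos y.1 < pos y.2) := by
    intro y hy
    induction hy with
    | refl => exact ⟨hab, Iff.rfl⟩
    | @tail x y hx hxy ih =>
      obtain ⟨x₁, x₂⟩ := x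
      obtain ⟨y₁, y₂⟩ := y
      obtain ⟨i₁, i₂⟩ := ih
      rcases hxy with ⟨he, hs⟩ | ⟨he, hs⟩
      · obtain rfl : x₂ = y₂ := he
        exact ⟨h.ne (h.symm hs), i₂.trans (hN _ _ _ hs)⟩
      · obtain rfl : x₁ = y₁ := he
        have hne := h.ne (h.symm hs)
        refine ⟨hne.symm, i₂.trans ?_⟩
        have := hN _ _ _ hs
        have e₁ : pos x₁ ≠ pos x₂ := fun e => i₁ (hpos e)
        have e₂ : pos y₂ ≠ pos x₁ := fun e => hne (hpos e)
        dsimp only at this ⊢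
        omega
  intro hF
  have := (key _ hF).2
  have hne : pos a ≠ pos b := fun e => hab (hpos e)
  dsimp only at this
  omega

variable [LinearOrder α]

/-- With `f = (μ, ν)`, `triangle` carries the cycle over to `μ`, `ν`, `c`. Now `(μ, c)` lies in the
class of `(a, c)`, so the key of `g` is below its key and `g` starts with `μ`. A second use of
`triangle`, along the path from `(c, μ)` to `g`, shows that `(ν, c)` forces `(ν, μ)`, although `μ`
stands before `ν`. -/
theorem not_cyclic_of_le (h : IsSeparation N) (hkey : ∀ x y : α × α, key x < key y → x.1 ≤ y.1)
    {a b c : α} (hab : Before N key a b) (hbc : Before N key b c) (hca : Before N key c a)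
    {f g : α × α} (hf : Forces N (a, b) f) (hg : Forces N (c, a) g)
    (hg' : ∀ g', Forces N (a, c) g' → key g < key g') (hfg : f.1 ≤ g.1) : False := by
  have t₁ := triangle h (fun hF => (hab.of_forces h hF).asymm hbc)
    (fun hF => (hab.of_forces h hF).asymm hca) hf
  obtain ⟨μ, ν⟩ := f
  obtain ⟨g₁, g₂⟩ := g
  have hab' := hab.of_forces h hf
  have hbc' := hbc.of_forces h t₁.1
  have hca' := hca.of_forces h t₁.2
  have hle := hkey _ _ (hg' (μ, c) t₁.2.swap)
  obtain rfl : μ = g₁ := le_antisymm hfg hle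
  have t₂ := triangle h (fun hF => (hca'.of_forces h hF).asymm hab')
    (fun hF => (hca'.of_forces h hF).asymm hbc') ((t₁.2.symm h).trans hg)
  exact (hbc'.of_forces h t₂.2).asymm hab'

theorem Before.trans (hinj : Function.Injective key) (h : IsSeparation N)
    (hkey : ∀ x y : α × α, key x < key y → x.1 ≤ y.1)
    (hno : ∀ a b, a ≠ b → ¬ Forces N (a, b) (b, a)) {a b c : α}
    (hab : Before N key a b) (hbc : Before N key b c) : Before N key a c := by
  by_cases hac : a = c
  · subst hac
    exact absurd hbc hab.asymm
  refine (before_total hinj h (hno a c hac)).resolve_right fun hca => ?_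
  obtain ⟨f₁, h₁, h₁'⟩ := id hab
  obtain ⟨f₂, h₂, h₂'⟩ := id hbc
  obtain ⟨f₃, h₃, h₃'⟩ := id hca
  -- The first components of the three witnesses cannot decrease strictly all the way around the
  -- cycle, so `not_cyclic_of_le` applies after some rotation.
  rcases le_total f₁.1 f₃.1 with h13 | h31
  · exact not_cyclic_of_le h hkey hab hbc hca h₁ h₃ h₃' h13
  · rcases le_total f₃.1 f₂.1 with h32 | h23
    · exact not_cyclic_of_le h hkey hca hab hbc h₃ h₂ h₂' h32
    · rcases le_total f₂.1 f₁.1 with h21 | h12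
      · exact not_cyclic_of_le h hkey hbc hca hab h₂ h₁ h₁' h21
      · exact not_cyclic_of_le h hkey hab hbc hca h₁ h₃ h₃' (h12.trans h23)

end ConsecutiveOrder

/-! ### The algorithm

The items, the voters, and all intermediate objects are natural numbers; tables are arrays. -/

/-- The data of an instance, together with the sizes of the tables of the algorithm. -/
structure Profile where
  n : ℕ
  m : ℕ
  b : ℕ
  c : ℕ → ℕ
  u : ℕ → ℕ → ℕ
  pairs : ℕ
  nodes : ℕ
  grid : ℕ
  levels : ℕ
  states : ℕ
  length : ℕ

namespace Profile

open scoped Classical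

variable (P : Profile)

/-- Some voter prefers both `a` and `a'` to `z`. -/
def Sep (a b z : ℕ) : Prop := ∃ v < P.n, P.u v z < P.u v a ∧ P.u v z < P.u v b

/-- The ordered pairs of items with codes `e` and `f` force each other directly. -/
def Link (e f : ℕ) : Prop :=
  (boundedMod P.pairs P.m e = boundedMod P.pairs P.m f ∧
    P.Sep (boundedDiv P.pairs P.m e) (boundedDiv P.pairs P.m f) (boundedMod P.pairs P.m e)) ∨
  (boundedDiv P.pairs P.m e = boundedDiv P.pairs P.m f ∧
    P.Sep (boundedMod P.pairs P.m e) (boundedMod P.pairs P.m f) (boundedDiv P.pairs P.m e))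

/-- Transitive closure of `Link`, by paths through ever more intermediate pairs. -/
noncomputable def closureEntry (A : ℕ → ℕ) (k e f : ℕ) : ℕ :=
  if k = 0 then if e = f ∨ P.Link e f then 1 else 0
  else if A (((k - 1) * P.pairs + e) * P.pairs + f) = 1 ∨
    (A (((k - 1) * P.pairs + e) * P.pairs + (k - 1)) = 1 ∧
      A (((k - 1) * P.pairs + (k - 1)) * P.pairs + f) = 1) then 1 else 0

/-- The pair of items with code `e` forces the one with code `f`. -/
def ForcesCode (A : ℕ → ℕ) (e f : ℕ) : Prop := A ((P.pairs * P.pairs + e) * P.pairs + f) = 1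

/-- The item `a` stands before the item `z` in the computed order. -/
def Precedes (A : ℕ → ℕ) (a z : ℕ) : Prop :=
  ∃ f < P.pairs, P.ForcesCode A (a * P.m + z) f ∧
    ∀ g < P.pairs, g ≤ f → ¬ P.ForcesCode A (z * P.m + a) g

/-- The computed order of the items makes the profile single-peaked. -/
def IsAxis (A : ℕ → ℕ) : Prop :=
  ∀ a < P.m, ∀ y < P.m, ∀ z < P.m, P.Precedes A a y → P.Precedes A y z →
    P.Precedes A a z ∧ ∀ v < P.n, ¬ (P.u v y < P.u v a ∧ P.u v y < P.u v z)

/-- The number of weak comparisons that the voters `g` and `v` share. -/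
noncomputable def agreement (g v : ℕ) : ℕ :=
  ∑ p ∈ Finset.range P.m, ∑ p' ∈ Finset.range P.m,
    if P.u g p ≤ P.u g p' ∧ P.u v p ≤ P.u v p' then 1 else 0

/-- The order of the voters by agreement with the voter `g`. -/
def Ahead (g v w : ℕ) : Prop :=
  P.agreement g w < P.agreement g v ∨ (P.agreement g w = P.agreement g v ∧ v < w)

/-- The source of the graph. Its other nodes are, for every item `p`, the node `p` and, for every
two voters `g` and `v`, the node `(1 + g * n + v) * m + p`, which stands for a block of voters that
ends in `v` in the order by agreement with `g` and is served by `p`. -/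
def source : ℕ := P.nodes - 1

def group (x : ℕ) : ℕ := boundedDiv P.nodes P.m x

def item (x : ℕ) : ℕ := boundedMod P.nodes P.m x

def guess (x : ℕ) : ℕ := boundedDiv P.nodes P.n (P.group x - 1)

def last (x : ℕ) : ℕ := boundedMod P.nodes P.n (P.group x - 1)

/-- Both kinds of walks leave from the same source and never mix. The test `IsAxis` belongs to the
edge, so walks through item nodes are sound for every profile, single-peaked or not. Walks through
blocks need no such test. -/
def Edge (A : ℕ → ℕ) (x y : ℕ) : Prop :=
  y ≠ P.source ∧
  ((P.group y = 0 ∧ P.IsAxis A ∧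
      (x = P.source ∨ (P.group x = 0 ∧ P.Precedes A (P.item x) (P.item y)))) ∨
    (P.group y ≠ 0 ∧
      (x = P.source ∨ (P.group x ≠ 0 ∧ P.guess x = P.guess y ∧
        P.Ahead (P.guess y) (P.last x) (P.last y)))))

/-- The utility gained along an edge. -/
noncomputable def gain (x y : ℕ) : ℕ :=
  if P.group y = 0 then
    ∑ v ∈ Finset.range P.n, (P.u v (P.item y) - if x = P.source then 0 else P.u v (P.item x))
  else
    ∑ z ∈ Finset.range P.n,
      if (x = P.source ∨ P.Ahead (P.guess y) (P.last x) z) ∧ ¬ P.Ahead (P.guess y) (P.last y) z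
      then P.u z (P.item y) else 0

/-- A utility `w`, measured in units of the largest utility of an affordable item divided by
`grid`. -/
noncomputable def scaled (w : ℕ) : ℕ :=
  ∑ t ∈ Finset.range P.grid,
    if ∀ p < P.m, P.c p ≤ P.b →
      boundedMul P.grid (t + 1) (∑ v ∈ Finset.range P.n, P.u v p) ≤ w * P.grid then 1 else 0

/-- Zero stands for a missing edge, hence the shift by one. -/
noncomputable def edgeEntry (A : ℕ → ℕ) (x y : ℕ) : ℕ :=
  if P.Edge A x y then P.scaled (P.gain x y) + 1 else 0

/-- The cost of reaching `x` from the source in `k` steps with scaled utility `q`, if the last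
but one node is `y`. -/
noncomputable def candidate (W D : ℕ → ℕ) (k x q y : ℕ) : ℕ :=
  if W (y * P.nodes + x) ≠ 0 ∧ W (y * P.nodes + x) - 1 ≤ q then
    D (((k - 1) * P.nodes + y) * P.levels + (q - (W (y * P.nodes + x) - 1))) + P.c (P.item x)
  else P.b + 1

noncomputable def previous (W D : ℕ → ℕ) (k x q : ℕ) : ℕ :=
  pick P.nodes fun y => ∀ z < P.nodes, P.candidate W D k x q y ≤ P.candidate W D k x q z

/-- The least cost of reaching `x` from the source in `k` steps with scaled utility `q`. -/
noncomputable def costEntry (W D : ℕ → ℕ) (k x q : ℕ) : ℕ :=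
  if k = 0 then if x = P.source ∧ q = 0 then 0 else P.b + 1
  else P.candidate W D k x q (P.previous W D k x q)

/-- For `k = 0` the truncated subtraction stays at level `0`, so following the pointers never leaves
the table. -/
noncomputable def previousEntry (W D : ℕ → ℕ) (k x q : ℕ) : ℕ :=
  ((k - 1) * P.nodes + P.previous W D k x q) * P.levels +
    (q - (W (P.previous W D k x q * P.nodes + x) - 1))

/-- The label `0` means that no item is collected; the items are shifted by one. -/
def labelEntry (k x : ℕ) : ℕ := if k = 0 then 0 else P.item x + 1

/-- An affordable state of the largest scaled utility. -/
noncomputable def bestState (D : ℕ → ℕ) : ℕ :=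
  pick P.states fun i => D i ≤ P.b ∧ ∀ j < P.states, D j ≤ P.b →
    boundedMod P.states P.levels j ≤ boundedMod P.states P.levels i

noncomputable def traceEntry (D R T : ℕ → ℕ) (t : ℕ) : ℕ :=
  if t = 0 then P.bestState D else R (T (t - 1))

/-- The result: the items on the path that leads to the best state. -/
noncomputable def chosenEntry (L T : ℕ → ℕ) (p : ℕ) : ℕ :=
  if ∃ t < P.length, L (T t) = p + 1 then 1 else 0

/-- The data as they are kept in the store. -/
def ofStore (s : RAM.Store) : Profile where
  n := s.reg 1
  m := s.reg 2
  b := s.arr 0 4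
  c p := s.arr 0 (5 + p)
  u v p := s.arr 0 (5 + s.reg 2 + (v * s.reg 2 + p))
  pairs := s.reg 4
  nodes := s.reg 6
  grid := s.reg 7
  levels := s.reg 8
  states := s.reg 10
  length := s.reg 11

end Profile

/-! ### Definability of all table entries -/

namespace RAM

open Profile

section Definability

variable {Γ : Type} [Ctx Γ] {f g h k : Γ → ℕ}

theorem definable_u (hf : Definable f) (hg : Definable g) :
    Definable (fun γ => (ofStore (Ctx.store γ)).u (f γ) (g γ)) :=
  .cell 0 (((Definable.const 5).add (.param 2)).add ((hf.mul_param 2).add hg))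

theorem definable_c (hf : Definable f) : Definable (fun γ => (ofStore (Ctx.store γ)).c (f γ)) :=
  .cell 0 ((Definable.const 5).add hf)

theorem definable_b : Definable (fun γ : Γ => (ofStore (Ctx.store γ)).b) :=
  .cell 0 (.const 4)

theorem decides_sep (hf : Definable f) (hg : Definable g) (hh : Definable h) :
    Decides (fun γ => (ofStore (Ctx.store γ)).Sep (f γ) (g γ) (h γ)) :=
  .exists_lt 1 (.and (.lt (definable_u .var hh.weaken) (definable_u .var hf.weaken))
    (.lt (definable_u .var hh.weaken) (definable_u .var hg.weaken)))

theorem decides_link (hf : Definable f) (hg : Definable g) :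
    Decides (fun γ => (ofStore (Ctx.store γ)).Link (f γ) (g γ)) :=
  .or (.and (.eq (hf.boundedMod 4 2) (hg.boundedMod 4 2))
      (decides_sep (hf.boundedDiv 4 2) (hg.boundedDiv 4 2) (hf.boundedMod 4 2)))
    (.and (.eq (hf.boundedDiv 4 2) (hg.boundedDiv 4 2))
      (decides_sep (hf.boundedMod 4 2) (hg.boundedMod 4 2) (hf.boundedDiv 4 2)))

theorem definable_closureEntry (hf : Definable f) (hg : Definable g) (hh : Definable h) :
    Definable (fun γ => (ofStore (Ctx.store γ)).closureEntry ((Ctx.store γ).arr 1)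
      (f γ) (g γ) (h γ)) := by
  classical
  have hk := hf.sub (.const 1)
  exact .ite (.eq hf (.const 0)) (.ite (.or (.eq hg hh) (decides_link hg hh)) (.const 1) (.const 0))
    (.ite (.or (.eq (.cell 1 (((((hk.mul_param 4).add hg).mul_param 4)).add hh)) (.const 1))
      (.and (.eq (.cell 1 (((((hk.mul_param 4).add hg).mul_param 4)).add hk)) (.const 1))
        (.eq (.cell 1 (((((hk.mul_param 4).add hk).mul_param 4)).add hh)) (.const 1))))
      (.const 1) (.const 0))

theorem decides_forcesCode (hf : Definable f) (hg : Definable g) :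
    Decides (fun γ => (ofStore (Ctx.store γ)).ForcesCode ((Ctx.store γ).arr 1) (f γ) (g γ)) :=
  .eq (.cell 1 ((((((Definable.param 4).mul_param 4)).add hf).mul_param 4).add hg)) (.const 1)

theorem decides_precedes (hf : Definable f) (hg : Definable g) :
    Decides (fun γ => (ofStore (Ctx.store γ)).Precedes ((Ctx.store γ).arr 1) (f γ) (g γ)) :=
  .exists_lt 4 (.and (decides_forcesCode ((hf.weaken.mul_param 2).add hg.weaken) .var)
    (.forall_lt 4 (.imp (.le .var Definable.var.weaken) (.not (decides_forcesCode
      ((hg.weaken.weaken.mul_param 2).add hf.weaken.weaken) .var)))))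

theorem decides_isAxis :
    Decides (fun γ : Γ => (ofStore (Ctx.store γ)).IsAxis ((Ctx.store γ).arr 1)) := by
  refine .forall_lt 2 (.forall_lt 2 (.forall_lt 2 ?_))
  have ha : Definable (fun γ : ((Γ × ℕ) × ℕ) × ℕ => γ.1.1.2) := Definable.var.weaken.weaken
  have hy : Definable (fun γ : ((Γ × ℕ) × ℕ) × ℕ => γ.1.2) := Definable.var.weaken
  have hz : Definable (fun γ : ((Γ × ℕ) × ℕ) × ℕ => γ.2) := Definable.var
  exact .imp (decides_precedes ha hy) (.imp (decides_precedes hy hz) (.and (decides_precedes ha hz)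
    (.forall_lt 1 (.not (.and (.lt (definable_u .var hy.weaken) (definable_u .var ha.weaken))
      (.lt (definable_u .var hy.weaken) (definable_u .var hz.weaken)))))))

theorem definable_agreement (hf : Definable f) (hg : Definable g) :
    Definable (fun γ => (ofStore (Ctx.store γ)).agreement (f γ) (g γ)) := by
  classical
  exact .sum 2 (.sum 2 (.ite (.and
    (.le (definable_u hf.weaken.weaken Definable.var.weaken) (definable_u hf.weaken.weaken .var))
    (.le (definable_u hg.weaken.weaken Definable.var.weaken) (definable_u hg.weaken.weaken .var)))
    (.const 1) (.const 0)))

theorem decides_ahead (hf : Definable f) (hg : Definable g) (hh : Definable h) :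
    Decides (fun γ => (ofStore (Ctx.store γ)).Ahead (f γ) (g γ) (h γ)) :=
  .or (.lt (definable_agreement hf hh) (definable_agreement hf hg))
    (.and (.eq (definable_agreement hf hh) (definable_agreement hf hg)) (.lt hg hh))

theorem definable_source : Definable (fun γ : Γ => (ofStore (Ctx.store γ)).source) :=
  (Definable.param 6).sub (.const 1)

theorem definable_group (hf : Definable f) :
    Definable (fun γ => (ofStore (Ctx.store γ)).group (f γ)) := hf.boundedDiv 6 2

theorem definable_item (hf : Definable f) :
    Definable (fun γ => (ofStore (Ctx.store γ)).item (f γ)) := hf.boundedMod 6 2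

theorem definable_guess (hf : Definable f) :
    Definable (fun γ => (ofStore (Ctx.store γ)).guess (f γ)) :=
  ((definable_group hf).sub (.const 1)).boundedDiv 6 1

theorem definable_last (hf : Definable f) :
    Definable (fun γ => (ofStore (Ctx.store γ)).last (f γ)) :=
  ((definable_group hf).sub (.const 1)).boundedMod 6 1

theorem decides_edge (hf : Definable f) (hg : Definable g) :
    Decides (fun γ => (ofStore (Ctx.store γ)).Edge ((Ctx.store γ).arr 1) (f γ) (g γ)) :=
  .and (.not (.eq hg definable_source)) (.or
    (.and (.eq (definable_group hg) (.const 0)) (.and decides_isAxis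
      (.or (.eq hf definable_source) (.and (.eq (definable_group hf) (.const 0))
        (decides_precedes (definable_item hf) (definable_item hg))))))
    (.and (.not (.eq (definable_group hg) (.const 0)))
      (.or (.eq hf definable_source) (.and (.not (.eq (definable_group hf) (.const 0)))
        (.and (.eq (definable_guess hf) (definable_guess hg))
          (decides_ahead (definable_guess hg) (definable_last hf) (definable_last hg)))))))

theorem definable_gain (hf : Definable f) (hg : Definable g) :
    Definable (fun γ => (ofStore (Ctx.store γ)).gain (f γ) (g γ)) := by
  classical
  exact .ite (.eq (definable_group hg) (.const 0))
    (.sum 1 (.sub (definable_u .var (definable_item hg).weaken)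
      (.ite (.eq hf.weaken definable_source) (.const 0)
        (definable_u .var (definable_item hf).weaken))))
    (.sum 1 (.ite (.and (.or (.eq hf.weaken definable_source)
      (decides_ahead (definable_guess hg).weaken (definable_last hf).weaken .var))
      (.not (decides_ahead (definable_guess hg).weaken (definable_last hg).weaken .var)))
      (definable_u .var (definable_item hg).weaken) (.const 0)))

theorem definable_scaled (hf : Definable f) :
    Definable (fun γ => (ofStore (Ctx.store γ)).scaled (f γ)) := by
  classical
  refine .sum 7 (.ite (.forall_lt 2 (.imp (.le (definable_c .var) definable_b)
    (.le (Definable.boundedMul 7 (Definable.var.weaken.add (.const 1))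
      (.sum 1 (definable_u .var Definable.var.weaken)))
      (hf.weaken.weaken.mul_param 7)))) (.const 1) (.const 0))

theorem definable_edgeEntry (hf : Definable f) (hg : Definable g) :
    Definable (fun γ => (ofStore (Ctx.store γ)).edgeEntry ((Ctx.store γ).arr 1) (f γ) (g γ)) := by
  classical
  exact .ite (decides_edge hf hg) ((definable_scaled (definable_gain hf hg)).add (.const 1))
    (.const 0)

theorem definable_candidate (hf : Definable f) (hg : Definable g) (hh : Definable h)
    (hk : Definable k) :
    Definable (fun γ => (ofStore (Ctx.store γ)).candidate ((Ctx.store γ).arr 2)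
      ((Ctx.store γ).arr 3) (f γ) (g γ) (h γ) (k γ)) := by
  have hw : Definable (fun γ => (Ctx.store γ).arr 2 (k γ * (Ctx.store γ).reg 6 + g γ)) :=
    .cell 2 ((hk.mul_param 6).add hg)
  exact .ite (.and (.not (.eq hw (.const 0))) (.le (hw.sub (.const 1)) hh))
    (.add (.cell 3 ((((((hf.sub (.const 1)).mul_param 6).add hk).mul_param 8)).add
      (hh.sub (hw.sub (.const 1))))) (definable_c (definable_item hg)))
    (definable_b.add (.const 1))

theorem definable_previous (hf : Definable f) (hg : Definable g) (hh : Definable h) :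
    Definable (fun γ => (ofStore (Ctx.store γ)).previous ((Ctx.store γ).arr 2)
      ((Ctx.store γ).arr 3) (f γ) (g γ) (h γ)) :=
  .pick 6 (.forall_lt 6 (.le
    (definable_candidate hf.weaken.weaken hg.weaken.weaken hh.weaken.weaken Definable.var.weaken)
    (definable_candidate hf.weaken.weaken hg.weaken.weaken hh.weaken.weaken .var)))

theorem definable_costEntry (hf : Definable f) (hg : Definable g) (hh : Definable h) :
    Definable (fun γ => (ofStore (Ctx.store γ)).costEntry ((Ctx.store γ).arr 2)
      ((Ctx.store γ).arr 3) (f γ) (g γ) (h γ)) :=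
  .ite (.eq hf (.const 0))
    (.ite (.and (.eq hg definable_source) (.eq hh (.const 0))) (.const 0)
      (definable_b.add (.const 1)))
    (definable_candidate hf hg hh (definable_previous hf hg hh))

theorem definable_previousEntry (hf : Definable f) (hg : Definable g) (hh : Definable h) :
    Definable (fun γ => (ofStore (Ctx.store γ)).previousEntry ((Ctx.store γ).arr 2)
      ((Ctx.store γ).arr 3) (f γ) (g γ) (h γ)) := by
  have hp := definable_previous hf hg hh
  exact (((((hf.sub (.const 1)).mul_param 6).add hp).mul_param 8)).add
    (hh.sub ((Definable.cell 2 ((hp.mul_param 6).add hg)).sub (.const 1)))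

theorem definable_labelEntry (hf : Definable f) (hg : Definable g) :
    Definable (fun γ => (ofStore (Ctx.store γ)).labelEntry (f γ) (g γ)) :=
  .ite (.eq hf (.const 0)) (.const 0) ((definable_item hg).add (.const 1))

theorem definable_bestState :
    Definable (fun γ : Γ => (ofStore (Ctx.store γ)).bestState ((Ctx.store γ).arr 3)) :=
  .pick 10 (.and (.le (.cell 3 .var) definable_b) (.forall_lt 10 (.imp
    (.le (.cell 3 .var) definable_b)
    (.le (Definable.var.boundedMod 10 8) (Definable.var.weaken.boundedMod 10 8)))))

theorem definable_traceEntry (hf : Definable f) :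
    Definable (fun γ => (ofStore (Ctx.store γ)).traceEntry ((Ctx.store γ).arr 3)
      ((Ctx.store γ).arr 4) ((Ctx.store γ).arr 6) (f γ)) :=
  .ite (.eq hf (.const 0)) definable_bestState (.cell 4 (.cell 6 (hf.sub (.const 1))))

theorem definable_chosenEntry (hf : Definable f) :
    Definable (fun γ => (ofStore (Ctx.store γ)).chosenEntry ((Ctx.store γ).arr 5)
      ((Ctx.store γ).arr 6) (f γ)) := by
  classical
  exact .ite (.exists_lt 11 (.eq (.cell 5 (.cell 6 .var)) (hf.weaken.add (.const 1))))
    (.const 1) (.const 0)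

end Definability

end RAM

/-! ### Correct table sizes and the meaning of the closure table -/

namespace Profile

variable (P : Profile)

structure Valid : Prop where
  m_pos : 0 < P.m
  pairs_eq : P.pairs = P.m * P.m
  nodes_eq : P.nodes = (1 + P.n * P.n) * P.m + 1
  levels_eq : P.levels = P.grid * P.m + 1
  states_eq : P.states = (P.m + 1) * P.nodes * P.levels
  length_eq : P.length = P.m + 1

/-- The array `A` holds the table of the transitive closure. -/
def IsClosure (A : ℕ → ℕ) : Prop :=
  ∀ k e f, k ≤ P.pairs → e < P.pairs → f < P.pairs →
    A ((k * P.pairs + e) * P.pairs + f) = P.closureEntry A k e f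

variable {P}

/-! ### The order of the items -/

section Closure

variable {A : ℕ → ℕ}

theorem IsClosure.zero (h : P.IsClosure A) {e f : ℕ} (he : e < P.pairs) (hf : f < P.pairs) :
    A ((0 * P.pairs + e) * P.pairs + f) = 1 ↔ e = f ∨ P.Link e f := by
  classical
  rw [h 0 e f (by omega) he hf, closureEntry, if_pos rfl]
  split_ifs with h <;> simp [h]

theorem IsClosure.succ (h : P.IsClosure A) {k e f : ℕ} (hk : k < P.pairs) (he : e < P.pairs)
    (hf : f < P.pairs) :
    A (((k + 1) * P.pairs + e) * P.pairs + f) = 1 ↔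
      A ((k * P.pairs + e) * P.pairs + f) = 1 ∨ (A ((k * P.pairs + e) * P.pairs + k) = 1 ∧
        A ((k * P.pairs + k) * P.pairs + f) = 1) := by
  classical
  rw [h (k + 1) e f (by omega) he hf, closureEntry, if_neg (by omega), Nat.add_sub_cancel]
  split_ifs with h <;> simp [h]

theorem IsClosure.of_link (h : P.IsClosure A) {e f : ℕ} (he : e < P.pairs) (hf : f < P.pairs)
    (hl : e = f ∨ P.Link e f) : P.ForcesCode A e f := by
  suffices ∀ k ≤ P.pairs, A ((k * P.pairs + e) * P.pairs + f) = 1 from this _ le_rfl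
  intro k
  induction k with
  | zero => exact fun _ => (h.zero he hf).2 hl
  | succ k ih => exact fun hk => (h.succ (by omega) he hf).2 (.inl (ih (by omega)))

theorem IsClosure.trans (h : P.IsClosure A) {e f g : ℕ} (he : e < P.pairs) (hf : f < P.pairs)
    (hg : g < P.pairs) (h₁ : P.ForcesCode A e f) (h₂ : P.ForcesCode A f g) :
    P.ForcesCode A e g := by
  -- At level `k` every `f < k` may serve as an intermediate pair; at the last level this is full
  -- transitivity. The new intermediate `f = k` is allowed by the recurrence itself, and the older
  -- ones combine four instances of the induction hypothesis.
  suffices H : ∀ k ≤ P.pairs, ∀ f < k, ∀ e < P.pairs, ∀ g < P.pairs,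
      A ((k * P.pairs + e) * P.pairs + f) = 1 → A ((k * P.pairs + f) * P.pairs + g) = 1 →
      A ((k * P.pairs + e) * P.pairs + g) = 1 from H _ le_rfl f hf e he g hg h₁ h₂
  intro k
  induction k with
  | zero => intro _ f hf; omega
  | succ k ih =>
    intro hk f hf e he g hg
    have hf' : f < P.pairs := by omega
    have hk' : k < P.pairs := by omega
    rw [h.succ hk' he hf', h.succ hk' hf' hg, h.succ hk' he hg]
    rcases Nat.lt_succ_iff_lt_or_eq.1 hf with hlt | rfl
    · have i₁ := ih (by omega) f hlt e he g hg
      have i₂ := ih (by omega) f hlt e he k hk'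
      have i₃ := ih (by omega) f hlt k hk' g hg
      have i₄ := ih (by omega) f hlt k hk' k hk'
      tauto
    · tauto

theorem IsClosure.induction (h : P.IsClosure A) {C : ℕ → ℕ → Prop} (hrefl : ∀ e < P.pairs, C e e)
    (hlink : ∀ e f, e < P.pairs → f < P.pairs → P.Link e f → C e f)
    (htrans : ∀ e f g, f < P.pairs → C e f → C f g → C e g) {e f : ℕ} (he : e < P.pairs)
    (hf : f < P.pairs)
    (hF : P.ForcesCode A e f) : C e f := by
  suffices H : ∀ k ≤ P.pairs, ∀ e < P.pairs, ∀ f < P.pairs,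
      A ((k * P.pairs + e) * P.pairs + f) = 1 → C e f from H _ le_rfl e he f hf hF
  intro k
  induction k with
  | zero =>
    intro _ e he f hf hA
    rcases (h.zero he hf).1 hA with rfl | hl
    · exact hrefl e he
    · exact hlink e f he hf hl
  | succ k ih =>
    intro hk e he f hf hA
    rcases (h.succ (by omega) he hf).1 hA with h₁ | ⟨h₁, h₂⟩
    · exact ih (by omega) e he f hf h₁
    · exact htrans e k f (by omega) (ih (by omega) e he k (by omega) h₁)
        (ih (by omega) k (by omega) f hf h₂)

variable (P) in
/-- Separation, for items of the instance. -/
def SepFin (a a' z : Fin P.m) : Prop := P.Sep a a' z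

variable (P) in
def code (x : Fin P.m × Fin P.m) : ℕ := x.1 * P.m + x.2

theorem Valid.code_lt (hP : P.Valid) (x : Fin P.m × Fin P.m) : P.code x < P.pairs := by
  rw [hP.pairs_eq, code]
  have h₁ := x.1.2
  have h₂ := x.2.2
  nlinarith [Nat.mul_le_mul_right P.m (Nat.succ_le_of_lt h₁)]

theorem code_div (hP : P.Valid) (x : Fin P.m × Fin P.m) :
    boundedDiv P.pairs P.m (P.code x) = x.1 := by
  rw [boundedDiv_eq hP.m_pos ((Nat.div_le_self _ _).trans (hP.code_lt x).le), code, mul_comm,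
    Nat.mul_add_div hP.m_pos, Nat.div_eq_of_lt x.2.2, add_zero]

theorem code_mod (hP : P.Valid) (x : Fin P.m × Fin P.m) :
    boundedMod P.pairs P.m (P.code x) = x.2 := by
  rw [boundedMod_eq hP.m_pos ((Nat.div_le_self _ _).trans (hP.code_lt x).le), code,
    Nat.mul_add_mod_self_right, Nat.mod_eq_of_lt x.2.2]

theorem code_injective (hP : P.Valid) : Function.Injective P.code := fun x y h =>
  Prod.ext (Fin.ext (by rw [← code_div hP, h, code_div hP]))
    (Fin.ext (by rw [← code_mod hP, h, code_mod hP]))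

theorem exists_code (hP : P.Valid) {e : ℕ} (he : e < P.pairs) : ∃ x, P.code x = e := by
  rw [hP.pairs_eq] at he
  exact ⟨(⟨e / P.m, Nat.div_lt_of_lt_mul he⟩, ⟨e % P.m, Nat.mod_lt _ hP.m_pos⟩),
    Nat.div_add_mod' _ _⟩

theorem le_of_code_lt (x y : Fin P.m × Fin P.m) (h : P.code x < P.code y) : x.1 ≤ y.1 := by
  by_contra hlt
  have hlt : (y.1 : ℕ) + 1 ≤ x.1 := Nat.succ_le_of_lt (Fin.lt_def.1 (not_le.1 hlt))
  have := Nat.mul_le_mul_right P.m hlt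
  have h₂ := y.2.2
  unfold code at h
  rw [Nat.succ_mul] at this
  omega

open ConsecutiveOrder

theorem link_code (hP : P.Valid) (x y : Fin P.m × Fin P.m) :
    P.Link (P.code x) (P.code y) ↔ Step P.SepFin x y := by
  simp only [Link, code_div hP, code_mod hP, Step, SepFin, Fin.ext_iff]

theorem forcesCode_iff (hP : P.Valid) (h : P.IsClosure A) (x y : Fin P.m × Fin P.m) :
    P.ForcesCode A (P.code x) (P.code y) ↔ Forces P.SepFin x y := by
  constructor
  · intro hF
    refine h.induction (C := fun e f => ∀ x y, P.code x = e → P.code y = f →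
      Forces P.SepFin x y) ?_ ?_ ?_ (hP.code_lt x) (hP.code_lt y) hF x y rfl rfl
    · rintro e - x y rfl hxy
      rw [code_injective hP hxy]
      exact .refl
    · rintro e f - - hl x y rfl rfl
      exact .single ((link_code hP x y).1 hl)
    · intro e f g hf h₁ h₂ x y hx hy
      obtain ⟨z, hz⟩ := exists_code hP hf
      exact (h₁ x z hx hz).trans (h₂ z y hz hy)
  · intro hF
    induction hF with
    | refl => exact h.of_link (hP.code_lt _) (hP.code_lt _) (.inl rfl)
    | tail _ hs ih =>
      exact h.trans (hP.code_lt _) (hP.code_lt _) (hP.code_lt _) ih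
        (h.of_link (hP.code_lt _) (hP.code_lt _) (.inr ((link_code hP _ _).2 hs)))

theorem precedes_iff (hP : P.Valid) (h : P.IsClosure A) (a z : Fin P.m) :
    P.Precedes A a z ↔ Before P.SepFin P.code a z := by
  constructor
  · rintro ⟨f, hf, h₁, h₂⟩
    obtain ⟨x, rfl⟩ := exists_code hP hf
    refine ⟨x, (forcesCode_iff hP h (a, z) x).1 h₁, fun y hy => ?_⟩
    by_contra hlt
    exact h₂ _ (hP.code_lt y) (not_lt.1 hlt) ((forcesCode_iff hP h (z, a) y).2 hy)
  · rintro ⟨x, h₁, h₂⟩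
    refine ⟨_, hP.code_lt x, (forcesCode_iff hP h (a, z) x).2 h₁, fun f hf hle hF => ?_⟩
    obtain ⟨y, rfl⟩ := exists_code hP hf
    exact absurd (h₂ y ((forcesCode_iff hP h (z, a) y).1 hF)) (not_lt.2 hle)

/-- For `split`, the separating voter compares `z` with `b`: if `z` is better, it is separated from
`b` together with `a` and `a'`; otherwise `z` is worse than both of these. -/
theorem isSeparation_sepFin : IsSeparation P.SepFin where
  symm := fun ⟨v, hv, h₁, h₂⟩ => ⟨v, hv, h₂, h₁⟩
  ne := fun ⟨v, _, h₁, _⟩ e => by subst e; exact lt_irrefl _ h₁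
  split := fun {a a' b} z ⟨v, hv, h₁, h₂⟩ => by
    rcases lt_or_ge (P.u v b) (P.u v z) with h | h
    · exact .inl ⟨⟨v, hv, h₁, h⟩, v, hv, h₂, h⟩
    · exact .inr ⟨v, hv, h.trans_lt h₁, h.trans_lt h₂⟩

variable (P) in
/-- Single-peakedness with respect to positions of the items. -/
def PeakedAt (pos : Fin P.m → ℕ) : Prop :=
  Function.Injective pos ∧ ∀ a a' z : Fin P.m, P.Sep a a' z → (pos a < pos z ↔ pos a' < pos z)

variable (P) in
/-- The computed relation compares any two items and makes the profile single-peaked. -/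
structure HasAxis (A : ℕ → ℕ) : Prop where
  isAxis : P.IsAxis A
  total : ∀ a < P.m, ∀ z < P.m, a ≠ z → P.Precedes A a z ∨ P.Precedes A z a

/-- The given order `pos` serves only to exclude that a pair forces its reversal. The computed axis
may be a different one. -/
theorem hasAxis (hP : P.Valid) (h : P.IsClosure A) {pos : Fin P.m → ℕ} (hpos : P.PeakedAt pos) :
    P.HasAxis A := by
  have hno : ∀ a b : Fin P.m, a ≠ b → ¬ Forces P.SepFin (a, b) (b, a) := fun a b hab =>
    not_forces_swap isSeparation_sepFin pos hpos.1 hpos.2 hab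
  have hpre : ∀ {a z : ℕ} (ha : a < P.m) (hz : z < P.m),
      P.Precedes A a z ↔ Before P.SepFin P.code ⟨a, ha⟩ ⟨z, hz⟩ := fun ha hz =>
    precedes_iff hP h ⟨_, ha⟩ ⟨_, hz⟩
  refine ⟨fun a ha y hy z hz h₁ h₂ => ?_, fun a ha z hz hne => ?_⟩
  · rw [hpre ha hy] at h₁
    rw [hpre hy hz] at h₂
    rw [hpre ha hz]
    refine ⟨h₁.trans (code_injective hP) isSeparation_sepFin le_of_code_lt hno h₂, ?_⟩
    rintro v hv ⟨hv₁, hv₂⟩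
    -- A voter with a valley at `y` lets `(a, y)` force `(z, y)`, so `z` would stand before `y` as
    -- well.
    have hs : P.SepFin ⟨a, ha⟩ ⟨z, hz⟩ ⟨y, hy⟩ := ⟨v, hv, hv₁, hv₂⟩
    exact (h₁.of_forces isSeparation_sepFin (Forces.left hs)).asymm h₂
  · rw [hpre ha hz, hpre hz ha]
    exact before_total (code_injective hP) isSeparation_sepFin (hno _ _ (by simpa using hne))

end Closure

end Profile

/-! ### Walks and the bundles that they certify -/

namespace Profile

variable (P : Profile)

/-- Walks in the graph: `Reach A k x q t Z w` holds if some walk with `k` steps leads from the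
source to `x`, with scaled utility `q`, cost `t`, set of items `Z`, and utility `w`. -/
inductive Reach (A : ℕ → ℕ) : ℕ → ℕ → ℕ → ℕ → Finset ℕ → ℕ → Prop
  | source : Reach A 0 P.source 0 0 ∅ 0
  | step {k y q t : ℕ} {Z : Finset ℕ} {w x : ℕ} : Reach A k y q t Z w → x < P.nodes →
      P.Edge A y x → Reach A (k + 1) x (q + P.scaled (P.gain y x)) (t + P.c (P.item x))
        (insert (P.item x) Z) (w + P.gain y x)

/-- The total satisfaction with a set of items. -/
def sat (Z : Finset ℕ) : ℕ := ∑ v ∈ Finset.range P.n, Z.sup (P.u v)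

/-- The node for a block that ends in `v` and is served by `p`, with the order guessed by `g`. -/
def blockNode (g v p : ℕ) : ℕ := (1 + g * P.n + v) * P.m + p

variable {P} {A : ℕ → ℕ}

/-! ### Nodes -/

namespace Valid

variable (hP : P.Valid)
include hP

theorem source_eq : P.source = (1 + P.n * P.n) * P.m := by
  rw [source, hP.nodes_eq, Nat.add_sub_cancel]

theorem source_lt : P.source < P.nodes := by
  rw [hP.source_eq, hP.nodes_eq]; omega

theorem group_eq {x : ℕ} (hx : x < P.nodes) : P.group x = x / P.m :=
  boundedDiv_eq hP.m_pos ((Nat.div_le_self _ _).trans hx.le)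

theorem item_eq {x : ℕ} (hx : x < P.nodes) : P.item x = x % P.m :=
  boundedMod_eq hP.m_pos ((Nat.div_le_self _ _).trans hx.le)

theorem item_lt {x : ℕ} (hx : x < P.nodes) : P.item x < P.m := by
  rw [hP.item_eq hx]; exact Nat.mod_lt _ hP.m_pos

theorem lt_source {p : ℕ} (hp : p < P.m) : p < P.source := by
  rw [hP.source_eq, add_mul]; omega

theorem group_item {p : ℕ} (hp : p < P.m) : P.group p = 0 := by
  rw [hP.group_eq ((hP.lt_source hp).trans hP.source_lt), Nat.div_eq_of_lt hp]

theorem item_item {p : ℕ} (hp : p < P.m) : P.item p = p := by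
  rw [hP.item_eq ((hP.lt_source hp).trans hP.source_lt), Nat.mod_eq_of_lt hp]

variable {g v p : ℕ}

theorem blockNode_lt (hg : g < P.n) (hv : v < P.n) (hp : p < P.m) :
    P.blockNode g v p < P.source := by
  rw [hP.source_eq, blockNode]
  have h₁ : g * P.n + v + 1 ≤ P.n * P.n := by
    have := Nat.mul_le_mul_right P.n (Nat.succ_le_of_lt hg)
    rw [Nat.succ_mul] at this
    omega
  have h₂ := Nat.mul_le_mul_right P.m (show 1 + g * P.n + v + 1 ≤ 1 + P.n * P.n by omega)
  rw [Nat.succ_mul] at h₂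
  omega

theorem group_blockNode (hg : g < P.n) (hv : v < P.n) (hp : p < P.m) :
    P.group (P.blockNode g v p) = 1 + g * P.n + v := by
  rw [hP.group_eq ((hP.blockNode_lt hg hv hp).trans hP.source_lt), blockNode, mul_comm,
    Nat.mul_add_div hP.m_pos, Nat.div_eq_of_lt hp, add_zero]

theorem item_blockNode (hg : g < P.n) (hv : v < P.n) (hp : p < P.m) :
    P.item (P.blockNode g v p) = p := by
  rw [hP.item_eq ((hP.blockNode_lt hg hv hp).trans hP.source_lt), blockNode,
    Nat.mul_add_mod_self_right, Nat.mod_eq_of_lt hp]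

theorem le_nodes (hg : g < P.n) (hv : v < P.n) : (g * P.n + v) / P.n ≤ P.nodes := by
  refine (Nat.div_le_self _ _).trans ?_
  have := hP.blockNode_lt hg hv hP.m_pos
  have h₂ := hP.source_lt
  have h₃ := Nat.le_mul_of_pos_right (1 + g * P.n + v) hP.m_pos
  rw [blockNode] at this
  omega

theorem guess_blockNode (hg : g < P.n) (hv : v < P.n) (hp : p < P.m) :
    P.guess (P.blockNode g v p) = g := by
  rw [guess, hP.group_blockNode hg hv hp, show 1 + g * P.n + v - 1 = g * P.n + v by omega,
    boundedDiv_eq (by omega) (hP.le_nodes hg hv), mul_comm, Nat.mul_add_div (by omega),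
    Nat.div_eq_of_lt hv, add_zero]

theorem last_blockNode (hg : g < P.n) (hv : v < P.n) (hp : p < P.m) :
    P.last (P.blockNode g v p) = v := by
  rw [last, hP.group_blockNode hg hv hp, show 1 + g * P.n + v - 1 = g * P.n + v by omega,
    boundedMod_eq (by omega) (hP.le_nodes hg hv), Nat.mul_add_mod_self_right, Nat.mod_eq_of_lt hv]

theorem node_cases {x : ℕ} (hx : x < P.nodes) (hs : x ≠ P.source) :
    x < P.m ∨ ∃ g < P.n, ∃ v < P.n, ∃ p < P.m, x = P.blockNode g v p := by
  by_cases hm : x < P.m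
  · exact .inl hm
  right
  have hx' : x < (1 + P.n * P.n) * P.m := by
    rw [← hP.source_eq]; rw [source] at hs ⊢; omega
  have h₁ : x / P.m < 1 + P.n * P.n := Nat.div_lt_of_lt_mul (by rwa [mul_comm])
  have h₂ : 1 ≤ x / P.m := (Nat.one_le_div_iff hP.m_pos).2 (not_lt.1 hm)
  have hn : 0 < P.n := Nat.pos_of_ne_zero fun h => by rw [h] at h₁; omega
  refine ⟨(x / P.m - 1) / P.n, Nat.div_lt_of_lt_mul (by omega), (x / P.m - 1) % P.n,
    Nat.mod_lt _ hn, x % P.m, Nat.mod_lt _ hP.m_pos, ?_⟩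
  rw [blockNode, add_assoc, Nat.div_add_mod', show 1 + (x / P.m - 1) = x / P.m by omega,
    Nat.div_add_mod']

end Valid

/-! ### The order of the voters -/

theorem Ahead.trans {g v w z : ℕ} (h₁ : P.Ahead g v w) (h₂ : P.Ahead g w z) : P.Ahead g v z := by
  unfold Ahead at *; omega

theorem Ahead.asymm {g v w : ℕ} (h₁ : P.Ahead g v w) : ¬ P.Ahead g w v := by
  unfold Ahead at *; omega

theorem ahead_total {g v w : ℕ} (h : v ≠ w) : P.Ahead g v w ∨ P.Ahead g w v := by
  unfold Ahead at *; omega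

/-! ### Walks bound the satisfaction from below -/

/-- If a voter likes `p` better than the last item `p'`, then no earlier item can beat `p'`, as `p'`
would be a valley. If not, `p` adds nothing. Thus the last item alone determines the gain. -/
theorem sup_insert_of_precedes (hA : P.IsAxis A) {Z : Finset ℕ} (hZ : ∀ q ∈ Z, q < P.m)
    {p' p v : ℕ} (hp' : p' ∈ Z) (hle : ∀ q ∈ Z, q = p' ∨ P.Precedes A q p') (hp : p < P.m)
    (hpp : P.Precedes A p' p) (hv : v < P.n) :
    (insert p Z).sup (P.u v) = Z.sup (P.u v) + (P.u v p - P.u v p') := by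
  rw [Finset.sup_insert]
  have h₁ : P.u v p' ≤ Z.sup (P.u v) := Finset.le_sup hp'
  rcases le_or_gt (P.u v p) (P.u v p') with h | h
  · rw [sup_of_le_right (h.trans h₁)]; omega
  · have h₂ : Z.sup (P.u v) ≤ P.u v p' := Finset.sup_le fun q hq => by
      rcases hle q hq with rfl | hq'
      · exact le_rfl
      · by_contra hlt
        exact (hA q (hZ q hq) p' (hZ p' hp') p hp hq' hpp).2 v hv ⟨not_le.1 hlt, h⟩
    rw [sup_of_le_left (h₂.trans h.le)]
    omega

theorem Edge.axis_cases (hP : P.Valid) {x y : ℕ} (hx : x < P.m) (h : P.Edge A y x) :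
    P.IsAxis A ∧ (y = P.source ∨ (P.group y = 0 ∧ P.Precedes A (P.item y) x)) := by
  obtain ⟨-, ⟨-, h₁, h₂⟩ | ⟨h₁, -⟩⟩ := h
  · rw [hP.item_item hx] at h₂
    exact ⟨h₁, h₂⟩
  · exact absurd (hP.group_item hx) h₁

theorem Edge.block_cases (hP : P.Valid) {g v p y : ℕ} (hg : g < P.n) (hv : v < P.n) (hp : p < P.m)
    (h : P.Edge A y (P.blockNode g v p)) :
    y = P.source ∨ (P.group y ≠ 0 ∧ P.guess y = g ∧ P.Ahead g (P.last y) v) := by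
  obtain ⟨-, ⟨h₁, -, -⟩ | ⟨-, h₂⟩⟩ := h
  · rw [hP.group_blockNode hg hv hp] at h₁; omega
  · rwa [hP.guess_blockNode hg hv hp, hP.last_blockNode hg hv hp] at h₂

theorem gain_item (hP : P.Valid) {x : ℕ} (hx : x < P.m) (y : ℕ) :
    P.gain y x =
      ∑ v ∈ Finset.range P.n, (P.u v x - if y = P.source then 0 else P.u v (P.item y)) := by
  rw [gain, if_pos (hP.group_item hx), hP.item_item hx]

open scoped Classical in
theorem gain_blockNode (hP : P.Valid) {g v p : ℕ} (hg : g < P.n) (hv : v < P.n) (hp : p < P.m)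
    (y : ℕ) :
    P.gain y (P.blockNode g v p) = ∑ z ∈ Finset.range P.n,
      if (y = P.source ∨ P.Ahead g (P.last y) z) ∧ ¬ P.Ahead g v z then P.u z p else 0 := by
  rw [gain, if_neg (by rw [hP.group_blockNode hg hv hp]; omega), hP.item_blockNode hg hv hp,
    hP.guess_blockNode hg hv hp, hP.last_blockNode hg hv hp]

/-- A walk pays again for an item that it has already collected, so its cost is only an upper bound
for the cost of its set. -/
theorem Reach.basic (hP : P.Valid) {k x q t w : ℕ} {Z : Finset ℕ} (h : P.Reach A k x q t Z w) :
    x < P.nodes ∧ (∀ p ∈ Z, p < P.m) ∧ ∑ p ∈ Z, P.c p ≤ t := by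
  induction h with
  | source => exact ⟨hP.source_lt, by simp, by simp⟩
  | @step k y q t Z w x _ hx _ ih =>
    refine ⟨hx, ?_, ?_⟩
    · intro p hp
      rcases Finset.mem_insert.1 hp with rfl | hp
      · exact hP.item_lt hx
      · exact ih.2.1 p hp
    · by_cases hm : P.item x ∈ Z
      · rw [Finset.insert_eq_of_mem hm]; exact ih.2.2.trans (by omega)
      · rw [Finset.sum_insert hm]; have := ih.2.2; omega

-- On item nodes the utility is exact, because the set ends in its last item on a verified axis. On
-- block nodes it is a lower bound for the satisfaction of the voters up to `v`, since a voter may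
-- prefer an item assigned to another block.
open scoped Classical in
theorem Reach.invariant (hP : P.Valid) {k x q t w : ℕ} {Z : Finset ℕ}
    (h : P.Reach A k x q t Z w) :
    (x = P.source ∧ Z = ∅ ∧ w = 0) ∨
    (x < P.m ∧ P.IsAxis A ∧ x ∈ Z ∧ (∀ q ∈ Z, q = x ∨ P.Precedes A q x) ∧ w = P.sat Z) ∨
    (∃ g < P.n, ∃ v < P.n, ∃ p < P.m, x = P.blockNode g v p ∧
      w ≤ ∑ z ∈ Finset.range P.n, if P.Ahead g v z then 0 else Z.sup (P.u z)) := by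
  induction h with
  | source => exact .inl ⟨rfl, rfl, rfl⟩
  | @step k y q t Z w x hr hx he ih =>
    right
    obtain ⟨hy, hZ, -⟩ := hr.basic hP
    rcases hP.node_cases hx he.1 with hxm | ⟨g, hg, v, hv, p, hp, rfl⟩
    · left
      obtain ⟨hA, hc⟩ := he.axis_cases hP hxm
      rw [gain_item hP hxm, hP.item_item hxm]
      refine ⟨hxm, hA, Finset.mem_insert_self _ _, ?_⟩
      rcases ih with ⟨rfl, rfl, rfl⟩ | ⟨hym, -, hyZ, hle, rfl⟩ | ⟨g, hg, v, hv, p, hp, rfl, -⟩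
      · simp [sat]
      · have hys : y ≠ P.source := (hP.lt_source hym).ne
        have hpre := (hc.resolve_left hys).2
        rw [hP.item_item hym] at hpre
        refine ⟨fun q hq => ?_, ?_⟩
        · rcases Finset.mem_insert.1 hq with rfl | hq
          · exact .inl rfl
          · rcases hle q hq with rfl | hq'
            · exact .inr hpre
            · exact .inr (hA q (hZ q hq) y hym x hxm hq' hpre).1
        · rw [sat, sat, ← Finset.sum_add_distrib]
          refine Finset.sum_congr rfl fun v hv => ?_
          rw [sup_insert_of_precedes hA hZ hyZ hle hxm hpre (Finset.mem_range.1 hv), if_neg hys,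
            hP.item_item hym]
      · have hys := (hP.blockNode_lt hg hv hp).ne
        have := (hc.resolve_left hys).1
        rw [hP.group_blockNode hg hv hp] at this
        omega
    · right
      refine ⟨g, hg, v, hv, p, hp, rfl, ?_⟩
      rw [gain_blockNode hP hg hv hp, hP.item_blockNode hg hv hp]
      have hpu : ∀ z, P.u z p ≤ (insert p Z).sup (P.u z) := fun z =>
        Finset.le_sup (f := P.u z) (Finset.mem_insert_self p Z)
      rcases ih with ⟨rfl, rfl, rfl⟩ | ⟨hym, -, -, -, -⟩ | ⟨g', hg', v', hv', p', hp', rfl, hw⟩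
      · rw [zero_add]
        refine Finset.sum_le_sum fun z _ => ?_
        split_ifs with h₁ h₂ <;> simp_all
      · rcases he.block_cases hP hg hv hp with hs | ⟨h, -⟩
        · exact absurd hs (hP.lt_source hym).ne
        · exact absurd (hP.group_item hym) h
      · have hys := (hP.blockNode_lt hg' hv' hp').ne
        obtain ⟨-, hgg, hah⟩ := (he.block_cases hP hg hv hp).resolve_left hys
        rw [hP.guess_blockNode hg' hv' hp'] at hgg
        subst hgg
        rw [hP.last_blockNode hg' hv' hp'] at hah ⊢
        refine (Nat.add_le_add_right hw _).trans ?_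
        rw [← Finset.sum_add_distrib]
        refine Finset.sum_le_sum fun z _ => ?_
        have hmono : Z.sup (P.u z) ≤ (insert p Z).sup (P.u z) :=
          Finset.sup_mono (Finset.subset_insert _ _)
        by_cases h₁ : P.Ahead g' v' z
        · by_cases h₂ : P.Ahead g' v z
          · simp [h₁, h₂]
          · simp [h₁, h₂, hys]
        · have h₂ : ¬ P.Ahead g' v z := fun h => h₁ (hah.trans h)
          simp [h₁, h₂, hys]

theorem Reach.le_sat (hP : P.Valid) {k x q t w : ℕ} {Z : Finset ℕ}
    (h : P.Reach A k x q t Z w) : w ≤ P.sat Z := by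
  classical
  rcases h.invariant hP with ⟨-, -, rfl⟩ | ⟨-, -, -, -, rfl⟩ | ⟨g, -, v, -, p, -, -, hw⟩
  · exact Nat.zero_le _
  · exact le_rfl
  · refine hw.trans (Finset.sum_le_sum fun z _ => ?_)
    split_ifs <;> simp

end Profile

namespace Profile

variable {P : Profile} {A : ℕ → ℕ}

/-! ### Walks for single-peaked profiles -/

theorem HasAxis.exists_last (h : P.HasAxis A) {S : Finset ℕ} (hne : S.Nonempty)
    (hS : ∀ p ∈ S, p < P.m) : ∃ x ∈ S, ∀ q ∈ S, q = x ∨ P.Precedes A q x := by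
  induction hne using Finset.Nonempty.cons_induction with
  | singleton a => exact ⟨a, by simp, by simp⟩
  | cons a S ha hne ih =>
    obtain ⟨x, hx, hmax⟩ := ih fun p hp => hS p (Finset.mem_cons_of_mem hp)
    have ham := hS a (Finset.mem_cons_self a S)
    have hxm := hS x (Finset.mem_cons_of_mem hx)
    rcases h.total a ham x hxm (fun e => ha (e ▸ hx)) with hax | hxa
    · refine ⟨x, Finset.mem_cons_of_mem hx, fun q hq => ?_⟩
      rcases Finset.mem_cons.1 hq with rfl | hq
      · exact .inr hax
      · exact hmax q hq
    · refine ⟨a, Finset.mem_cons_self a S, fun q hq => ?_⟩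
      rcases Finset.mem_cons.1 hq with rfl | hq'
      · exact .inl rfl
      · rcases hmax q hq' with rfl | hqx
        · exact .inr hxa
        · exact .inr (h.isAxis q (hS q hq) x hxm a ham hqx hxa).1

/-- The walk visits the items of `S` in the order of the axis; the induction removes the last one.
-/
theorem HasAxis.exists_walk (hP : P.Valid) (h : P.HasAxis A) {S : Finset ℕ} (hne : S.Nonempty)
    (hS : ∀ p ∈ S, p < P.m) : ∃ x q, P.Reach A S.card x q (∑ p ∈ S, P.c p) S (P.sat S) := by
  suffices H : ∀ S : Finset ℕ, S.Nonempty → (∀ p ∈ S, p < P.m) → ∃ x ∈ S,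
      (∀ q ∈ S, q = x ∨ P.Precedes A q x) ∧
      ∃ q, P.Reach A S.card x q (∑ p ∈ S, P.c p) S (P.sat S) by
    obtain ⟨x, -, -, q, hq⟩ := H S hne hS
    exact ⟨x, q, hq⟩
  intro S
  induction S using Finset.strongInduction with
  | H S ih =>
    intro hne hS
    obtain ⟨x, hx, hmax⟩ := h.exists_last hne hS
    have hxm := hS x hx
    have hxn := (hP.lt_source hxm).trans hP.source_lt
    have hS' : insert x (S.erase x) = S := Finset.insert_erase hx
    have hcard : (S.erase x).card + 1 = S.card := Finset.card_erase_add_one hx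
    have hcost : ∑ p ∈ S.erase x, P.c p + P.c x = ∑ p ∈ S, P.c p := Finset.sum_erase_add _ _ hx
    refine ⟨x, hx, hmax, ?_⟩
    by_cases he : (S.erase x).Nonempty
    · have hE : ∀ p ∈ S.erase x, p < P.m := fun p hp => hS p (Finset.mem_of_mem_erase hp)
      obtain ⟨y, hy, hymax, q, hr⟩ := ih _ (Finset.erase_ssubset hx) he hE
      have hym := hE y hy
      have hys := (hP.lt_source hym).ne
      have hyx : P.Precedes A y x :=
        (hmax y (Finset.mem_of_mem_erase hy)).resolve_left (Finset.ne_of_mem_erase hy)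
      have hedge : P.Edge A y x := ⟨(hP.lt_source hxm).ne, .inl ⟨hP.group_item hxm, h.isAxis,
        .inr ⟨hP.group_item hym, by rwa [hP.item_item hym, hP.item_item hxm]⟩⟩⟩
      have := hr.step hxn hedge
      rw [hP.item_item hxm, hS', hcard, hcost] at this
      have hw : P.sat (S.erase x) + P.gain y x = P.sat S := by
        rw [gain_item hP hxm, sat, sat, ← Finset.sum_add_distrib]
        refine Finset.sum_congr rfl fun v hv => ?_
        rw [if_neg hys, hP.item_item hym, ← sup_insert_of_precedes h.isAxis hE hy hymax hxm hyx
          (Finset.mem_range.1 hv), hS']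
      rw [hw] at this
      exact ⟨_, this⟩
    · rw [Finset.not_nonempty_iff_eq_empty] at he
      have hedge : P.Edge A P.source x := ⟨(hP.lt_source hxm).ne, .inl ⟨hP.group_item hxm,
        h.isAxis, .inl rfl⟩⟩
      have := (Reach.source (P := P) (A := A)).step hxn hedge
      rw [he] at hS' hcard hcost
      rw [Finset.card_empty] at hcard
      rw [Finset.sum_empty] at hcost
      rw [hP.item_item hxm, hS', hcard, hcost, zero_add] at this
      have hw : P.gain P.source x = P.sat S := by
        rw [gain_item hP hxm, sat, ← hS']
        simp
      rw [zero_add, hw] at this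
      exact ⟨_, this⟩

/-! ### Walks for single-crossing profiles -/

variable (P) in
/-- Whatever weak comparison holds for the voter `g` holds for an initial segment of the voters,
ordered by `pos`. -/
def CrossesFrom (g : ℕ) (pos : ℕ → ℕ) : Prop :=
  ∀ p < P.m, ∀ p' < P.m, P.u g p ≤ P.u g p' → ∀ v < P.n, ∀ w < P.n, pos v ≤ pos w →
    P.u w p ≤ P.u w p' → P.u v p ≤ P.u v p'

/-- If `w` shares a comparison with `g` that `v` lacks, then `w` does not come after `v` in `pos`.
Hence `w` shares every comparison that `v` shares with `g`, and one more, so its agreement is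
strictly larger and `v` cannot be ahead. -/
theorem CrossesFrom.of_ahead {g : ℕ} {pos : ℕ → ℕ} (h : P.CrossesFrom g pos) {v w p p' : ℕ}
    (hv : v < P.n) (hw : w < P.n) (hp : p < P.m) (hp' : p' < P.m) (ha : P.Ahead g v w)
    (hg : P.u g p ≤ P.u g p') (hwp : P.u w p ≤ P.u w p') : P.u v p ≤ P.u v p' := by
  by_contra hlt
  have hpos : pos w ≤ pos v := by
    by_contra hpos
    exact hlt (h p hp p' hp' hg v hv w hw (by omega) hwp)
  suffices P.agreement g v < P.agreement g w by unfold Ahead at ha; omega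
  unfold agreement
  have hle : ∀ a ∈ Finset.range P.m, ∀ a' ∈ Finset.range P.m,
      (if P.u g a ≤ P.u g a' ∧ P.u v a ≤ P.u v a' then 1 else 0) ≤
        if P.u g a ≤ P.u g a' ∧ P.u w a ≤ P.u w a' then 1 else 0 := fun a ha a' ha' => by
    split_ifs with h₁ h₂ <;> simp
    exact h₂ ⟨h₁.1,
      h a (Finset.mem_range.1 ha) a' (Finset.mem_range.1 ha') h₁.1 w hw v hv hpos h₁.2⟩
  refine Finset.sum_lt_sum (fun a ha => Finset.sum_le_sum (hle a ha))
    ⟨p, Finset.mem_range.2 hp, Finset.sum_lt_sum (hle p (Finset.mem_range.2 hp))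
      ⟨p', Finset.mem_range.2 hp', ?_⟩⟩
  rw [if_neg (fun h => hlt h.2), if_pos ⟨hg, hwp⟩]
  exact one_pos

/-- Every voter can be assigned a best item of `S` so that the assigned items appear in the same
order as the voters. -/
theorem CrossesFrom.exists_assignment {g : ℕ} {pos : ℕ → ℕ} (h : P.CrossesFrom g pos)
    {S : Finset ℕ} (hne : S.Nonempty) (hS : ∀ p ∈ S, p < P.m) :
    ∃ (ch : ℕ → ℕ) (r : ℕ → ℕᵒᵈ ×ₗ ℕ), Function.Injective r ∧ (∀ v, ch v ∈ S) ∧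
      (∀ v, S.sup (P.u v) = P.u v (ch v)) ∧
      ∀ v < P.n, ∀ w < P.n, P.Ahead g v w → r (ch v) ≤ r (ch w) := by
  -- Items are ranked by the taste of `g`, the favourite first, with ties broken by their numbers.
  -- Each voter takes, among its best items in `S`, the one of least rank; this choice is monotone.
  let r : ℕ → ℕᵒᵈ ×ₗ ℕ := fun p => toLex (OrderDual.toDual (P.u g p), p)
  have hex : ∀ v, ∃ x ∈ S, ∀ p ∈ S, P.u v p < P.u v x ∨ (P.u v p = P.u v x ∧ r x ≤ r p) := by
    intro v
    obtain ⟨x, hx, hmax⟩ := S.exists_max_image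
      (fun p => (toLex (P.u v p, OrderDual.toDual (r p)) : ℕ ×ₗ (ℕᵒᵈ ×ₗ ℕ)ᵒᵈ)) hne
    refine ⟨x, hx, fun p hp => ?_⟩
    have := hmax p hp
    rw [Prod.Lex.toLex_le_toLex] at this
    simpa using this
  choose ch hch hmax using hex
  refine ⟨ch, r, fun p q hpq => ?_, hch, fun v => ?_, fun v hv w hw ha => ?_⟩
  · have := congrArg (fun z => (ofLex z).2) hpq
    simpa [r] using this
  · refine le_antisymm (Finset.sup_le fun p hp => ?_) (Finset.le_sup (hch v))
    rcases hmax v p hp with h | h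
    · exact h.le
    · exact h.1.le
  · by_contra hlt
    rw [not_le] at hlt
    have hg : P.u g (ch v) ≤ P.u g (ch w) := by
      have := hlt.le
      simp only [r, Prod.Lex.toLex_le_toLex, OrderDual.toDual_lt_toDual,
        OrderDual.toDual_inj] at this
      omega
    have hw' : P.u w (ch v) ≤ P.u w (ch w) := by
      rcases hmax w (ch v) (hch v) with h | h
      · exact h.le
      · exact h.1.le
    have hv' := h.of_ahead hv hw (hS _ (hch v)) (hS _ (hch w)) ha hg hw'
    rcases hmax v (ch w) (hch w) with h | h
    · omega
    · exact absurd h.2 (not_le.2 hlt)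

open scoped Classical in
theorem exists_last_ahead (g : ℕ) {V : Finset ℕ} (hne : V.Nonempty) :
    ∃ x ∈ V, ∀ z ∈ V, ¬ P.Ahead g x z := by
  obtain ⟨x, hx, hmax⟩ := V.exists_max_image
    (fun v => (toLex (OrderDual.toDual (P.agreement g v), v) : ℕᵒᵈ ×ₗ ℕ)) hne
  refine ⟨x, hx, fun z hz => ?_⟩
  have := hmax z hz
  simp only [Prod.Lex.toLex_le_toLex, OrderDual.toDual_lt_toDual, OrderDual.toDual_inj] at this
  unfold Ahead
  omega

variable (P) in
open scoped Classical in
/-- The voters up to `v` in the order by agreement with `g`. -/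
noncomputable def upTo (g v : ℕ) : Finset ℕ := (Finset.range P.n).filter fun z => ¬ P.Ahead g v z

theorem mem_upTo {g v z : ℕ} : z ∈ P.upTo g v ↔ z < P.n ∧ ¬ P.Ahead g v z := by
  simp [upTo]

/-- Since `r ∘ ch` is monotone and `r` is injective, the voters up to `v` that share the item of `v`
form a final segment. It is the last block of the walk, and induction covers the voters before it.
Distinct blocks have distinct items, so no item is paid for twice. -/
theorem exists_block_walk (hP : P.Valid) {g : ℕ} (hg : g < P.n) {β : Type*} [LinearOrder β]
    {r : ℕ → β} (hr : Function.Injective r) {ch : ℕ → ℕ} (hch : ∀ v, ch v < P.m)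
    (hmono : ∀ v < P.n, ∀ w < P.n, P.Ahead g v w → r (ch v) ≤ r (ch w)) {v : ℕ} (hv : v < P.n) :
    ∃ q, P.Reach A ((P.upTo g v).image ch).card (P.blockNode g v (ch v)) q
      (∑ p ∈ (P.upTo g v).image ch, P.c p) ((P.upTo g v).image ch)
      (∑ z ∈ P.upTo g v, P.u z (ch z)) := by
  classical
  induction hN : (P.upTo g v).card using Nat.strong_induction_on generalizing v with
  | _ N ih =>
  subst hN
  have hirr : ∀ z, ¬ P.Ahead g z z := fun z h => h.asymm h
  have hvv : v ∈ P.upTo g v := mem_upTo.2 ⟨hv, hirr v⟩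
  have hlt := hP.blockNode_lt hg hv (hch v)
  have hlt' := hlt.trans hP.source_lt
  set V := (P.upTo g v).filter fun z => ch z ≠ ch v with hV
  by_cases hne : V.Nonempty
  · obtain ⟨y, hy, hmax⟩ := exists_last_ahead (P := P) g hne
    rw [hV, Finset.mem_filter] at hy
    have hyn := (mem_upTo.1 hy.1).1
    have hyv : P.Ahead g y v :=
      (ahead_total (fun e => hy.2 (by rw [e]))).resolve_right (mem_upTo.1 hy.1).2
    -- The voters served by other items are an initial segment, which ends in its last member `y`.
    have hUV : P.upTo g y = V := by
      ext z
      rw [mem_upTo, hV, Finset.mem_filter, mem_upTo]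
      constructor
      · rintro ⟨hz, hyz⟩
        have hvz : ¬ P.Ahead g v z := fun h => hyz (hyv.trans h)
        refine ⟨⟨hz, hvz⟩, fun e => hy.2 (hr (le_antisymm (hmono y hyn v hv hyv) ?_))⟩
        rw [← e]
        by_cases hzy : z = y
        · rw [hzy]
        · exact hmono z hz y hyn ((ahead_total hzy).resolve_right hyz)
      · rintro ⟨⟨hz, hvz⟩, hne⟩
        exact ⟨hz, hmax z (by rw [hV, Finset.mem_filter, mem_upTo]; exact ⟨⟨hz, hvz⟩, hne⟩)⟩
    have hsub : V ⊆ P.upTo g v := Finset.filter_subset _ _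
    have hvV : v ∉ V := fun h => (Finset.mem_filter.1 h).2 rfl
    have hcard : (P.upTo g y).card < (P.upTo g v).card := by
      rw [hUV]
      exact Finset.card_lt_card ⟨hsub, fun h => hvV (h hvv)⟩
    obtain ⟨q, hq⟩ := ih _ hcard hyn rfl
    have hedge : P.Edge A (P.blockNode g y (ch y)) (P.blockNode g v (ch v)) := by
      refine ⟨hlt.ne, .inr ⟨by rw [hP.group_blockNode hg hv (hch v)]; omega, .inr ⟨by
        rw [hP.group_blockNode hg hyn (hch y)]; omega, ?_⟩⟩⟩
      rw [hP.guess_blockNode hg hv (hch v), hP.guess_blockNode hg hyn (hch y),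
        hP.last_blockNode hg hv (hch v), hP.last_blockNode hg hyn (hch y)]
      exact ⟨rfl, hyv⟩
    have := hq.step hlt' hedge
    rw [hP.item_blockNode hg hv (hch v), hUV] at this
    have himg : insert (ch v) (V.image ch) = (P.upTo g v).image ch := by
      ext p
      simp only [Finset.mem_insert, Finset.mem_image]
      constructor
      · rintro (rfl | ⟨z, hz, rfl⟩)
        · exact ⟨v, hvv, rfl⟩
        · exact ⟨z, hsub hz, rfl⟩
      · rintro ⟨z, hz, rfl⟩
        by_cases h : ch z = ch v
        · exact .inl h
        · exact .inr ⟨z, Finset.mem_filter.2 ⟨hz, h⟩, rfl⟩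
    have hnot : ch v ∉ V.image ch := fun h => by
      obtain ⟨z, hz, e⟩ := Finset.mem_image.1 h
      exact (Finset.mem_filter.1 hz).2 e
    have hc := Finset.sum_insert (f := P.c) hnot
    have hk := Finset.card_insert_of_notMem hnot
    rw [himg] at hc hk this
    rw [← hk, add_comm (∑ p ∈ V.image ch, P.c p), ← hc] at this
    have hw : ∑ z ∈ V, P.u z (ch z) + P.gain (P.blockNode g y (ch y)) (P.blockNode g v (ch v)) =
        ∑ z ∈ P.upTo g v, P.u z (ch z) := by
      rw [gain_blockNode hP hg hv (hch v), ← Finset.sum_filter_add_sum_filter_not (P.upTo g v)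
        (fun z => ch z ≠ ch v), ← hV]
      congr 1
      rw [← Finset.sum_filter]
      have hset : ∀ z, z ∈ (Finset.range P.n).filter (fun z =>
          (P.blockNode g y (ch y) = P.source ∨ P.Ahead g (P.last (P.blockNode g y (ch y))) z) ∧
            ¬ P.Ahead g v z) ↔ z ∈ (P.upTo g v).filter (fun z => ¬ ch z ≠ ch v) := fun z => by
        have hzV : z ∈ V ↔ z < P.n ∧ ¬ P.Ahead g y z := by rw [← hUV, mem_upTo]
        have hzV' : z ∈ V ↔ (z < P.n ∧ ¬ P.Ahead g v z) ∧ ch z ≠ ch v := by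
          rw [hV, Finset.mem_filter, mem_upTo]
        have hns := (hP.blockNode_lt hg hyn (hch y)).ne
        rw [Finset.mem_filter, Finset.mem_filter, mem_upTo, hP.last_blockNode hg hyn (hch y),
          Finset.mem_range]
        tauto
      rw [Finset.ext hset]
      refine Finset.sum_congr rfl fun z hz => ?_
      rw [not_not.1 (Finset.mem_filter.1 hz).2]
    rw [hw] at this
    exact ⟨_, this⟩
  · have hall : ∀ z ∈ P.upTo g v, ch z = ch v := fun z hz => by
      by_contra h
      exact hne ⟨z, Finset.mem_filter.2 ⟨hz, h⟩⟩
    have himg : (P.upTo g v).image ch = {ch v} := by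
      ext p
      simp only [Finset.mem_image, Finset.mem_singleton]
      exact ⟨fun ⟨z, hz, e⟩ => e ▸ hall z hz, fun e => ⟨v, hvv, e.symm⟩⟩
    have hedge : P.Edge A P.source (P.blockNode g v (ch v)) :=
      ⟨hlt.ne, .inr ⟨by rw [hP.group_blockNode hg hv (hch v)]; omega, .inl rfl⟩⟩
    have := (Reach.source (P := P) (A := A)).step hlt' hedge
    have hw : P.gain P.source (P.blockNode g v (ch v)) = ∑ z ∈ P.upTo g v, P.u z (ch z) := by
      rw [gain_blockNode hP hg hv (hch v), upTo, Finset.sum_filter]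
      refine Finset.sum_congr rfl fun z hz => ?_
      by_cases h : P.Ahead g v z
      · simp [h]
      · simp [h, hall z (mem_upTo.2 ⟨Finset.mem_range.1 hz, h⟩)]
    rw [hP.item_blockNode hg hv (hch v), hw] at this
    rw [himg]
    simp only [zero_add, insert_empty_eq] at this
    simp only [Finset.card_singleton, Finset.sum_singleton]
    exact ⟨_, this⟩

theorem CrossesFrom.exists_walk (hP : P.Valid) {g : ℕ} (hg : g < P.n) {pos : ℕ → ℕ}
    (h : P.CrossesFrom g pos) {S : Finset ℕ} (hne : S.Nonempty) (hS : ∀ p ∈ S, p < P.m) :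
    ∃ k ≤ S.card, ∃ x q t Z, t ≤ ∑ p ∈ S, P.c p ∧ P.Reach A k x q t Z (P.sat S) := by
  classical
  obtain ⟨ch, r, hr, hch, hsup, hmono⟩ := h.exists_assignment hne hS
  -- For the last of all voters, the walk accounts for everybody.
  obtain ⟨v, hv, hlast⟩ := exists_last_ahead (P := P) g (V := Finset.range P.n)
    ⟨g, Finset.mem_range.2 hg⟩
  obtain ⟨q, hq⟩ := exists_block_walk (A := A) hP hg hr (fun v => hS _ (hch v)) hmono
    (Finset.mem_range.1 hv)
  have hU : P.upTo g v = Finset.range P.n := Finset.filter_true_of_mem hlast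
  have hsub : (P.upTo g v).image ch ⊆ S := Finset.image_subset_iff.2 fun z _ => hch z
  have hw : ∑ z ∈ P.upTo g v, P.u z (ch z) = P.sat S := by
    rw [hU, sat]
    exact Finset.sum_congr rfl fun z _ => (hsup z).symm
  rw [hw] at hq
  exact ⟨_, Finset.card_le_card hsub, _, q, _, _, Finset.sum_le_sum_of_subset hsub, hq⟩

end Profile

/-! ### Rounded utilities and the dynamic program -/

theorem boundedDiv_mul_le (N M i : ℕ) : boundedDiv N M i * M ≤ i := by
  rcases Nat.eq_zero_or_pos M with rfl | hM
  · simp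
  · rw [← Nat.le_div_iff_mul_le hM, boundedDiv, ← Finset.card_filter]
    refine (Finset.card_le_card fun t ht => ?_).trans (Finset.card_range (i / M)).le
    rw [Finset.mem_filter, ← Nat.le_div_iff_mul_le hM] at ht
    exact Finset.mem_range.2 ht.2

theorem le_boundedDiv_succ_mul {N M i : ℕ} (h : i ≤ N * M) : i ≤ (boundedDiv N M i + 1) * M := by
  rcases Nat.eq_zero_or_pos M with rfl | hM
  · simpa using h
  · rw [boundedDiv_eq hM (Nat.div_le_of_le_mul (by rwa [mul_comm]))]
    have := Nat.lt_mul_div_succ i hM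
    rw [mul_comm]
    exact this.le

theorem boundedDiv_le (N M i : ℕ) : boundedDiv N M i ≤ N := by
  rw [boundedDiv, ← Finset.card_filter]
  exact (Finset.card_filter_le _ _).trans (Finset.card_range N).le

namespace Profile

variable (P : Profile)

/-- The largest total utility of an affordable item. -/
def peak : ℕ :=
  ((Finset.range P.m).filter fun p => P.c p ≤ P.b).sup fun p => ∑ v ∈ Finset.range P.n, P.u v p

variable {P} {A W D R L T : ℕ → ℕ}

/-- A multiple of a maximum is at most `w * P.grid` exactly if this holds for the multiple of each
term. So `scaled` is the quotient by `peak`, cut off at `grid`; for `peak = 0` it equals `grid`. -/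
theorem scaled_eq (w : ℕ) : P.scaled w = boundedDiv P.grid P.peak (w * P.grid) := by
  classical
  unfold scaled boundedDiv
  refine Finset.sum_congr rfl fun t ht => ?_
  rw [Finset.mem_range] at ht
  have : (∀ p < P.m, P.c p ≤ P.b →
      boundedMul P.grid (t + 1) (∑ v ∈ Finset.range P.n, P.u v p) ≤ w * P.grid) ↔
      (t + 1) * P.peak ≤ w * P.grid := by
    rw [peak, mul_comm (t + 1), ← Nat.le_div_iff_mul_le (by omega), Finset.sup_le_iff]
    simp only [Finset.mem_filter, Finset.mem_range, and_imp]
    refine forall_congr' fun p => forall_congr' fun _ => forall_congr' fun _ => ?_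
    rw [Nat.le_div_iff_mul_le (by omega), boundedMul_eq (by omega), mul_comm]
  simp only [this]

theorem gain_le (x y : ℕ) : P.gain y x ≤ ∑ v ∈ Finset.range P.n, P.u v (P.item x) := by
  rw [gain]
  by_cases h : P.group x = 0
  · rw [if_pos h]
    exact Finset.sum_le_sum fun v _ => Nat.sub_le _ _
  · rw [if_neg h]
    exact Finset.sum_le_sum fun v _ => by split_ifs <;> simp

theorem le_peak {p : ℕ} (hp : p < P.m) (hc : P.c p ≤ P.b) :
    ∑ v ∈ Finset.range P.n, P.u v p ≤ P.peak :=
  Finset.le_sup (f := fun p => ∑ v ∈ Finset.range P.n, P.u v p)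
    (Finset.mem_filter.2 ⟨Finset.mem_range.2 hp, hc⟩)

/-- Rounding never overstates a gain. -/
theorem Reach.scaled_mul_le {k x q t w : ℕ} {Z : Finset ℕ} (h : P.Reach A k x q t Z w) :
    q * P.peak ≤ w * P.grid := by
  induction h with
  | source => simp
  | @step k y q t Z w x _ _ _ ih =>
    rw [add_mul, add_mul, scaled_eq]
    exact add_le_add ih (boundedDiv_mul_le _ _ _)

/-- The cutoff at `grid` keeps the rounded utility inside the table, whose number of levels is `grid
* m + 1`. -/
theorem Reach.scaled_le {k x q t w : ℕ} {Z : Finset ℕ} (h : P.Reach A k x q t Z w) :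
    q ≤ k * P.grid := by
  induction h with
  | source => simp
  | @step k y q t Z w x _ _ _ ih =>
    rw [Nat.succ_mul, scaled_eq]
    exact add_le_add ih (boundedDiv_le _ _ _)

/-- Each step loses at most one unit. The budget enters because the gain from an affordable item is
at most `peak`, so the cutoff at `grid` does no harm there. -/
theorem Reach.mul_grid_le (hP : P.Valid) {k x q t w : ℕ} {Z : Finset ℕ}
    (h : P.Reach A k x q t Z w) (ht : t ≤ P.b) : w * P.grid ≤ (q + k) * P.peak := by
  induction h with
  | source => simp
  | @step k y q t Z w x _ hx _ ih =>
    have h₁ := ih (by omega)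
    have h₂ : P.gain y x ≤ P.peak := (gain_le x y).trans (le_peak (hP.item_lt hx) (by omega))
    have h₃ := le_boundedDiv_succ_mul (N := P.grid) (M := P.peak) (i := P.gain y x * P.grid)
      (by rw [mul_comm]; exact Nat.mul_le_mul_left _ h₂)
    rw [← scaled_eq] at h₃
    calc (w + P.gain y x) * P.grid = w * P.grid + P.gain y x * P.grid := add_mul _ _ _
      _ ≤ (q + k) * P.peak + (P.scaled (P.gain y x) + 1) * P.peak := add_le_add h₁ h₃
      _ = _ := by ring

/-! ### The tables -/

variable (P) in
/-- The number of the state `(k, x, q)`. -/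
def state (k x q : ℕ) : ℕ := (k * P.nodes + x) * P.levels + q

variable (P) in
structure IsTables (A W D R L T : ℕ → ℕ) : Prop where
  edge : ∀ x y, x < P.nodes → y < P.nodes → W (x * P.nodes + y) = P.edgeEntry A x y
  cost : ∀ k x q, k ≤ P.m → x < P.nodes → q < P.levels →
    D (P.state k x q) = P.costEntry W D k x q
  previous : ∀ k x q, k ≤ P.m → x < P.nodes → q < P.levels →
    R (P.state k x q) = P.previousEntry W D k x q
  label : ∀ k x q, k ≤ P.m → x < P.nodes → q < P.levels →
    L (P.state k x q) = P.labelEntry k x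
  trace : ∀ t ≤ P.m, T t = P.traceEntry D R T t

section Tables

variable (hP : P.Valid) (h : P.IsTables A W D R L T)
include hP

theorem previous_spec (k x q : ℕ) : P.previous W D k x q < P.nodes ∧
    ∀ z < P.nodes, P.candidate W D k x q (P.previous W D k x q) ≤ P.candidate W D k x q z := by
  refine pick_spec ?_
  obtain ⟨y, hy, hmin⟩ := (Finset.range P.nodes).exists_min_image
    (fun y => P.candidate W D k x q y) ⟨P.source, Finset.mem_range.2 hP.source_lt⟩
  exact ⟨y, Finset.mem_range.1 hy, fun z hz => hmin z (Finset.mem_range.2 hz)⟩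

theorem levels_pos : 0 < P.levels := by rw [hP.levels_eq]; omega

include h

/-- Pointers from level `0` stay at level `0`, so a trace that runs on beyond the source collects
nothing. -/
theorem label_iterate_zero (t : ℕ) : ∀ {x q : ℕ}, x < P.nodes → q < P.levels →
    L (R^[t] (P.state 0 x q)) = 0 := by
  induction t with
  | zero =>
    intro x q hx hq
    rw [Function.iterate_zero_apply, h.label 0 x q (by omega) hx hq, labelEntry, if_pos rfl]
  | succ t ih =>
    intro x q hx hq
    rw [Function.iterate_succ_apply, h.previous 0 x q (by omega) hx hq]
    exact ih (previous_spec hP 0 x q).1 (by omega)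

/-- An entry within the budget is not the default `b + 1`, so the minimizing predecessor comes with
a real edge and again has an entry within the budget. The pointers in `R` retrace the walk, and the
labels in `L` spell out its items. -/
theorem cost_sound (k : ℕ) : ∀ {x q : ℕ}, k ≤ P.m → x < P.nodes → q < P.levels →
    D (P.state k x q) ≤ P.b → ∃ Z w, P.Reach A k x q (D (P.state k x q)) Z w ∧
      (∀ p, p ∈ Z ↔ ∃ t < k, L (R^[t] (P.state k x q)) = p + 1) ∧
      ∀ t ≥ k, L (R^[t] (P.state k x q)) = 0 := by
  classical
  induction k with
  | zero =>
    intro x q hk hx hq hD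
    have hc := h.cost 0 x q hk hx hq
    rw [costEntry, if_pos rfl] at hc
    split_ifs at hc with hs
    · obtain ⟨rfl, rfl⟩ := hs
      rw [hc]
      exact ⟨∅, 0, .source, by simp, fun t _ => label_iterate_zero hP h t hx hq⟩
    · omega
  | succ k ih =>
    intro x q hk hx hq hD
    have hc := h.cost (k + 1) x q hk hx hq
    rw [costEntry, if_neg (by omega)] at hc
    set y := P.previous W D (k + 1) x q with hy
    have hyn : y < P.nodes := (previous_spec hP (k + 1) x q).1
    rw [candidate] at hc
    split_ifs at hc with hs
    swap
    · omega
    have he := h.edge y x hyn hx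
    rw [edgeEntry] at he
    split_ifs at he with hedge
    swap
    · exact absurd he hs.1
    rw [Nat.add_sub_cancel] at hc
    rw [he, Nat.add_sub_cancel] at hc hs
    set q' := q - P.scaled (P.gain y x) with hq'
    have hqq : q' + P.scaled (P.gain y x) = q := by omega
    obtain ⟨Z, w, hr, hZ, hL⟩ := ih (x := y) (q := q') (by omega) hyn (by omega)
      (by rw [state]; omega)
    have hstep := hr.step hx hedge
    rw [hqq, state, ← hc] at hstep
    have hR : R (P.state (k + 1) x q) = P.state k y q' := by
      rw [h.previous (k + 1) x q hk hx hq, previousEntry, ← hy, he, Nat.add_sub_cancel,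
        Nat.add_sub_cancel, state]
    have hlab : L (P.state (k + 1) x q) = P.item x + 1 := by
      rw [h.label (k + 1) x q hk hx hq, labelEntry, if_neg (by omega)]
    refine ⟨_, _, hstep, fun p => ?_, fun t ht => ?_⟩
    · rw [Finset.mem_insert, hZ]
      constructor
      · rintro (rfl | ⟨t, ht, e⟩)
        · exact ⟨0, by omega, hlab⟩
        · exact ⟨t + 1, by omega, by rw [Function.iterate_succ_apply, hR, e]⟩
      · rintro ⟨t, ht, e⟩
        cases t with
        | zero =>
          rw [Function.iterate_zero_apply, hlab] at e
          exact .inl (by omega)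
        | succ t =>
          rw [Function.iterate_succ_apply, hR] at e
          exact .inr ⟨t, by omega, e⟩
    · obtain ⟨t, rfl⟩ : ∃ t', t = t' + 1 := ⟨t - 1, by omega⟩
      rw [Function.iterate_succ_apply, hR]
      exact hL t (by omega)

/-- The minimum over predecessors is at most the candidate that the walk itself uses. -/
theorem cost_complete {k x q t w : ℕ} {Z : Finset ℕ} (hr : P.Reach A k x q t Z w)
    (hk : k ≤ P.m) (ht : t ≤ P.b) : q < P.levels ∧ D (P.state k x q) ≤ t := by
  classical
  have hlev : ∀ {k q}, k ≤ P.m → q ≤ k * P.grid → q < P.levels := fun {k q} hk hq => by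
    have := Nat.mul_le_mul_right P.grid hk
    rw [hP.levels_eq, mul_comm P.grid]
    omega
  induction hr with
  | source =>
    have hq := levels_pos hP
    refine ⟨hq, ?_⟩
    rw [h.cost 0 _ 0 (by omega) hP.source_lt hq, costEntry, if_pos rfl, if_pos ⟨rfl, rfl⟩]
  | @step k y q t Z w x hr hx hedge ih =>
    obtain ⟨-, hD⟩ := ih (by omega) (by omega)
    have hq := hlev hk (hr.step hx hedge).scaled_le
    have hyn := (hr.basic hP).1
    refine ⟨hq, ?_⟩
    rw [h.cost (k + 1) x _ hk hx hq, costEntry, if_neg (by omega)]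
    refine ((previous_spec hP _ _ _).2 y hyn).trans ?_
    have he : W (y * P.nodes + x) = P.scaled (P.gain y x) + 1 := by
      rw [h.edge y x hyn hx, edgeEntry, if_pos hedge]
    rw [candidate, he, Nat.add_sub_cancel, if_pos ⟨by omega, by omega⟩, Nat.add_sub_cancel,
      Nat.add_sub_cancel]
    exact Nat.add_le_add_right hD _

omit h in
theorem state_lt {k x q : ℕ} (hk : k ≤ P.m) (hx : x < P.nodes) (hq : q < P.levels) :
    P.state k x q < P.states := by
  rw [hP.states_eq, state]
  have h₁ : k * P.nodes + x + 1 ≤ (P.m + 1) * P.nodes := by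
    have := Nat.mul_le_mul_right P.nodes (Nat.add_le_add_right hk 1)
    rw [Nat.succ_mul] at this
    omega
  have := Nat.mul_le_mul_right P.levels h₁
  rw [Nat.succ_mul] at this
  omega

omit h in
theorem exists_state {i : ℕ} (hi : i < P.states) :
    ∃ k x q, k ≤ P.m ∧ x < P.nodes ∧ q < P.levels ∧ i = P.state k x q := by
  rw [hP.states_eq] at hi
  have hn : 0 < P.nodes := by have := hP.source_lt; omega
  refine ⟨i / P.levels / P.nodes, i / P.levels % P.nodes, i % P.levels, ?_, Nat.mod_lt _ hn,
    Nat.mod_lt _ (levels_pos hP), ?_⟩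
  · refine Nat.lt_succ_iff.1 (Nat.div_lt_of_lt_mul (Nat.div_lt_of_lt_mul ?_))
    rwa [mul_comm, mul_comm P.nodes]
  · rw [state, Nat.div_add_mod', Nat.div_add_mod']

omit h in
theorem level_state {k x q : ℕ} (hk : k ≤ P.m) (hx : x < P.nodes) (hq : q < P.levels) :
    boundedMod P.states P.levels (P.state k x q) = q := by
  rw [boundedMod_eq (levels_pos hP) ((Nat.div_le_self _ _).trans (state_lt hP hk hx hq).le), state,
    Nat.mul_add_mod_self_right, Nat.mod_eq_of_lt hq]

theorem bestState_spec : P.bestState D < P.states ∧ D (P.bestState D) ≤ P.b ∧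
    ∀ j < P.states, D j ≤ P.b →
      boundedMod P.states P.levels j ≤ boundedMod P.states P.levels (P.bestState D) := by
  classical
  refine pick_spec ?_
  have h₀ := cost_complete hP h Reach.source (by omega) (Nat.zero_le _)
  obtain ⟨i, hi, hmax⟩ := ((Finset.range P.states).filter fun i => D i ≤ P.b).exists_max_image
    (fun i => boundedMod P.states P.levels i)
    ⟨P.state 0 P.source 0, Finset.mem_filter.2 ⟨Finset.mem_range.2
      (state_lt hP (by omega) hP.source_lt h₀.1), h₀.2.trans (Nat.zero_le _)⟩⟩
  rw [Finset.mem_filter, Finset.mem_range] at hi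
  exact ⟨i, hi.1, hi.2, fun j hj hD => hmax j (Finset.mem_filter.2 ⟨Finset.mem_range.2 hj, hD⟩)⟩

omit hP in
theorem trace_eq (t : ℕ) (ht : t ≤ P.m) : T t = R^[t] (P.bestState D) := by
  induction t with
  | zero => rw [h.trace 0 ht, traceEntry, if_pos rfl, Function.iterate_zero_apply]
  | succ t ih =>
    rw [h.trace _ ht, traceEntry, if_neg (by omega), Nat.add_sub_cancel, ih (by omega),
      Function.iterate_succ_apply']

/-- The chosen items form an affordable set whose satisfaction is nearly that of every walk. -/
theorem chosen_spec : ∃ Z : Finset ℕ, (∀ p ∈ Z, p < P.m) ∧ ∑ p ∈ Z, P.c p ≤ P.b ∧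
    (∀ p, P.chosenEntry L T p = 1 ↔ p ∈ Z) ∧ (∀ p, p ∉ Z → P.chosenEntry L T p = 0) ∧
    ∀ {k x q t w : ℕ} {Z' : Finset ℕ}, P.Reach A k x q t Z' w → k ≤ P.m → t ≤ P.b →
      w * P.grid ≤ P.sat Z * P.grid + P.m * P.peak := by
  classical
  obtain ⟨hlt, hD, hmax⟩ := bestState_spec hP h
  obtain ⟨k, x, q, hk, hx, hq, hi⟩ := exists_state hP hlt
  rw [hi] at hD
  obtain ⟨Z, w, hr, hZ, hL⟩ := cost_sound hP h k hk hx hq hD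
  obtain ⟨-, hZm, hZc⟩ := hr.basic hP
  have hch : ∀ p, (∃ t < P.length, L (T t) = p + 1) ↔ p ∈ Z := fun p => by
    rw [hZ, hP.length_eq]
    constructor
    · rintro ⟨t, ht, e⟩
      rw [trace_eq h t (by omega), hi] at e
      refine ⟨t, ?_, e⟩
      by_contra hkt
      rw [hL t (by omega)] at e
      omega
    · rintro ⟨t, ht, e⟩
      exact ⟨t, by omega, by rw [trace_eq h t (by omega), hi, e]⟩
  refine ⟨Z, hZm, hZc.trans hD, fun p => ?_, fun p hp => ?_, ?_⟩
  · rw [← hch, chosenEntry]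
    split_ifs with h <;> simp [h]
  · rw [chosenEntry, if_neg (mt (hch p).1 hp)]
  · intro k' x' q' t' w' Z' hr' hk' ht'
    obtain ⟨hq', hD'⟩ := cost_complete hP h hr' hk' ht'
    have hx' := (hr'.basic hP).1
    have hqq := hmax _ (state_lt hP hk' hx' hq') (hD'.trans ht')
    rw [level_state hP hk' hx' hq', hi, level_state hP hk hx hq] at hqq
    -- The competing walk loses at most `k' ≤ m` units, the best state has the largest level, and
    -- its own rounded utility is not overstated.
    calc w' * P.grid ≤ (q' + k') * P.peak := hr'.mul_grid_le hP ht'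
      _ ≤ (q + P.m) * P.peak := Nat.mul_le_mul_right _ (by omega)
      _ = q * P.peak + P.m * P.peak := add_mul _ _ _
      _ ≤ w * P.grid + P.m * P.peak := Nat.add_le_add_right hr.scaled_mul_le _
      _ ≤ P.sat Z * P.grid + P.m * P.peak :=
        Nat.add_le_add_right (Nat.mul_le_mul_right _ (hr.le_sat hP)) _

omit hP h in
variable (P A) in
/-- Every set of items is matched by a walk. -/
def HasWalks : Prop :=
  ∀ S : Finset ℕ, S.Nonempty → (∀ p ∈ S, p < P.m) →
    ∃ k ≤ S.card, ∃ x q t Z, t ≤ ∑ p ∈ S, P.c p ∧ P.Reach A k x q t Z (P.sat S)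

/-- With `grid = (K + 1) * m`, the additive loss `m * peak` from `chosen_spec` shrinks to `peak`
after division by `m`. -/
theorem chosen_approx {K : ℕ} (hK : P.grid = (K + 1) * P.m) (hW : P.HasWalks A) :
    ∃ Z : Finset ℕ, (∀ p ∈ Z, p < P.m) ∧ ∑ p ∈ Z, P.c p ≤ P.b ∧
    (∀ p, P.chosenEntry L T p = if p ∈ Z then 1 else 0) ∧
    ∀ S : Finset ℕ, (∀ p ∈ S, p < P.m) → ∑ p ∈ S, P.c p ≤ P.b →
      K * P.sat S ≤ (K + 1) * P.sat Z := by
  classical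
  obtain ⟨Z, hZm, hZc, hZ, hZ', hbest⟩ := chosen_spec hP h
  refine ⟨Z, hZm, hZc, fun p => ?_, ?_⟩
  · split_ifs with hp
    · exact (hZ p).2 hp
    · exact hZ' p hp
  have key : ∀ S : Finset ℕ, (∀ p ∈ S, p < P.m) → ∑ p ∈ S, P.c p ≤ P.b →
      (K + 1) * P.sat S ≤ (K + 1) * P.sat Z + P.peak := fun S hS hc => by
    rcases S.eq_empty_or_nonempty with rfl | hne
    · simp [sat]
    obtain ⟨k, hk, x, q, t, Z', ht, hr⟩ := hW S hne hS
    have hcard : S.card ≤ P.m := by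
      simpa using Finset.card_le_card (t := Finset.range P.m) fun p hp =>
        Finset.mem_range.2 (hS p hp)
    have := hbest hr (hk.trans hcard) (ht.trans hc)
    rw [hK] at this
    refine Nat.le_of_mul_le_mul_right (c := P.m) ?_ hP.m_pos
    calc (K + 1) * P.sat S * P.m = P.sat S * ((K + 1) * P.m) := by ring
      _ ≤ P.sat Z * ((K + 1) * P.m) + P.m * P.peak := this
      _ = _ := by ring
  intro S hS hc
  have hS' := key S hS hc
  -- If `S` is worth at least `peak`, one of the `K + 1` copies of `P.sat S` pays for the loss.
  -- Otherwise the best affordable single item is worth more than `S`, and the bound for that item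
  -- suffices.
  rcases le_or_gt P.peak (P.sat S) with hle | hlt
  · have : (K + 1) * P.sat S = K * P.sat S + P.sat S := by ring
    omega
  · obtain ⟨p, hp, hpeak⟩ : ∃ p ∈ (Finset.range P.m).filter (fun p => P.c p ≤ P.b),
        P.peak = ∑ v ∈ Finset.range P.n, P.u v p := by
      refine Finset.exists_mem_eq_sup _ ?_ _
      by_contra hne
      rw [Finset.not_nonempty_iff_eq_empty] at hne
      rw [peak, hne] at hlt
      simp at hlt
    rw [Finset.mem_filter, Finset.mem_range] at hp
    have hsat : P.sat {p} = P.peak := by rw [hpeak]; simp [sat]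
    have hp' := key {p} (by simpa using hp.1) (by simpa using hp.2)
    rw [hsat] at hp'
    have e : (K + 1) * P.peak = K * P.peak + P.peak := by ring
    have := Nat.mul_le_mul_left K hlt.le
    omega

end Tables

end Profile

/-! ### The parameters: values, bounds and computation -/

namespace DiverseKnapsack

open RAM Profile

/-- The input of the algorithm, as the contents of an array. -/
def inputArray (x : DiverseKnapsack × ℚ) (i : ℕ) : ℕ :=
  ([x.2.num.toNat, x.2.den] ++ x.1.encode).getD i 0

/-- The measure of the running time. -/
def inputSize (x : DiverseKnapsack × ℚ) : ℕ := x.1.size + ⌈1 / x.2⌉₊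

/-- The number of voters, bounded by the length of the input. -/
def voters (x : DiverseKnapsack × ℚ) : ℕ := x.1.n - (x.1.n - (x.1.encode.length + 2))

/-- The contents of the parameter registers. -/
def params (x : DiverseKnapsack × ℚ) : ℕ → ℕ
  | 0 => x.1.encode.length + 2
  | 1 => voters x
  | 2 => x.1.m
  | 3 => ⌈1 / x.2⌉₊
  | 4 => x.1.m * x.1.m
  | 5 => (x.1.m * x.1.m + 1) * (x.1.m * x.1.m) * (x.1.m * x.1.m)
  | 6 => (1 + voters x * voters x) * x.1.m + 1
  | 7 => (⌈1 / x.2⌉₊ + 1) * x.1.m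
  | 8 => (⌈1 / x.2⌉₊ + 1) * x.1.m * x.1.m + 1
  | 9 => ((1 + voters x * voters x) * x.1.m + 1) * ((1 + voters x * voters x) * x.1.m + 1)
  | 10 => (x.1.m + 1) * ((1 + voters x * voters x) * x.1.m + 1) *
      ((⌈1 / x.2⌉₊ + 1) * x.1.m * x.1.m + 1)
  | 11 => x.1.m + 1
  | _ => 0

/-- The first `j` parameters have been computed. -/
def Prepared (j : ℕ) (x : DiverseKnapsack × ℚ) (s : Store) : Prop :=
  0 < x.2 ∧ (∀ y < numParams, s.reg y = if y < j then params x y else 0) ∧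
    s.arr 0 = inputArray x

theorem length_encode (I : DiverseKnapsack) : I.encode.length = 3 + I.m + I.n * I.m := by
  simp [encode, Function.comp_def]
  omega

theorem length_le_size (I : DiverseKnapsack) : I.encode.length ≤ I.size := by
  unfold size
  generalize I.encode = l
  induction l with
  | nil => simp
  | cons a l ih => simp; omega

section PolyBounded

def PolyBounded {ι : Type} (size f : ι → ℕ) : Prop :=
  ∃ r : Polynomial ℕ, ∀ x, f x ≤ r.eval (size x)

variable {ι : Type} {size f g : ι → ℕ}

theorem PolyBounded.of_le (hg : PolyBounded size g) (h : ∀ x, f x ≤ g x) : PolyBounded size f :=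
  let ⟨r, hr⟩ := hg
  ⟨r, fun x => (h x).trans (hr x)⟩

theorem PolyBounded.self : PolyBounded size size := ⟨Polynomial.X, fun x => by simp⟩

theorem PolyBounded.const (k : ℕ) : PolyBounded size (fun _ => k) :=
  ⟨Polynomial.C k, fun x => by simp⟩

theorem PolyBounded.add (hf : PolyBounded size f) (hg : PolyBounded size g) :
    PolyBounded size (fun x => f x + g x) := by
  obtain ⟨r, hr⟩ := hf
  obtain ⟨r', hr'⟩ := hg
  exact ⟨r + r', fun x => by simpa using add_le_add (hr x) (hr' x)⟩

theorem PolyBounded.mul (hf : PolyBounded size f) (hg : PolyBounded size g) :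
    PolyBounded size (fun x => f x * g x) := by
  obtain ⟨r, hr⟩ := hf
  obtain ⟨r', hr'⟩ := hg
  exact ⟨r * r', fun x => by simpa using Nat.mul_le_mul (hr x) (hr' x)⟩

theorem PolyBounded.exists_common {F : ℕ → ι → ℕ} (h : ∀ y, PolyBounded size (F y)) (N : ℕ) :
    ∃ r : Polynomial ℕ, ∀ x, ∀ y < N, F y x ≤ r.eval (size x) := by
  choose r hr using h
  refine ⟨∑ y ∈ Finset.range N, r y, fun x y hy => (hr y x).trans ?_⟩
  rw [Polynomial.eval_finsetSum]
  exact Finset.single_le_sum (f := fun y => (r y).eval (size x)) (fun _ _ => Nat.zero_le _)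
    (Finset.mem_range.2 hy)

end PolyBounded

theorem polyBounded_params (y : ℕ) : PolyBounded inputSize (params · y) := by
  have hl₀ : PolyBounded inputSize fun x => x.1.encode.length :=
    PolyBounded.self.of_le fun x => by
      have := length_le_size x.1
      unfold inputSize
      omega
  have hl : PolyBounded inputSize fun x => x.1.encode.length + 2 := hl₀.add (.const 2)
  have hn : PolyBounded inputSize voters := hl.of_le fun x => by unfold voters; omega
  have hm : PolyBounded inputSize fun x => x.1.m := hl.of_le fun x => by
    rw [length_encode]; omega
  have hk : PolyBounded inputSize fun x => ⌈1 / x.2⌉₊ := PolyBounded.self.of_le fun x => by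
    unfold inputSize; omega
  have hN := (((PolyBounded.const 1).add (hn.mul hn)).mul hm).add (.const 1)
  have hT := (hk.add (.const 1)).mul hm
  rcases y with _ | _ | _ | _ | _ | _ | _ | _ | _ | _ | _ | _ | y
  · exact hl
  · exact hn
  · exact hm
  · exact hk
  · exact hm.mul hm
  · exact (((hm.mul hm).add (.const 1)).mul (hm.mul hm)).mul (hm.mul hm)
  · exact hN
  · exact hT
  · exact (hT.mul hm).add (.const 1)
  · exact hN.mul hN
  · exact ((hm.add (.const 1)).mul hN).mul ((hT.mul hm).add (.const 1))
  · exact hm.add (.const 1)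
  · exact .const 0

theorem paramsBounded {P : DiverseKnapsack × ℚ → Store → Prop}
    (h : ∀ x s, P x s → ∀ y < numParams, s.reg y ≤ params x y) :
    Achieves.ParamsBounded inputSize P := by
  obtain ⟨r, hr⟩ := PolyBounded.exists_common polyBounded_params numParams
  exact ⟨r, fun x s hs y hy => (h x s hs y hy).trans (hr x y hy)⟩

theorem paramsBounded_prepared (j : ℕ) : Achieves.ParamsBounded inputSize (Prepared j) :=
  paramsBounded fun x s hs y hy => by rw [hs.2.1 y hy]; split_ifs <;> simp

theorem achieves_prepared_succ (j : ℕ) {F : Store → ℕ} (hF : Definable F)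
    (h : ∀ x s, Prepared j x s → F s = params x j) :
    Achieves inputSize (Prepared j) (Prepared (j + 1)) := by
  refine .setParam j hF (paramsBounded_prepared j) fun x s s' hs ha hr => ⟨hs.1, fun y hy => ?_, ?_⟩
  · rw [hr y hy, h x s hs, hs.2.1 y hy]
    rcases lt_trichotomy y j with hlt | rfl | hlt
    · simp [hlt, hlt.ne, hlt.trans (Nat.lt_succ_self j)]
    · simp
    · simp [hlt.ne', hlt.not_gt, show ¬ y < j + 1 by omega]
  · rw [ha, hs.2.2]

/-- Without denominators, the ceiling can be found by counting and repeated addition. -/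
theorem lt_ceil_inv_iff {ε : ℚ} (h : 0 < ε) (j : ℕ) :
    j < ⌈1 / ε⌉₊ ↔ j * ε.num.toNat < ε.den := by
  have hn : ((ε.num.toNat : ℕ) : ℚ) = ε.num := by
    exact_mod_cast Int.toNat_of_nonneg (Rat.num_nonneg.2 h.le)
  have hd : (0 : ℚ) < ε.den := by exact_mod_cast ε.den_pos
  rw [Nat.lt_ceil, lt_div_iff₀ h, ← Nat.cast_lt (α := ℚ)]
  push_cast
  rw [hn]
  nth_rewrite 1 [← Rat.num_div_den ε]
  rw [← mul_div_assoc, div_lt_one hd]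

theorem achieves_ceil : Achieves inputSize (Prepared 3) (Prepared 4) := by
  -- Register `16`, the first scratch register, accumulates multiples of the numerator until it
  -- reaches the denominator; register `3` counts them.
  let body : Prog := .seq (.assign 16 (.add (.reg 16) (.cell 0 (.lit 0))))
    (.assign 3 (.add (.reg 3) (.lit 1)))
  refine ⟨.seq (.assign 16 (.lit 0)) (.while (.sub (.cell 0 (.lit 1)) (.reg 16)) body),
    Polynomial.X * Polynomial.C 14 + Polynomial.C 7, fun x s hs => ?_⟩
  have hnum : inputArray x 0 = x.2.num.toNat := rfl
  have hden : inputArray x 1 = x.2.den := rfl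
  obtain ⟨s', t, e, ht, hI⟩ := exec_while (n := ⌈1 / x.2⌉₊) (T := 9)
    (e := .sub (.cell 0 (.lit 1)) (.reg 16)) (c := body)
    (fun j s' => s'.arr = s.arr ∧ s'.reg 16 = j * x.2.num.toNat ∧ s'.reg 3 = j ∧
      ∀ y < numParams, y ≠ 3 → s'.reg y = s.reg y)
    (fun j s' ⟨ha, h16, _⟩ => by
      rw [lt_ceil_inv_iff hs.1]
      simp only [Expr.eval, ha, hs.2.2, hden, h16]
      omega)
    (fun j s' hj ⟨ha, h16, h3, hy⟩ => by
      refine ⟨_, _, .seq (.assign _ _ _) (.assign _ _ _), ?_, ?_, ?_, ?_, ?_⟩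
      · simp [Expr.steps]
      · simp [ha]
      · rw [Store.setReg_reg_of_ne _ _ (by decide), Store.setReg_reg_self]
        simp [Expr.eval, ha, hs.2.2, hnum, h16, Nat.succ_mul]
      · rw [Store.setReg_reg_self]
        simp [Expr.eval, Store.setReg_reg_of_ne, h3]
      · intro y hyl hy3
        have : y ≠ 16 := by unfold numParams at hyl; omega
        rw [Store.setReg_reg_of_ne _ _ hy3, Store.setReg_reg_of_ne _ _ this, hy y hyl hy3])
    (s := s.setReg 16 0)
    ⟨rfl, by simp, by
      rw [Store.setReg_reg_of_ne _ _ (by decide), hs.2.1 3 (by decide)]; simp,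
      fun y hyl _ => Store.setReg_reg_of_ne _ _ (by unfold numParams at hyl; omega)⟩
  refine ⟨s', _, .seq (.assign _ _ _) e, ?_, hs.1, fun y hy => ?_, ?_⟩
  · simp only [Expr.steps, Polynomial.eval_add, Polynomial.eval_mul, Polynomial.eval_X,
      Polynomial.eval_C] at ht ⊢
    have : ⌈1 / x.2⌉₊ ≤ inputSize x := Nat.le_add_left _ _
    omega
  · by_cases h3 : y = 3
    · subst h3
      rw [hI.2.2.1]
      simp [params]
    · rw [hI.2.2.2 y hy h3, hs.2.1 y hy]
      congr 1
      simp only [eq_iff_iff]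
      omega
  · rw [hI.1, hs.2.2]

theorem prepared_one (x : DiverseKnapsack × ℚ) (h : 0 < x.2) :
    Prepared 1 x (Store.ofInput ([x.2.num.toNat, x.2.den] ++ x.1.encode)) := by
  refine ⟨h, fun y _ => ?_, ?_⟩
  · rcases y with _ | y
    · simp [Store.ofInput, params]
    · simp [Store.ofInput]
  · funext i
    simp [Store.ofInput, inputArray]

/-- Cells `0` and `1` hold the numerator and denominator of `ε`, so the instance begins in cell `2`
and its costs in cell `5`. -/
theorem inputArray_head (x : DiverseKnapsack × ℚ) : inputArray x 2 = x.1.n ∧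
    inputArray x 3 = x.1.m ∧ inputArray x 4 = x.1.budget := ⟨rfl, rfl, rfl⟩

theorem achieves_params : Achieves inputSize (Prepared 1) (Prepared 12) := by
  have hp : ∀ {j x s}, Prepared j x s → ∀ y, y < numParams → y < j → s.reg y = params x y :=
    fun hs y hy hyj => by rw [hs.2.1 y hy, if_pos hyj]
  have p : ∀ (y : ℕ) (hy : y < numParams), Definable (fun s : Store => s.reg y) := fun y hy =>
    Definable.param (Γ := Store) y hy
  refine (achieves_prepared_succ 1 (F := fun s => s.arr 0 2 - (s.arr 0 2 - s.reg 0))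
    (.sub (.cell (Γ := Store) 0 (.const 2)) (.sub (.cell (Γ := Store) 0 (.const 2))
      (p 0 (by decide)))) fun x s hs => ?_).trans ?_
  · rw [hp hs 0 (by decide) (by omega), hs.2.2, (inputArray_head x).1]; rfl
  refine (achieves_prepared_succ 2 (F := fun s => s.arr 0 3)
    (.cell (Γ := Store) 0 (.const 3)) fun x s hs => ?_).trans ?_
  · rw [hs.2.2, (inputArray_head x).2.1]; rfl
  refine achieves_ceil.trans ?_
  have hm : ∀ {j x s}, Prepared j x s → 4 ≤ j → s.reg 2 = x.1.m := fun hs hj =>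
    hp hs 2 (by decide) (by omega)
  refine (achieves_prepared_succ 4 (F := fun s => s.reg 2 * s.reg 2)
    ((p 2 (by decide)).mul_param 2) fun x s hs => ?_).trans ?_
  · rw [hm hs le_rfl]; rfl
  refine (achieves_prepared_succ 5 (F := fun s => (s.reg 4 + 1) * s.reg 4 * s.reg 4)
    ((((p 4 (by decide)).add (.const 1)).mul_param 4).mul_param 4) fun x s hs => ?_).trans ?_
  · rw [hp hs 4 (by decide) (by omega)]; rfl
  refine (achieves_prepared_succ 6 (F := fun s => (1 + s.reg 1 * s.reg 1) * s.reg 2 + 1)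
    ((((Definable.const 1).add ((p 1 (by decide)).mul_param 1)).mul_param 2).add (.const 1))
    fun x s hs => ?_).trans ?_
  · rw [hp hs 1 (by decide) (by omega), hp hs 2 (by decide) (by omega)]; rfl
  refine (achieves_prepared_succ 7 (F := fun s => (s.reg 3 + 1) * s.reg 2)
    (((p 3 (by decide)).add (.const 1)).mul_param 2) fun x s hs => ?_).trans ?_
  · rw [hp hs 3 (by decide) (by omega), hp hs 2 (by decide) (by omega)]; rfl
  refine (achieves_prepared_succ 8 (F := fun s => s.reg 7 * s.reg 2 + 1)
    (((p 7 (by decide)).mul_param 2).add (.const 1)) fun x s hs => ?_).trans ?_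
  · rw [hp hs 7 (by decide) (by omega), hp hs 2 (by decide) (by omega)]; rfl
  refine (achieves_prepared_succ 9 (F := fun s => s.reg 6 * s.reg 6)
    ((p 6 (by decide)).mul_param 6) fun x s hs => ?_).trans ?_
  · rw [hp hs 6 (by decide) (by omega)]; rfl
  refine (achieves_prepared_succ 10 (F := fun s => (s.reg 2 + 1) * s.reg 6 * s.reg 8)
    ((((p 2 (by decide)).add (.const 1)).mul_param 6).mul_param 8) fun x s hs => ?_).trans ?_
  · rw [hp hs 2 (by decide) (by omega), hp hs 6 (by decide) (by omega),
      hp hs 8 (by decide) (by omega)]; rfl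
  refine achieves_prepared_succ 11 (F := fun s => s.reg 2 + 1)
    ((p 2 (by decide)).add (.const 1)) fun x s hs => ?_
  rw [hp hs 2 (by decide) (by omega)]; rfl

end DiverseKnapsack

/-! ### Table entries depend on earlier cells only -/

namespace Profile

variable {P : Profile} {A A' W D D' R R' L T T' : ℕ → ℕ}

theorem index_lt {k e f E M : ℕ} (he : e < E) (hf : f < M) :
    (k * E + e) * M + f < (k + 1) * E * M := by
  have h₁ : k * E + e + 1 ≤ (k + 1) * E := by rw [Nat.succ_mul]; omega
  have := Nat.mul_le_mul_right M h₁
  rw [Nat.succ_mul] at this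
  omega

theorem lt_of_index_lt {k e f E M K : ℕ} (h : (k * E + e) * M + f < K * E * M) : k < K := by
  by_contra hk
  have := Nat.mul_le_mul_right M (Nat.mul_le_mul_right E (not_lt.1 hk))
  have h₂ := Nat.mul_le_mul_right M (Nat.le_add_right (k * E) e)
  omega

/-- Level `k + 1` reads only level `k`, all of whose cells precede it. The same reason works for
`costEntry_congr`, where the minimization also reads only the preceding level. -/
theorem closureEntry_congr {k e f : ℕ} (he : e < P.pairs) (hf : f < P.pairs) (hk : k ≤ P.pairs)
    (h : ∀ j < (k * P.pairs + e) * P.pairs + f, A j = A' j) :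
    P.closureEntry A k e f = P.closureEntry A' k e f := by
  classical
  cases k with
  | zero => simp [closureEntry]
  | succ k =>
    have h' : ∀ e' < P.pairs, ∀ f' < P.pairs,
        A ((k * P.pairs + e') * P.pairs + f') = A' ((k * P.pairs + e') * P.pairs + f') :=
      fun e' he' f' hf' => h _ ((index_lt he' hf').trans_le (by
        refine le_trans ?_ (Nat.le_add_right _ _)
        exact Nat.mul_le_mul_right _ (Nat.le_add_right _ _)))
    simp only [closureEntry, Nat.add_sub_cancel, h' e he f hf, h' e he k (by omega),
      h' k (by omega) f hf]

theorem costEntry_congr (hP : P.Valid) {k x q : ℕ} (hq : q < P.levels)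
    (h : ∀ j < (k * P.nodes + x) * P.levels + q, D j = D' j) :
    P.costEntry W D k x q = P.costEntry W D' k x q := by
  classical
  cases k with
  | zero => simp [costEntry]
  | succ k =>
    have hc : ∀ y < P.nodes, P.candidate W D (k + 1) x q y = P.candidate W D' (k + 1) x q y := by
      intro y hy
      unfold candidate
      rw [Nat.add_sub_cancel, h _ ((index_lt hy (lt_of_le_of_lt (Nat.sub_le _ _) hq)).trans_le ?_)]
      refine le_trans ?_ (Nat.le_add_right _ _)
      exact Nat.mul_le_mul_right _ (Nat.le_add_right _ _)
    have hp : P.previous W D (k + 1) x q = P.previous W D' (k + 1) x q := by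
      refine pick_congr fun y hy => forall_congr' fun z => forall_congr' fun hz => ?_
      rw [hc y hy, hc z hz]
    rw [costEntry, costEntry, if_neg (by omega), if_neg (by omega), hp,
      hc _ (previous_spec hP _ _ _).1]

theorem traceEntry_congr {t : ℕ} (h : ∀ j < t, T j = T' j) :
    P.traceEntry D R T t = P.traceEntry D R T' t := by
  cases t with
  | zero => simp [traceEntry]
  | succ t => simp [traceEntry, h t (by omega)]

end Profile

/-! ### Computing the tables one after another -/

namespace DiverseKnapsack

open RAM Profile

/-- The instance as data of the algorithm. -/
def profile (x : DiverseKnapsack × ℚ) : Profile :=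
  ofStore ⟨params x, fun _ => inputArray x⟩

/-- The parameters have been computed, and there are items. -/
structure Ready (x : DiverseKnapsack × ℚ) (s : Store) : Prop where
  pos : 0 < x.2
  m_pos : 0 < x.1.m
  reg : ∀ y < numParams, s.reg y = params x y
  arr : s.arr 0 = inputArray x

theorem Ready.ofStore_eq {x : DiverseKnapsack × ℚ} {s : Store} (h : Ready x s) :
    ofStore s = profile x := by
  simp only [profile, ofStore, h.arr, h.reg 1 (by decide), h.reg 2 (by decide),
    h.reg 4 (by decide), h.reg 6 (by decide), h.reg 7 (by decide), h.reg 8 (by decide),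
    h.reg 10 (by decide), h.reg 11 (by decide)]

theorem Ready.agree {x : DiverseKnapsack × ℚ} {a : ℕ} {s s' : Store} (h : Ready x s)
    (hs : AgreeOff a s s') (ha : 0 ≠ a) : Ready x s' :=
  ⟨h.pos, h.m_pos, fun y hy => (hs.1 y hy).trans (h.reg y hy), (hs.2 0 ha).trans h.arr⟩

theorem valid_profile {x : DiverseKnapsack × ℚ} (h : 0 < x.1.m) : (profile x).Valid :=
  ⟨h, rfl, rfl, rfl, rfl, rfl⟩

theorem paramsBounded_ready {P : DiverseKnapsack × ℚ → Store → Prop}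
    (h : ∀ x s, P x s → Ready x s) : Achieves.ParamsBounded inputSize P :=
  paramsBounded fun x s hs y hy => ((h x s hs).reg y hy).le

theorem nodes_pos (x : DiverseKnapsack × ℚ) : 0 < params x 6 := Nat.succ_pos _

theorem levels_pos (x : DiverseKnapsack × ℚ) : 0 < params x 8 := Nat.succ_pos _

/-- The closure table has been computed. -/
def HasClosure (x : DiverseKnapsack × ℚ) (s : Store) : Prop :=
  Ready x s ∧ (profile x).IsClosure (s.arr 1)

theorem achieves_hasClosure : Achieves inputSize Ready HasClosure := by
  have hpairs : ∀ {x s}, Ready x s → s.reg 4 = (profile x).pairs := fun hs => hs.reg 4 (by decide)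
  have hle : ∀ {x s}, Ready x s → ∀ {k e f}, (k * s.reg 4 + e) * s.reg 4 + f < s.reg 5 →
      k ≤ (profile x).pairs := fun {x s} hs {k e f} h => by
    rw [hpairs hs, hs.reg 5 (by decide)] at h
    exact Nat.lt_succ_iff.1 (lt_of_index_lt (K := (profile x).pairs + 1) h)
  refine Achieves.tabulate₃ 1 5 4 4
    (F := fun s k e f => (ofStore s).closureEntry (s.arr 1) k e f)
    (definable_closureEntry Definable.var.weaken .var Definable.var.weaken.weaken)
    (paramsBounded_ready fun _ _ h => h) ?_ ?_ ?_ ?_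
  · intro x s hs k e f he hf hlt s₁ s₂ h₁ h₂ hj
    simp only [(hs.agree h₁ (by decide)).ofStore_eq, (hs.agree h₂ (by decide)).ofStore_eq]
    have hk := hle hs hlt
    rw [hpairs hs] at he hf hj
    exact closureEntry_congr he hf hk hj
  · intro x s s' hs hA h
    have hs' := hs.agree hA (by decide)
    refine ⟨hs', fun k e f hk he hf => ?_⟩
    have := h k e f
    rw [hs'.ofStore_eq, hpairs hs, hs.reg 5 (by decide)] at this
    refine this he hf ?_
    refine (index_lt he hf).trans_le ?_
    exact Nat.mul_le_mul_right _ (Nat.mul_le_mul_right _ (Nat.succ_le_succ hk))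
  all_goals
    intro x s hs
    rw [hpairs hs]
    exact Nat.mul_pos hs.m_pos hs.m_pos

/-- The table of edges has been computed. -/
def HasEdges (x : DiverseKnapsack × ℚ) (s : Store) : Prop :=
  HasClosure x s ∧ ∀ y z, y < (profile x).nodes → z < (profile x).nodes →
    s.arr 2 (y * (profile x).nodes + z) = (profile x).edgeEntry (s.arr 1) y z

theorem achieves_hasEdges : Achieves inputSize HasClosure HasEdges := by
  have hnodes : ∀ {x s}, Ready x s → s.reg 6 = (profile x).nodes := fun hs => hs.reg 6 (by decide)
  refine Achieves.tabulate₂ 2 9 6 (F := fun s y z => (ofStore s).edgeEntry (s.arr 1) y z)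
    (definable_edgeEntry Definable.var.weaken .var) (paramsBounded_ready fun _ _ h => h.1) ?_ ?_ ?_
  · intro x s hs e f hf hlt s₁ s₂ h₁ h₂ _
    simp only [(hs.1.agree h₁ (by decide)).ofStore_eq, (hs.1.agree h₂ (by decide)).ofStore_eq,
      h₁.2 1 (by decide), h₂.2 1 (by decide)]
  · intro x s s' hs hA h
    have hs' := hs.1.agree hA (by decide)
    refine ⟨⟨hs', by rw [hA.2 1 (by decide)]; exact hs.2⟩, fun y z hy hz => ?_⟩
    have := h y z
    rw [hs'.ofStore_eq, hnodes hs.1, hs.1.reg 9 (by decide)] at this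
    refine this hz ?_
    have h₁ := Nat.mul_le_mul_right (profile x).nodes (Nat.succ_le_of_lt hy)
    rw [Nat.succ_mul] at h₁
    exact lt_of_lt_of_le (Nat.add_lt_add_left hz _) h₁
  · intro x s hs
    rw [hnodes hs.1]
    exact nodes_pos x

/-- The table of costs has been computed. -/
def HasCosts (x : DiverseKnapsack × ℚ) (s : Store) : Prop :=
  HasEdges x s ∧ ∀ k y q, k ≤ (profile x).m → y < (profile x).nodes → q < (profile x).levels →
    s.arr 3 ((profile x).state k y q) = (profile x).costEntry (s.arr 2) (s.arr 3) k y q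

theorem HasEdges.agree {x : DiverseKnapsack × ℚ} {a : ℕ} {s s' : Store} (h : HasEdges x s)
    (hs : AgreeOff a s s') (ha : 2 < a) : HasEdges x s' := by
  refine ⟨⟨h.1.1.agree hs (by omega), ?_⟩, ?_⟩
  · rw [hs.2 1 (by omega)]; exact h.1.2
  · rw [hs.2 1 (by omega), hs.2 2 (by omega)]; exact h.2

theorem HasCosts.agree {x : DiverseKnapsack × ℚ} {a : ℕ} {s s' : Store} (h : HasCosts x s)
    (hs : AgreeOff a s s') (ha : 3 < a) : HasCosts x s' := by
  refine ⟨h.1.agree hs (by omega), ?_⟩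
  rw [hs.2 2 (by omega), hs.2 3 (by omega)]; exact h.2

theorem Ready.reg_six {x : DiverseKnapsack × ℚ} {s : Store} (h : Ready x s) :
    s.reg 6 = (profile x).nodes := h.reg 6 (by decide)

theorem Ready.reg_eight {x : DiverseKnapsack × ℚ} {s : Store} (h : Ready x s) :
    s.reg 8 = (profile x).levels := h.reg 8 (by decide)

theorem Ready.reg_ten {x : DiverseKnapsack × ℚ} {s : Store} (h : Ready x s) :
    s.reg 10 = (profile x).states := h.reg 10 (by decide)

/-- Tabulation of a function of the states. -/
theorem achieves_states (a : ℕ) {P Q : DiverseKnapsack × ℚ → Store → Prop}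
    {F : Store → ℕ → ℕ → ℕ → ℕ}
    (hF : Definable (fun γ : (((((Store × ℕ) × ℕ) × ℕ) × ℕ) × ℕ) =>
      F γ.1.1.1.1.1 γ.1.2 γ.2 γ.1.1.2))
    (hP : ∀ x s, P x s → Ready x s)
    (hloc : ∀ x s, P x s → ∀ k y q, q < (profile x).levels →
      LocalAt a s (F · k y q) ((profile x).state k y q))
    (h : ∀ x s s', P x s → AgreeOff a s s' →
      (∀ k y q, k ≤ (profile x).m → y < (profile x).nodes → q < (profile x).levels →
        s'.arr a ((profile x).state k y q) = F s' k y q) → Q x s') :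
    Achieves inputSize P Q := by
  refine Achieves.tabulate₃ a 10 6 8 hF (paramsBounded_ready hP) ?_ ?_ ?_ ?_
  · intro x s hs k y q hy hq hlt
    have hr := hP x s hs
    rw [hr.reg_eight] at hq
    rw [hr.reg_six, hr.reg_eight]
    exact hloc x s hs k y q hq
  · intro x s s' hs hA hs'
    have hr := hP x s hs
    rw [hr.reg_six, hr.reg_eight, hr.reg_ten] at hs'
    exact h x s s' hs hA fun k y q hk hy hq =>
      hs' k y q hy hq (state_lt (valid_profile hr.m_pos) hk hy hq)
  · intro x s hs
    rw [(hP x s hs).reg_eight]; exact levels_pos x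
  · intro x s hs
    rw [(hP x s hs).reg_six]; exact nodes_pos x

theorem achieves_hasCosts : Achieves inputSize HasEdges HasCosts := by
  refine achieves_states 3
    (F := fun s k y q => (ofStore s).costEntry (s.arr 2) (s.arr 3) k y q)
    (definable_costEntry Definable.var.weaken .var Definable.var.weaken.weaken)
    (fun _ _ h => h.1.1) ?_ ?_
  · intro x s hs k y q hq s₁ s₂ h₁ h₂ hj
    simp only [(hs.1.1.agree h₁ (by decide)).ofStore_eq, (hs.1.1.agree h₂ (by decide)).ofStore_eq,
      h₁.2 2 (by decide), h₂.2 2 (by decide)]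
    exact costEntry_congr (valid_profile hs.1.1.m_pos) hq hj
  · intro x s s' hs hA h
    rw [(hs.1.1.agree hA (by decide)).ofStore_eq] at h
    exact ⟨hs.agree hA (by decide), h⟩

/-- The table of previous states has been computed. -/
def HasPrevious (x : DiverseKnapsack × ℚ) (s : Store) : Prop :=
  HasCosts x s ∧ ∀ k y q, k ≤ (profile x).m → y < (profile x).nodes → q < (profile x).levels →
    s.arr 4 ((profile x).state k y q) = (profile x).previousEntry (s.arr 2) (s.arr 3) k y q

theorem achieves_hasPrevious : Achieves inputSize HasCosts HasPrevious := by
  refine achieves_states 4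
    (F := fun s k y q => (ofStore s).previousEntry (s.arr 2) (s.arr 3) k y q)
    (definable_previousEntry Definable.var.weaken .var Definable.var.weaken.weaken)
    (fun _ _ h => h.1.1.1) ?_ ?_
  · intro x s hs k y q hq s₁ s₂ h₁ h₂ _
    simp only [(hs.1.1.1.agree h₁ (by decide)).ofStore_eq,
      (hs.1.1.1.agree h₂ (by decide)).ofStore_eq, h₁.2 2 (by decide), h₂.2 2 (by decide),
      h₁.2 3 (by decide), h₂.2 3 (by decide)]
  · intro x s s' hs hA h
    rw [(hs.1.1.1.agree hA (by decide)).ofStore_eq] at h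
    exact ⟨hs.agree hA (by decide), h⟩

/-- The table of labels has been computed. -/
def HasLabels (x : DiverseKnapsack × ℚ) (s : Store) : Prop :=
  HasPrevious x s ∧ ∀ k y q, k ≤ (profile x).m → y < (profile x).nodes →
    q < (profile x).levels → s.arr 5 ((profile x).state k y q) = (profile x).labelEntry k y

theorem achieves_hasLabels : Achieves inputSize HasPrevious HasLabels := by
  refine achieves_states 5 (F := fun s k y _ => (ofStore s).labelEntry k y)
    (definable_labelEntry Definable.var.weaken .var) (fun _ _ h => h.1.1.1.1) ?_ ?_
  · intro x s hs k y q hq s₁ s₂ h₁ h₂ _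
    simp only [(hs.1.1.1.1.agree h₁ (by decide)).ofStore_eq,
      (hs.1.1.1.1.agree h₂ (by decide)).ofStore_eq]
  · intro x s s' hs hA h
    rw [(hs.1.1.1.1.agree hA (by decide)).ofStore_eq] at h
    refine ⟨⟨hs.1.agree hA (by decide), ?_⟩, h⟩
    rw [hA.2 2 (by decide), hA.2 3 (by decide), hA.2 4 (by decide)]
    exact hs.2

/-- All tables have been computed. -/
def HasTables (x : DiverseKnapsack × ℚ) (s : Store) : Prop :=
  Ready x s ∧ (profile x).IsClosure (s.arr 1) ∧
    (profile x).IsTables (s.arr 1) (s.arr 2) (s.arr 3) (s.arr 4) (s.arr 5) (s.arr 6)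

theorem achieves_hasTables : Achieves inputSize HasLabels HasTables := by
  have hlen : ∀ {x s}, HasLabels x s → s.reg 11 = x.1.m + 1 := fun hs =>
    hs.1.1.1.1.1.reg 11 (by decide)
  refine Achieves.tabulate 6 11
    (F := fun s t => (ofStore s).traceEntry (s.arr 3) (s.arr 4) (s.arr 6) t)
    (definable_traceEntry Definable.var) (paramsBounded_ready fun _ _ h => h.1.1.1.1.1) ?_ ?_
  · intro x s hs t ht s₁ s₂ h₁ h₂ hj
    simp only [(hs.1.1.1.1.1.agree h₁ (by decide)).ofStore_eq,
      (hs.1.1.1.1.1.agree h₂ (by decide)).ofStore_eq, h₁.2 3 (by decide), h₂.2 3 (by decide),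
      h₁.2 4 (by decide), h₂.2 4 (by decide)]
    exact traceEntry_congr hj
  · intro x s s' hs hA h
    rw [(hs.1.1.1.1.1.agree hA (by decide)).ofStore_eq, hlen hs] at h
    have e := fun a (ha : a ≠ 6) => hA.2 a ha
    refine ⟨hs.1.1.1.1.1.agree hA (by decide), ?_, ?_, ?_, ?_, ?_, ?_⟩
    · rw [e 1 (by decide)]; exact hs.1.1.1.1.2
    · rw [e 1 (by decide), e 2 (by decide)]; exact hs.1.1.1.2
    · rw [e 2 (by decide), e 3 (by decide)]; exact hs.1.1.2
    · rw [e 2 (by decide), e 3 (by decide), e 4 (by decide)]; exact hs.1.2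
    · rw [e 5 (by decide)]; exact hs.2
    · exact fun t ht => h t (Nat.lt_succ_of_le ht)

/-- The result has been written. -/
def HasResult (x : DiverseKnapsack × ℚ) (s : Store) : Prop :=
  s.reg 0 = x.1.m ∧ (0 < x.1.m → ∃ A W D R L T : ℕ → ℕ, (profile x).IsClosure A ∧
    (profile x).IsTables A W D R L T ∧ ∀ p < x.1.m, s.arr 0 p = (profile x).chosenEntry L T p)

/-- The data of the instance are read from array `0`, so the result is first written to array `7`
and copied to array `0` only at the end. Register `0`, the length of the output, is set last. -/
theorem achieves_hasResult : Achieves inputSize HasTables HasResult := by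
  refine Achieves.trans (Q := fun x s => s.reg 2 = x.1.m ∧ ∃ A W D R L T : ℕ → ℕ,
    (profile x).IsClosure A ∧ (profile x).IsTables A W D R L T ∧
    ∀ p < x.1.m, s.arr 0 p = (profile x).chosenEntry L T p) ?_
    (.assign 0 (.reg 2) fun x s hs => ⟨by simpa [Expr.eval] using hs.1, fun _ => hs.2⟩)
  refine Achieves.tabulate 7 2 (F := fun s p => (ofStore s).chosenEntry (s.arr 5) (s.arr 6) p)
    (Q := fun x s => Ready x s ∧ ∃ A W D R L T : ℕ → ℕ,
      (profile x).IsClosure A ∧ (profile x).IsTables A W D R L T ∧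
      ∀ p < x.1.m, s.arr 7 p = (profile x).chosenEntry L T p)
    (definable_chosenEntry Definable.var) (paramsBounded_ready fun _ _ h => h.1) ?_ ?_ |>.trans ?_
  · intro x s hs t ht s₁ s₂ h₁ h₂ hj
    simp only [(hs.1.agree h₁ (by decide)).ofStore_eq, (hs.1.agree h₂ (by decide)).ofStore_eq,
      h₁.2 5 (by decide), h₂.2 5 (by decide), h₁.2 6 (by decide), h₂.2 6 (by decide)]
  · intro x s s' hs hA h
    have hs' := hs.1.agree hA (by decide)
    rw [hs'.ofStore_eq, hs.1.reg 2 (by decide), hA.2 5 (by decide), hA.2 6 (by decide)] at h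
    exact ⟨hs', _, _, _, _, _, _, hs.2.1, hs.2.2, h⟩
  · refine Achieves.tabulate 0 2 (F := fun s p => s.arr 7 p)
      (Definable.cell 7 Definable.var) (paramsBounded_ready fun _ _ h => h.1) ?_ ?_
    · intro x s hs t ht s₁ s₂ h₁ h₂ _
      simp only [h₁.2 7 (by decide), h₂.2 7 (by decide)]
    · intro x s s' hs hA h
      obtain ⟨hr, A, W, D, R, L, T, hc, ht, ho⟩ := hs
      have h2 : s.reg 2 = x.1.m := hr.reg 2 (by decide)
      refine ⟨(hA.1 2 (by decide)).trans h2, A, W, D, R, L, T, hc, ht, fun p hp => ?_⟩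
      rw [h p (h2 ▸ hp), hA.2 7 (by decide), ho p hp]

theorem achieves_result : Achieves inputSize (Prepared 1) HasResult := by
  refine achieves_params.trans (.ite (.reg 2) ?_ ?_)
  · refine .mono (achieves_hasClosure.trans (achieves_hasEdges.trans (achieves_hasCosts.trans
      (achieves_hasPrevious.trans (achieves_hasLabels.trans (achieves_hasTables.trans
        achieves_hasResult)))))) (fun x s hs => ?_) fun _ _ h => h
    have hreg : ∀ y < numParams, s.reg y = params x y := fun y hy => by
      rw [hs.1.2.1 y hy]
      split_ifs with h
      · rfl
      · obtain ⟨z, rfl⟩ : ∃ z, y = z + 12 := ⟨y - 12, by omega⟩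
        rfl
    refine ⟨hs.1.1, Nat.pos_of_ne_zero ?_, hreg, hs.1.2.2⟩
    have := hs.2
    rw [Expr.eval, hreg 2 (by decide)] at this
    exact this
  -- Without items the indices of the tables cannot be decoded by division by `m`; the output is
  -- then empty.
  · refine .assign 0 (.reg 2) fun x s hs => ?_
    have h0 : x.1.m = 0 := by
      have := hs.2
      rwa [Expr.eval, hs.1.2.1 2 (by decide)] at this
    refine ⟨?_, fun h => absurd h0 h.ne'⟩
    rw [Store.setReg_reg_self, hs.2, h0]

end DiverseKnapsack

/-! ### From the arrays back to the instance -/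

namespace DiverseKnapsack

open RAM Profile

theorem inputArray_cost (x : DiverseKnapsack × ℚ) (p : Fin x.1.m) :
    inputArray x (5 + p) = x.1.cost p := by
  have hp := p.2
  simp [inputArray, encode, List.getD_eq_getElem?_getD, List.getElem?_append,
    show 5 + (p : ℕ) = (p : ℕ) + 1 + 1 + 1 + 1 + 1 by omega]

theorem inputArray_util (x : DiverseKnapsack × ℚ) (v : Fin x.1.n) (p : Fin x.1.m) :
    inputArray x (5 + x.1.m + (v * x.1.m + p)) = x.1.util v p := by
  have hp := p.2
  have hv := v.2
  have hm : 0 < x.1.m := by omega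
  have hlt : (v : ℕ) * x.1.m + p < x.1.n * x.1.m := by
    have := Nat.mul_le_mul_right x.1.m (Nat.succ_le_of_lt hv)
    rw [Nat.succ_mul] at this
    omega
  have hdiv : ∀ (i : ℕ) (j : Fin x.1.m), (i * x.1.m + j) / x.1.m = i := fun i j => by
    rw [mul_comm, Nat.mul_add_div hm, Nat.div_eq_of_lt j.2, add_zero]
  have hflat : (List.ofFn fun v => List.ofFn (x.1.util v)).flatten =
      List.ofFn fun k : Fin (x.1.n * x.1.m) => x.1.util k.divNat k.modNat := by
    rw [List.ofFn_mul]
    congr 2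
    funext i
    congr 1
    funext j
    congr 1
    · ext
      simp [Fin.divNat, hdiv]
    · ext
      simp [Fin.modNat, Nat.mod_eq_of_lt]
  have hidx : 5 + x.1.m + ((v : ℕ) * x.1.m + p) =
      ([x.2.num.toNat, x.2.den] ++ ([x.1.n, x.1.m, x.1.budget] ++ List.ofFn x.1.cost)).length +
        (v * x.1.m + p) := by
    simp; omega
  rw [inputArray, encode, ← List.append_assoc, hidx, List.getD_append_right _ _ _ _ (by omega),
    Nat.add_sub_cancel_left, hflat, List.getD_eq_getElem _ _ (by simpa using hlt),
    List.getElem_ofFn]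
  congr 1
  · ext
    simp [Fin.divNat, hdiv]
  · ext
    simp [Fin.modNat, Nat.mod_eq_of_lt]

section Instance

variable {x : DiverseKnapsack × ℚ} (hm : 0 < x.1.m)
include hm

/-- With at least one item, the utilities alone occupy `n * m ≥ n` cells of the input, so the cutoff
in `voters` has no effect. It matters for `m = 0`, where `n` is written in binary and may be
exponential in the size. -/
theorem profile_n : (profile x).n = x.1.n := by
  show voters x = x.1.n
  have := Nat.le_mul_of_pos_right x.1.n hm
  rw [voters, length_encode]
  omega

omit hm in
theorem profile_c (p : Fin x.1.m) : (profile x).c p = x.1.cost p := inputArray_cost x p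

omit hm in
theorem profile_u (v : Fin x.1.n) (p : Fin x.1.m) : (profile x).u v p = x.1.util v p :=
  inputArray_util x v p

theorem sat_map (S : Finset (Fin x.1.m)) :
    (profile x).sat (S.map Fin.valEmbedding) = x.1.satisfaction S := by
  rw [sat, profile_n hm, satisfaction, Finset.sum_range]
  refine Finset.sum_congr rfl fun v _ => ?_
  rw [Finset.sup_map]
  exact Finset.sup_congr rfl fun p _ => profile_u v p

omit hm in
theorem sum_cost_map (S : Finset (Fin x.1.m)) :
    ∑ p ∈ S.map Fin.valEmbedding, (profile x).c p = ∑ p ∈ S, x.1.cost p := by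
  rw [Finset.sum_map]
  exact Finset.sum_congr rfl fun p _ => profile_c p

/-- An item `z` between `a` and `a'` is either the top or lies on one side of it, and is then at
least as good as whichever of `a`, `a'` is farther out on that side. So no voter ranks `z` below
both. -/
theorem peakedAt_of_singlePeaked (h : x.1.SinglePeaked) : ∃ pos, (profile x).PeakedAt pos := by
  obtain ⟨σ, hσ⟩ := h
  refine ⟨fun p => (σ p : ℕ), fun a b hab => σ.injective (Fin.ext hab), ?_⟩
  suffices H : ∀ a a' z : Fin x.1.m, (profile x).Sep a a' z → (σ a : ℕ) < σ z → (σ a' : ℕ) < σ z by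
    intro a a' z hs
    obtain ⟨v, hv, h₁, h₂⟩ := id hs
    exact ⟨H a a' z hs, H a' a z ⟨v, hv, h₂, h₁⟩⟩
  rintro a a' z ⟨v, hv, h₁, h₂⟩ hlt
  rw [profile_n hm] at hv
  have e := profile_u (x := x) ⟨v, hv⟩
  simp only at e
  rw [e, e] at h₁ h₂
  obtain ⟨top, htop, hpk⟩ := hσ ⟨v, hv⟩
  by_contra hge
  have hne : z ≠ a' := fun h => by rw [h] at h₂; exact lt_irrefl _ h₂
  have hne' : (σ z : ℕ) ≠ σ a' := fun h => hne (σ.injective (Fin.ext h))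
  rcases lt_trichotomy (σ z) (σ top) with h | h | h
  · exact absurd (hpk a z (.inl ⟨hlt, h⟩)) (not_le.2 h₁)
  · rw [σ.injective h] at h₁
    exact absurd (htop a) (not_le.2 h₁)
  · exact absurd (hpk a' z (.inr ⟨h, Fin.lt_def.2 (by omega)⟩)) (not_le.2 h₂)

/-- The voter `g` stands in the first position; a block of consecutive positions that contains the
first one is an initial segment. -/
theorem crossesFrom_of_singleCrossing (h : x.1.SingleCrossing) (hn : 0 < x.1.n) :
    ∃ g < (profile x).n, ∃ pos, (profile x).CrossesFrom g pos := by
  obtain ⟨σ, hσ⟩ := h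
  set g := σ.symm ⟨0, hn⟩ with hg
  refine ⟨g, by rw [profile_n hm]; exact g.2,
    fun v => if h : v < x.1.n then (σ ⟨v, h⟩ : ℕ) else 0, ?_⟩
  intro p hp p' hp' hgp v hv w hw hvw hwp
  rw [profile_n hm] at hv hw
  have e := fun (v : Fin x.1.n) (p : ℕ) (hp : p < x.1.m) => profile_u (x := x) v ⟨p, hp⟩
  rw [e g p hp, e g p' hp'] at hgp
  rw [e ⟨w, hw⟩ p hp, e ⟨w, hw⟩ p' hp'] at hwp
  rw [e ⟨v, hv⟩ p hp, e ⟨v, hv⟩ p' hp']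
  simp only [dif_pos hv, dif_pos hw] at hvw
  obtain ⟨v', hv', hvv⟩ := (hσ ⟨p', hp'⟩ ⟨p, hp⟩).out ⟨g, hgp, rfl⟩ ⟨⟨w, hw⟩, hwp, rfl⟩
    (show σ ⟨v, hv⟩ ∈ Set.Icc (σ g) (σ ⟨w, hw⟩) from
      ⟨by rw [hg, Equiv.apply_symm_apply]; exact Nat.zero_le _, hvw⟩)
  rwa [σ.injective hvv] at hv'

theorem hasWalks {A : ℕ → ℕ} (hA : (profile x).IsClosure A)
    (h : x.1.SinglePeaked ∨ x.1.SingleCrossing) : (profile x).HasWalks A := by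
  have hP := valid_profile hm
  have hpeak : (∃ pos, (profile x).PeakedAt pos) → (profile x).HasWalks A := by
    intro ⟨pos, hpos⟩ S hne hS
    obtain ⟨y, q, hr⟩ := (hasAxis hP hA hpos).exists_walk hP hne hS
    exact ⟨_, le_rfl, y, q, _, _, le_rfl, hr⟩
  rcases h with h | h
  · exact hpeak (peakedAt_of_singlePeaked hm h)
  · rcases Nat.eq_zero_or_pos x.1.n with hn | hn
    -- Without voters there is no `g` to guess, but every order of the items is an axis.
    · refine hpeak ⟨fun p => p, Fin.val_injective, fun a a' z ⟨v, hv, _⟩ => ?_⟩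
      rw [profile_n hm, hn] at hv
      exact absurd hv (Nat.not_lt_zero v)
    · obtain ⟨g, hg, pos, hc⟩ := crossesFrom_of_singleCrossing hm h hn
      exact fun S hne hS => hc.exists_walk hP hg hne hS

end Instance

/-- From `⌈1 / ε⌉₊ ≥ 1 / ε` the ratio is at most `1 + ε`. The bound with `1 - ε` follows from `(1 -
ε) * (1 + ε) ≤ 1` for `ε < 1`, and is trivial otherwise. -/
theorem approx_of_mul_le {ε : ℚ} (hε : 0 < ε) {a b : ℕ}
    (h : ⌈1 / ε⌉₊ * a ≤ (⌈1 / ε⌉₊ + 1) * b) :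
    (1 - ε) * (a : ℚ) ≤ b ∧ (a : ℚ) ≤ (1 + ε) * b := by
  have hk : 1 / ε ≤ (⌈1 / ε⌉₊ : ℚ) := Nat.le_ceil _
  have hk0 : (0 : ℚ) < (⌈1 / ε⌉₊ : ℚ) := lt_of_lt_of_le (by positivity) hk
  rw [div_le_iff₀ hε] at hk
  have h' : (⌈1 / ε⌉₊ : ℚ) * a ≤ (⌈1 / ε⌉₊ + 1) * b := by exact_mod_cast h
  have hb : (0 : ℚ) ≤ b := Nat.cast_nonneg b
  have h₂ : (a : ℚ) ≤ (1 + ε) * b := by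
    refine le_of_mul_le_mul_left ?_ hk0
    nlinarith [mul_le_mul_of_nonneg_right hk hb]
  refine ⟨?_, h₂⟩
  rcases le_or_gt 1 ε with h1 | h1
  · have ha : (0 : ℚ) ≤ a := Nat.cast_nonneg a
    nlinarith [mul_nonneg (sub_nonneg.2 h1) ha]
  · nlinarith [mul_le_mul_of_nonneg_left h₂ (sub_pos.2 h1).le, mul_nonneg (sq_nonneg ε) hb]

/-- The result of the algorithm is a good bundle. -/
theorem exists_bundle {x : DiverseKnapsack × ℚ} (hε : 0 < x.2)
    (hI : x.1.SinglePeaked ∨ x.1.SingleCrossing) {s : Store} (hs : HasResult x s) :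
    ∃ Z : Finset (Fin x.1.m), s.output = x.1.encodeBundle Z ∧ x.1.Feasible Z ∧
      ∀ S : Finset (Fin x.1.m), x.1.Feasible S →
        (1 - x.2) * (x.1.satisfaction S : ℚ) ≤ (x.1.satisfaction Z : ℚ) ∧
        (x.1.satisfaction S : ℚ) ≤ (1 + x.2) * (x.1.satisfaction Z : ℚ) := by
  obtain ⟨h0, hres⟩ := hs
  rcases Nat.eq_zero_or_pos x.1.m with hm | hm
  · have : IsEmpty (Fin x.1.m) := by rw [hm]; infer_instance
    refine ⟨∅, ?_, by simp [Feasible], fun S _ => ?_⟩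
    · refine List.ext_getElem (by simp [Store.output, encodeBundle, h0]) fun i h₁ h₂ => ?_
      simp [encodeBundle, hm] at h₂
    · rw [Finset.eq_empty_of_isEmpty S]
      simp [satisfaction]
  obtain ⟨A, W, D, R, L, T, hA, hT, hout⟩ := hres hm
  obtain ⟨Z, hZm, hZc, hch, hbest⟩ := chosen_approx (valid_profile hm) hT
    (K := ⌈1 / x.2⌉₊) rfl (hasWalks hm hA hI)
  let Z' : Finset (Fin x.1.m) := Finset.univ.filter fun p => (p : ℕ) ∈ Z
  have hZ' : Z'.map Fin.valEmbedding = Z := by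
    ext p
    simp only [Z', Finset.mem_map, Finset.mem_filter, Finset.mem_univ, true_and,
      Fin.valEmbedding_apply]
    exact ⟨fun ⟨a, ha, e⟩ => e ▸ ha, fun hp => ⟨⟨p, hZm p hp⟩, hp, rfl⟩⟩
  refine ⟨Z', ?_, ?_, fun S hS => ?_⟩
  · refine List.ext_getElem (by simp [Store.output, encodeBundle, h0]) fun i h₁ h₂ => ?_
    have hi : i < x.1.m := by simpa [encodeBundle] using h₂
    simp [Store.output, encodeBundle, Z', hout i hi, hch]
  · rw [Feasible, ← sum_cost_map, hZ']
    exact hZc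
  · rw [← sat_map hm S, ← sat_map hm Z', hZ']
    refine approx_of_mul_le hε (hbest _ (fun p hp => ?_) ?_)
    · obtain ⟨a, -, rfl⟩ := Finset.mem_map.1 hp
      exact a.2
    · rw [sum_cost_map]
      exact hS

end DiverseKnapsack

theorem mainTheorem11 :
    ∃ c : RAM.Prog, c.IsFPTASOn (fun I => I.SinglePeaked ∨ I.SingleCrossing) := by
  obtain ⟨c, q, h⟩ := DiverseKnapsack.achieves_result
  refine ⟨c, q, fun I hI ε hε => ?_⟩
  obtain ⟨s, t, he, ht, hs⟩ := h (I, ε) _ (DiverseKnapsack.prepared_one (I, ε) hε)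
  obtain ⟨Z, hout, hfeas, hbest⟩ := DiverseKnapsack.exists_bundle (x := (I, ε)) hε hI hs
  exact ⟨Z, t, ⟨s, he, hout⟩, ht, hfeas, hbest⟩
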